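/- **Setting.** Let $G$ be the universal covering group of $\mathrm{SL}_2(\mathbb R)$, with Lie algebra $\mathfrak g=\mathfrak{sl}_2(\mathbb R)$ and basis $$X_0=\tfrac12\begin{pmatrix}0&-1\\1&0\end{pmatrix},\quad X_1=\tfrac12\begin{pmatrix}1&0\\0&-1\end{pmatrix},\quad X_2=\tfrac12\begin{pmatrix}0&1\\1&0\end{pmatrix},$$ so that $[X_0,X_1]=X_2$, $[X_1,X_2]=-X_0$, $[X_2,X_0]=X_1$. Let $X\in\mathfrak g$ act on $C_c^\infty(G)$ as the right-invariant vector field $(Xf)(g)=\frac{d}{dt}\big|_{t=0}f(\exp(tX)g)$. Put $c(X_k)=i\sigma_k$ with $$\sigma_0=\begin{pmatrix}1&0\\0&-1\end{pmatrix},\quad \sigma_1=\begin{pmatrix}0&1\\1&0\end{pmatrix},\quad \sigma_2=\begin{pmatrix}0&i\\-i&0\end{pmatrix}.$$ The Dirac operator $D=\sum_{k=0}^2X_k\otimes c(X_k)$ on $C_c^\infty(G)\otimes\mathbb C^2$ is regarded as an unbounded operator on the Hilbert module $A\oplus A$ over $A=C^*_r(G)$. For a unitary representation $(V,\pi)$ of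 $G$ that is weakly contained in the regular representation, the localisation of $D$ at $\pi$ is the closed operator $D\otimes1$ on the Hilbert space $(A\oplus A)\otimes_AV$ (the closure of $D\otimes 1$ on the algebraic tensor product of $C_c^\infty(G)\otimes\mathbb C^2$ with $V$), and the spectrum of $D$ localised at $\pi$ is the spectrum of this operator. For $g\in \mathrm{SL}_2(\mathbb R)$ write $gw=\alpha w+\beta\bar w$ as a real-linear map of $\mathbb R^2=\mathbb C$. Then $g$ acts on the closed unit disc by $g\cdot z=(\alpha z+\beta)/(\bar\beta z+\bar\alpha)$, with automorphy factor $J(g,z)=\bar\beta z+\bar\alpha$. Elements of $G$ are the pairs $x=(g,\varphi)$ with $\varphi(x,\cdot)$ a continuous logarithm of $J(g,\cdot)$ on the closed disc, and real powers of $J$ and of $J/|J|$ on $G$ are formed with this logarithm: $J^s=e^{s\varphi}$, $(J/|J|)^{s}=e^{is\operatorname{Im}\varphi}$. * For $q\ge 1/4$ and $0\le\tau\le1$ the principal series representation $\pi_{q,\tau}$ (with Casimir eigenvalue $q$) acts on $L^2$ of the unit circle by $$(\pi_{q,\tau}(x)f)(\zeta)=|J|^{-1-2i\sqrt{q-1/4}}\,(J/|J|)^{-2\tau}\,f(x^{-1}\cdot\zeta),\qquad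 J=J(x^{-1},\zeta).$$ * For $\ell>1/2$ the discrete series representation $\omega_{\ell,+}$ of lowest weight $\ell$ (with Casimir eigenvalue $\ell(1-\ell)$) acts on the holomorphic functions on the unit disc that are square integrable for $(1-|z|^2)^{2\ell-2}dA(z)$ by $(\omega_{\ell,+}(x)f)(z)=J^{-2\ell}f(x^{-1}\cdot z)$, $J=J(x^{-1},z)$. The discrete series representation $\omega_{\ell,-}$ of highest weight $-\ell$ acts in the same way on the antiholomorphic functions with $\overline{J^{-2\ell}}$ in place of $J^{-2\ell}$. **Theorem 3.2.** 1. For all $q\ge1/4$ and $0\le\tau\le1$, the spectrum of $D$ localised at $\pi_{q,\tau}$ is $$\Big\{-\tfrac12\pm\sqrt{\tfrac14+q+2(\tau+k)(\tau+k-1)}\;:\;k\in\mathbb Z\Big\}.$$ 2. For all $\ell>1/2$, the spectrum of $D$ localised at $\omega_{\ell,+}$ agrees with that at $\omega_{\ell,-}$, and both are equal to $$\{-\ell\}\cup\Big\{-\tfrac12\pm\sqrt{\tfrac14+\ell(1-\ell)+2(\ell+k)(\ell+k-1)}\;:\;k=1,2,\ldots\Big\}.$$ -/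

import Mathlib

open MeasureTheory Complex Topology
open scoped ENNReal ComplexConjugate InnerProductSpace TensorProduct ContDiff MatrixGroups

noncomputable section

namespace SL2Dirac

/-! ### The action of `SL(2,ℝ)` on the closed unit disc -/

/-- The complex-linear part of the real-linear map `g` of `ℝ² = ℂ`: one has `g w = α w + β w̄`. -/
def al (g : SL(2, ℝ)) : ℂ := ⟨(g 0 0 + g 1 1) / 2, (g 1 0 - g 0 1) / 2⟩

/-- The antilinear part of the real-linear map `g` of `ℝ² = ℂ`: one has `g w = α w + β w̄`. -/
def be (g : SL(2, ℝ)) : ℂ := ⟨(g 0 0 - g 1 1) / 2, (g 1 0 + g 0 1) / 2⟩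

/-- The denominator `β̄ z + ᾱ` of the fractional linear transformation of the unit disc
attached to `g`; it is the automorphy factor of `g`. -/
def den (g : SL(2, ℝ)) (z : ℂ) : ℂ := conj (be g) * z + conj (al g)

/-- The numerator `α z + β` of the fractional linear transformation attached to `g`. -/
def num (g : SL(2, ℝ)) (z : ℂ) : ℂ := al g * z + be g

/-- The fractional linear transformation `z ↦ (α z + β) / (β̄ z + ᾱ)`. -/
def mob (g : SL(2, ℝ)) (z : ℂ) : ℂ := num g z / den g z

theorem al_one : al 1 = 1 := by
  apply Complex.ext <;> simp [al]

theorem be_one : be 1 = 0 := by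
  apply Complex.ext <;> simp [be]

theorem al_mul (g h : SL(2, ℝ)) : al (g * h) = al g * al h + be g * conj (be h) := by
  apply Complex.ext <;>
    simp [al, be, Matrix.mul_apply, Fin.sum_univ_two] <;> ring

theorem be_mul (g h : SL(2, ℝ)) : be (g * h) = al g * be h + be g * conj (al h) := by
  apply Complex.ext <;>
    simp [al, be, Matrix.mul_apply, Fin.sum_univ_two] <;> ring

theorem normSq_al_sub (g : SL(2, ℝ)) : normSq (al g) - normSq (be g) = 1 := by
  have h := g.det_coe
  rw [Matrix.det_fin_two] at h
  simp only [normSq_apply, al, be]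
  linear_combination h

theorem normSq_den_sub (g : SL(2, ℝ)) (z : ℂ) :
    normSq (den g z) - normSq (num g z) = 1 - normSq z := by
  have h := normSq_al_sub g
  simp only [normSq_apply, den, num, add_re, add_im, mul_re, mul_im, conj_re, conj_im] at h ⊢
  linear_combination (1 - z.re * z.re - z.im * z.im) * h

theorem den_ne_zero (g : SL(2, ℝ)) {z : ℂ} (hz : ‖z‖ ≤ 1) : den g z ≠ 0 := by
  intro h0
  have h1 : conj (al g) = - (conj (be g) * z) := by
    rw [den] at h0
    linear_combination h0
  have h2 : ‖al g‖ = ‖be g‖ * ‖z‖ := by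
    rw [← RCLike.norm_conj (al g), h1, norm_neg, norm_mul, RCLike.norm_conj]
  have h3 := normSq_al_sub g
  rw [normSq_eq_norm_sq, normSq_eq_norm_sq, h2] at h3
  have h4 : ‖z‖ ^ 2 ≤ 1 := by nlinarith [norm_nonneg z]
  nlinarith [sq_nonneg ‖be g‖]

theorem one_sub_normSq_mob (g : SL(2, ℝ)) {z : ℂ} (hz : ‖z‖ ≤ 1) :
    1 - normSq (mob g z) = (1 - normSq z) / normSq (den g z) := by
  have h : normSq (den g z) ≠ 0 := by simpa using den_ne_zero g hz
  rw [mob, normSq_div, ← normSq_den_sub g z]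
  field_simp

theorem norm_mob_le (g : SL(2, ℝ)) {z : ℂ} (hz : ‖z‖ ≤ 1) : ‖mob g z‖ ≤ 1 := by
  have h := one_sub_normSq_mob g hz
  have h1 : 0 ≤ (1 - normSq z) / normSq (den g z) := by
    apply div_nonneg _ (normSq_nonneg _)
    rw [normSq_eq_norm_sq]
    nlinarith [norm_nonneg z]
  rw [← h, normSq_eq_norm_sq] at h1
  nlinarith [norm_nonneg (mob g z)]

theorem norm_mob_lt (g : SL(2, ℝ)) {z : ℂ} (hz : ‖z‖ < 1) : ‖mob g z‖ < 1 := by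
  have h := one_sub_normSq_mob g hz.le
  have h1 : 0 < (1 - normSq z) / normSq (den g z) := by
    apply div_pos _ (normSq_pos.2 (den_ne_zero g hz.le))
    rw [normSq_eq_norm_sq]
    nlinarith [norm_nonneg z]
  rw [← h, normSq_eq_norm_sq] at h1
  nlinarith [norm_nonneg (mob g z)]

theorem norm_mob_eq (g : SL(2, ℝ)) {z : ℂ} (hz : ‖z‖ = 1) : ‖mob g z‖ = 1 := by
  have h := one_sub_normSq_mob g hz.le
  rw [normSq_eq_norm_sq, normSq_eq_norm_sq, hz] at h
  have h1 : (‖mob g z‖ - 1) * (‖mob g z‖ + 1) = 0 := by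
    simp at h
    linear_combination -h
  rcases mul_eq_zero.1 h1 with h2 | h2
  · linarith
  · linarith [norm_nonneg (mob g z)]

theorem den_mul (g h : SL(2, ℝ)) {z : ℂ} (hz : ‖z‖ ≤ 1) :
    den (g * h) z = den g (mob h z) * den h z := by
  have h0 := den_ne_zero h hz
  have : den g (mob h z) * den h z = conj (be g) * num h z + conj (al g) * den h z := by
    rw [den, mob]
    field_simp
  rw [this]
  simp only [den, num, al_mul, be_mul, map_add, map_mul, Complex.conj_conj]
  ring

theorem mob_mul (g h : SL(2, ℝ)) {z : ℂ} (hz : ‖z‖ ≤ 1) :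
    mob (g * h) z = mob g (mob h z) := by
  have h0 := den_ne_zero h hz
  have h1 := den_ne_zero g (norm_mob_le h hz)
  have h2 : num (g * h) z = num g (mob h z) * den h z := by
    have : num g (mob h z) * den h z = al g * num h z + be g * den h z := by
      rw [num, mob]
      field_simp
    rw [this]
    simp only [den, num, al_mul, be_mul]
    ring
  rw [mob, h2, den_mul g h hz, mul_div_mul_right _ _ h0, ← mob]

theorem mob_one (z : ℂ) : mob 1 z = z := by
  simp [mob, num, den, al_one, be_one]

theorem den_one (z : ℂ) : den 1 z = 1 := by
  simp [den, al_one, be_one]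

theorem continuous_entry (i j : Fin 2) : Continuous fun g : SL(2, ℝ) => g i j :=
  (continuous_apply_apply i j).comp continuous_subtype_val

theorem continuous_al : Continuous al := by
  have : al = fun g : SL(2, ℝ) => (((g 0 0 + g 1 1) / 2 : ℝ) : ℂ) + (((g 1 0 - g 0 1) / 2 : ℝ) : ℂ) * I := by
    funext g; apply Complex.ext <;> simp [al]
  rw [this]
  have := continuous_entry
  fun_prop

theorem continuous_be : Continuous be := by
  have : be = fun g : SL(2, ℝ) => (((g 0 0 - g 1 1) / 2 : ℝ) : ℂ) + (((g 1 0 + g 0 1) / 2 : ℝ) : ℂ) * I := by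
    funext g; apply Complex.ext <;> simp [be]
  rw [this]
  have := continuous_entry
  fun_prop

theorem continuous_den : Continuous fun p : SL(2, ℝ) × ℂ => den p.1 p.2 := by
  have := continuous_al
  have := continuous_be
  unfold den
  fun_prop

theorem continuous_num : Continuous fun p : SL(2, ℝ) × ℂ => num p.1 p.2 := by
  have := continuous_al
  have := continuous_be
  unfold num
  fun_prop

/-- The closed unit disc. -/
abbrev Disc : Type := Metric.closedBall (0 : ℂ) 1

theorem Disc.norm_le (z : Disc) : ‖(z : ℂ)‖ ≤ 1 := mem_closedBall_zero_iff.1 z.2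

/-- The homeomorphism of the closed disc given by the fractional linear transformation of `g`,
as a continuous map. -/
def mobD (g : SL(2, ℝ)) : C(Disc, Disc) where
  toFun z := ⟨mob g z, mem_closedBall_zero_iff.2 (norm_mob_le g z.norm_le)⟩
  continuous_toFun := by
    refine Continuous.subtype_mk ?_ _
    refine Continuous.div ?_ ?_ fun z => den_ne_zero g z.norm_le
    · exact continuous_num.comp (by fun_prop : Continuous fun z : Disc => (g, (z : ℂ)))
    · exact continuous_den.comp (by fun_prop : Continuous fun z : Disc => (g, (z : ℂ)))

@[simp] theorem coe_mobD (g : SL(2, ℝ)) (z : Disc) : (mobD g z : ℂ) = mob g z := rfl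

theorem mobD_mul (g h : SL(2, ℝ)) (z : Disc) : mobD (g * h) z = mobD g (mobD h z) :=
  Subtype.ext (mob_mul g h z.norm_le)

theorem mobD_one (z : Disc) : mobD 1 z = z := Subtype.ext (mob_one z)

theorem continuous_mobD_uncurry : Continuous fun p : SL(2, ℝ) × Disc => mobD p.1 p.2 := by
  have e : Continuous fun p : SL(2, ℝ) × Disc => (p.2 : ℂ) :=
    continuous_subtype_val.comp continuous_snd
  have a := continuous_al.comp (continuous_fst (X := SL(2, ℝ)) (Y := Disc))
  have b := continuous_be.comp (continuous_fst (X := SL(2, ℝ)) (Y := Disc))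
  have h1 : Continuous fun p : SL(2, ℝ) × Disc => num p.1 p.2 := (a.mul e).add b
  have h2 : Continuous fun p : SL(2, ℝ) × Disc => den p.1 p.2 :=
    ((Complex.continuous_conj.comp b).mul e).add (Complex.continuous_conj.comp a)
  have h3 : ∀ p : SL(2, ℝ) × Disc, den p.1 p.2 ≠ 0 :=
    fun p => den_ne_zero p.1 (Disc.norm_le p.2)
  have h4 : Continuous fun p : SL(2, ℝ) × Disc => mob p.1 p.2 := h1.div h2 h3
  exact Continuous.subtype_mk h4 _

theorem continuous_mobD : Continuous mobD :=
  ContinuousMap.continuous_of_continuous_uncurry mobD continuous_mobD_uncurry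

/-! ### The universal covering group -/

/-- The universal covering group `G` of `SL(2,ℝ)`: its points are the pairs `(g, φ)` of an element
`g` of `SL(2,ℝ)` and a continuous logarithm `φ` of the automorphy factor `z ↦ β̄ z + ᾱ` of `g`
on the closed unit disc.  The covering map is `(g, φ) ↦ g`; its fibres are torsors under
`2πiℤ`, and the loop of rotations that generates the fundamental group of `SL(2,ℝ)` lifts to a
path from `φ = 0` to `φ = -2πi`. -/
@[ext] structure Cover where
  /-- the image in `SL(2,ℝ)` -/
  g : SL(2, ℝ)
  /-- the logarithm of the automorphy factor -/
  φ : C(Disc, ℂ)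
  exp_φ : ∀ z : Disc, Complex.exp (φ z) = den g z

namespace Cover

instance : Mul Cover where
  mul x y := ⟨x.g * y.g, x.φ.comp (mobD y.g) + y.φ, fun z => by
    simp [Complex.exp_add, x.exp_φ, y.exp_φ, den_mul x.g y.g z.norm_le]⟩

instance : One Cover where
  one := ⟨1, 0, fun z => by simp [den_one]⟩

instance : Inv Cover where
  inv x := ⟨x.g⁻¹, -(x.φ.comp (mobD x.g⁻¹)), fun z => by
    have h := den_mul x.g x.g⁻¹ z.norm_le
    rw [mul_inv_cancel, den_one] at h
    simp only [ContinuousMap.neg_apply, ContinuousMap.comp_apply, Complex.exp_neg, x.exp_φ, coe_mobD]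
    exact (eq_inv_of_mul_eq_one_right h.symm).symm⟩

@[simp] theorem mul_g (x y : Cover) : (x * y).g = x.g * y.g := rfl
@[simp] theorem one_g : (1 : Cover).g = 1 := rfl
@[simp] theorem inv_g (x : Cover) : (x⁻¹).g = x.g⁻¹ := rfl
@[simp] theorem mul_φ (x y : Cover) (z : Disc) : (x * y).φ z = x.φ (mobD y.g z) + y.φ z := rfl
@[simp] theorem one_φ (z : Disc) : (1 : Cover).φ z = 0 := rfl
@[simp] theorem inv_φ (x : Cover) (z : Disc) : (x⁻¹).φ z = -x.φ (mobD x.g⁻¹ z) := rfl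

instance : Group Cover :=
  Group.ofLeftAxioms
    (fun x y z => Cover.ext (mul_assoc _ _ _) (by
      ext w
      simp [mobD_mul, add_assoc]))
    (fun x => Cover.ext (one_mul _) (by ext w; simp))
    (fun x => Cover.ext (inv_mul_cancel _) (by
      ext w
      simp [← mobD_mul, mobD_one]))

/-- The topology of `G` is induced from `SL(2,ℝ) × C(Disc, ℂ)`. -/
instance : TopologicalSpace Cover :=
  TopologicalSpace.induced (fun x => (x.g, x.φ)) inferInstance

theorem isInducing : IsInducing fun x : Cover => (x.g, x.φ) := ⟨rfl⟩

theorem continuous_g : Continuous fun x : Cover => x.g := continuous_fst.comp isInducing.continuous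

theorem continuous_φ : Continuous fun x : Cover => x.φ := continuous_snd.comp isInducing.continuous

instance : IsTopologicalGroup Cover where
  continuous_mul := by
    refine isInducing.continuous_iff.2 ?_
    have h1 := continuous_g
    have h2 := continuous_φ
    have h3 := continuous_mobD
    refine Continuous.prodMk (by simpa using by fun_prop) ?_
    exact ((h2.comp continuous_fst).compCM (h3.comp (h1.comp continuous_snd))).add
      (h2.comp continuous_snd)
  continuous_inv := by
    refine isInducing.continuous_iff.2 ?_
    have h1 := continuous_g
    have h2 := continuous_φ
    have h3 := continuous_mobD
    refine Continuous.prodMk (h1.inv) ?_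
    exact (h2.compCM (h3.comp h1.inv)).neg

instance : T2Space Cover :=
  T2Space.of_injective_continuous (f := fun x : Cover => (x.g, x.φ))
    (fun _ _ h => Cover.ext (congrArg Prod.fst h) (congrArg Prod.snd h)) isInducing.continuous

instance : MeasurableSpace Cover := borel Cover
instance : BorelSpace Cover := ⟨rfl⟩

instance : SecondCountableTopology SL(2, ℝ) :=
  haveI : SecondCountableTopology (Matrix (Fin 2) (Fin 2) ℝ) :=
    inferInstanceAs (SecondCountableTopology (Fin 2 → Fin 2 → ℝ))
  (IsInducing.subtypeVal (t := {A : Matrix (Fin 2) (Fin 2) ℝ | A.det = 1})).secondCountableTopology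
instance : SecondCountableTopology Cover := isInducing.secondCountableTopology

theorem continuous_φ_uncurry : Continuous fun p : Cover × Disc => p.1.φ p.2 := by
  have h2 := continuous_φ
  exact (h2.comp continuous_fst).eval continuous_snd

end Cover

/-! ### One-parameter subgroups and smooth functions -/

/-- An element of `SL(2,ℝ)` whose automorphy factor has positive real part on the closed disc,
lifted to `G` by means of the principal logarithm. -/
def posLift (g : SL(2, ℝ)) (h : ∀ z : Disc, 0 < (den g z).re) : Cover where
  g := g
  φ := ⟨fun z => Complex.log (den g z), by
    refine Continuous.clog ?_ fun z => Or.inl (h z)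
    exact (continuous_const.mul continuous_subtype_val).add continuous_const⟩
  exp_φ z := Complex.exp_log (den_ne_zero g z.norm_le)

/-- The rotation `exp (t X₀)` in `SL(2,ℝ)`, where `X₀ = ½ !![0, -1; 1, 0]`. -/
def mat0 (t : ℝ) : SL(2, ℝ) :=
  ⟨!![Real.cos (t / 2), -Real.sin (t / 2); Real.sin (t / 2), Real.cos (t / 2)], by
    rw [Matrix.det_fin_two_of]
    linear_combination Real.cos_sq_add_sin_sq (t / 2)⟩

/-- The matrix `exp (t X₁)` in `SL(2,ℝ)`, where `X₁ = ½ !![1, 0; 0, -1]`. -/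
def mat1 (t : ℝ) : SL(2, ℝ) :=
  ⟨!![Real.exp (t / 2), 0; 0, Real.exp (-(t / 2))], by
    rw [Matrix.det_fin_two_of, ← Real.exp_add]
    simp⟩

/-- The matrix `exp (t X₂)` in `SL(2,ℝ)`, where `X₂ = ½ !![0, 1; 1, 0]`. -/
def mat2 (t : ℝ) : SL(2, ℝ) :=
  ⟨!![Real.cosh (t / 2), Real.sinh (t / 2); Real.sinh (t / 2), Real.cosh (t / 2)], by
    rw [Matrix.det_fin_two_of]
    linear_combination Real.cosh_sq_sub_sinh_sq (t / 2)⟩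

theorem al_mat0 (t : ℝ) : al (mat0 t) = Complex.exp ((t / 2 : ℝ) * I) := by
  rw [Complex.exp_mul_I]
  apply Complex.ext <;> simp [al, mat0, ← Complex.ofReal_cos, ← Complex.ofReal_sin, -Complex.ofReal_div]

theorem be_mat0 (t : ℝ) : be (mat0 t) = 0 := by
  apply Complex.ext <;> simp [be, mat0]

theorem al_mat1 (t : ℝ) : al (mat1 t) = (Real.cosh (t / 2) : ℂ) := by
  apply Complex.ext <;> simp [al, mat1, Real.cosh_eq, -Complex.ofReal_cosh, -Complex.ofReal_exp, -Complex.ofReal_neg,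
    -Complex.ofReal_div, -Complex.ofReal_add]

theorem be_mat1 (t : ℝ) : be (mat1 t) = (Real.sinh (t / 2) : ℂ) := by
  apply Complex.ext <;> simp [be, mat1, Real.sinh_eq, -Complex.ofReal_sinh, -Complex.ofReal_exp, -Complex.ofReal_neg,
    -Complex.ofReal_div, -Complex.ofReal_sub]


theorem al_mat2 (t : ℝ) : al (mat2 t) = (Real.cosh (t / 2) : ℂ) := by
  apply Complex.ext <;> simp [al, mat2, -Complex.ofReal_cosh]

theorem be_mat2 (t : ℝ) : be (mat2 t) = (Real.sinh (t / 2) : ℂ) * I := by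
  apply Complex.ext <;> simp [be, mat2, -Complex.ofReal_sinh]

theorem cosh_add_sinh_mul_pos (t : ℝ) {a : ℝ} (ha : |a| ≤ 1) :
    0 < Real.cosh t + Real.sinh t * a := by
  have h1 := Real.cosh_sq_sub_sinh_sq t
  have h2 := Real.cosh_pos t
  have h3 : |Real.sinh t * a| < Real.cosh t := by
    rw [abs_mul]
    have h4 : |Real.sinh t| < Real.cosh t := abs_lt_of_sq_lt_sq (by linarith) h2.le
    nlinarith [abs_nonneg (Real.sinh t), abs_nonneg a]
  linarith [neg_abs_le (Real.sinh t * a)]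

theorem re_den_mat1 (t : ℝ) {z : ℂ} (hz : ‖z‖ ≤ 1) : 0 < (den (mat1 t) z).re := by
  have h := cosh_add_sinh_mul_pos (t / 2) ((Complex.abs_re_le_norm z).trans hz)
  simp only [den, al_mat1, be_mat1, Complex.conj_ofReal, add_re, Complex.re_ofReal_mul, ofReal_re]
  linarith

theorem re_den_mat2 (t : ℝ) {z : ℂ} (hz : ‖z‖ ≤ 1) : 0 < (den (mat2 t) z).re := by
  have h := cosh_add_sinh_mul_pos (t / 2) ((Complex.abs_im_le_norm z).trans hz)
  simp only [den, al_mat2, be_mat2, map_mul, Complex.conj_ofReal, Complex.conj_I, add_re, mul_re,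
    ofReal_re, ofReal_im, neg_re, neg_im, I_re, I_im, mul_im]
  linarith

/-- The one-parameter subgroups `t ↦ exp (t Xₖ)` of `G`, for the basis
`X₀ = ½ !![0, -1; 1, 0]`, `X₁ = ½ !![1, 0; 0, -1]`, `X₂ = ½ !![0, 1; 1, 0]` of `sl₂(ℝ)`,
which satisfies `[X₀, X₁] = X₂`, `[X₁, X₂] = -X₀`, `[X₂, X₀] = X₁`. -/
def expX (k : Fin 3) (t : ℝ) : Cover :=
  match k with
  | 0 => ⟨mat0 t, ContinuousMap.const _ (-((t / 2 : ℝ) * I)), fun z => by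
      rw [den, be_mat0, al_mat0, ← Complex.exp_conj, map_mul, Complex.conj_ofReal, Complex.conj_I]
      simp⟩
  | 1 => posLift (mat1 t) fun z => re_den_mat1 t z.norm_le
  | 2 => posLift (mat2 t) fun z => re_den_mat2 t z.norm_le

theorem continuous_SL_of {X : Type*} [TopologicalSpace X] {f : X → SL(2, ℝ)}
    (h : ∀ i j, Continuous fun x => f x i j) : Continuous f :=
  Continuous.subtype_mk (continuous_matrix h) _

theorem continuous_mat1 : Continuous mat1 := by
  refine continuous_SL_of fun i j => ?_
  fin_cases i <;> fin_cases j <;> simp [mat1] <;> fun_prop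

theorem continuous_mat2 : Continuous mat2 := by
  refine continuous_SL_of fun i j => ?_
  fin_cases i <;> fin_cases j <;> simp [mat2] <;> fun_prop

theorem continuous_mat0 : Continuous mat0 := by
  refine continuous_SL_of fun i j => ?_
  fin_cases i <;> fin_cases j <;> simp [mat0] <;> fun_prop

theorem continuous_den_disc {m : ℝ → SL(2, ℝ)} (hm : Continuous m) :
    Continuous fun p : ℝ × Disc => den (m p.1) p.2 := by
  have e : Continuous fun p : ℝ × Disc => (p.2 : ℂ) := continuous_subtype_val.comp continuous_snd
  have a := continuous_al.comp (hm.comp (continuous_fst (X := ℝ) (Y := Disc)))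
  have b := continuous_be.comp (hm.comp (continuous_fst (X := ℝ) (Y := Disc)))
  exact ((Complex.continuous_conj.comp b).mul e).add (Complex.continuous_conj.comp a)

theorem continuous_expX (k : Fin 3) : Continuous (expX k) := by
  refine Cover.isInducing.continuous_iff.2 ?_
  fin_cases k
  · refine continuous_mat0.prodMk (ContinuousMap.continuous_of_continuous_uncurry _ ?_)
    have : Continuous fun p : ℝ × Disc => -((p.1 / 2 : ℝ) * I : ℂ) := by fun_prop
    exact this
  · refine continuous_mat1.prodMk (ContinuousMap.continuous_of_continuous_uncurry _ ?_)
    exact (continuous_den_disc continuous_mat1).clog fun p => Or.inl (re_den_mat1 p.1 p.2.norm_le)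
  · refine continuous_mat2.prodMk (ContinuousMap.continuous_of_continuous_uncurry _ ?_)
    exact (continuous_den_disc continuous_mat2).clog fun p => Or.inl (re_den_mat2 p.1 p.2.norm_le)

theorem expX_zero (k : Fin 3) : expX k 0 = 1 := by
  have h1 : mat1 0 = 1 := by
    apply Subtype.ext; ext i j; fin_cases i <;> fin_cases j <;> simp [mat1]
  have h2 : mat2 0 = 1 := by
    apply Subtype.ext; ext i j; fin_cases i <;> fin_cases j <;> simp [mat2]
  have h0 : mat0 0 = 1 := by
    apply Subtype.ext; ext i j; fin_cases i <;> fin_cases j <;> simp [mat0]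
  fin_cases k
  · refine Cover.ext h0 (ContinuousMap.ext fun z => ?_)
    simp [expX]
  · refine Cover.ext h1 (ContinuousMap.ext fun z => ?_)
    change Complex.log (den (mat1 0) z) = 0
    rw [h1, den_one, Complex.log_one]
  · refine Cover.ext h2 (ContinuousMap.ext fun z => ?_)
    change Complex.log (den (mat2 0) z) = 0
    rw [h2, den_one, Complex.log_one]

/-- The centre of the disc. -/
def ctr : Disc := ⟨0, by simp⟩

/-- The global coordinates `(g, φ) ↦ (Im φ(0), β)` on `G`.  Since `ᾱ = exp φ(0)` and
`|α|² = 1 + |β|²`, they identify `G` with the manifold `ℝ × ℂ`. -/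
def coord (x : Cover) : ℝ × ℂ := ((x.φ ctr).im, be x.g)

theorem continuous_coord : Continuous coord := by
  have h := Cover.continuous_φ
  refine Continuous.prodMk (Complex.continuous_im.comp ?_) (continuous_be.comp Cover.continuous_g)
  exact h.eval_const ctr

/-- `ᾱ` as a function of the coordinates. -/
def cal (c : ℝ × ℂ) : ℂ := (√(1 + normSq c.2) : ℝ) * Complex.exp (c.1 * I)

theorem conj_al_eq (x : Cover) : conj (al x.g) = cal (coord x) := by
  have h1 : Complex.exp (x.φ ctr) = conj (al x.g) := by
    rw [x.exp_φ]; simp [den, ctr]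
  have h2 : ‖al x.g‖ ^ 2 = 1 + normSq (be x.g) := by
    rw [← normSq_eq_norm_sq]; linarith [normSq_al_sub x.g]
  have h3 : Real.exp (x.φ ctr).re = √(1 + normSq (be x.g)) := by
    rw [← h2, Real.sqrt_sq (norm_nonneg _), ← RCLike.norm_conj (al x.g), ← h1, Complex.norm_exp]
  rw [← h1, cal, coord, ← h3, Complex.ofReal_exp, ← Complex.exp_add, Complex.re_add_im]

theorem contDiff_normSq : ContDiff ℝ ∞ (fun z : ℂ => normSq z) := by
  have : (fun z : ℂ => normSq z) = fun z => z.re * z.re + z.im * z.im := by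
    funext z; exact normSq_apply z
  rw [this]
  have h1 : ContDiff ℝ ∞ Complex.re := Complex.reCLM.contDiff
  have h2 : ContDiff ℝ ∞ Complex.im := Complex.imCLM.contDiff
  fun_prop

theorem contDiff_ofReal' : ContDiff ℝ ∞ (fun r : ℝ => (r : ℂ)) := Complex.ofRealCLM.contDiff

theorem contDiff_cexp' : ContDiff ℝ ∞ Complex.exp := ContDiff.restrict_scalars ℝ (𝕜' := ℂ) Complex.contDiff_exp

theorem contDiff_cal : ContDiff ℝ ∞ cal := by
  have h1 : ContDiff ℝ ∞ fun c : ℝ × ℂ => √(1 + normSq c.2) := by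
    refine ContDiff.sqrt (contDiff_const.add (contDiff_normSq.comp contDiff_snd)) fun c => ?_
    have := normSq_nonneg c.2
    positivity
  refine (contDiff_ofReal'.comp h1).mul (contDiff_cexp'.comp ?_)
  exact (contDiff_ofReal'.comp contDiff_fst).mul contDiff_const

theorem cal_ne_zero (c : ℝ × ℂ) : cal c ≠ 0 := by
  have := normSq_nonneg c.2
  have h : √(1 + normSq c.2) ≠ 0 := by positivity
  exact mul_ne_zero (by exact_mod_cast h) (Complex.exp_ne_zero _)

theorem norm_div_cal_le (c : ℝ × ℂ) : ‖c.2 / cal c‖ ≤ 1 := by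
  have h : ‖cal c‖ = √(1 + normSq c.2) := by
    rw [cal, norm_mul, Complex.norm_exp_ofReal_mul_I, mul_one, Complex.norm_real,
      Real.norm_of_nonneg (Real.sqrt_nonneg _)]
  rw [norm_div, h]
  refine div_le_one_of_le₀ ?_ (Real.sqrt_nonneg _)
  rw [normSq_eq_norm_sq]
  exact Real.le_sqrt_of_sq_le (by linarith)

theorem mobD_ctr (x : Cover) : (mobD x.g ctr : ℂ) = (coord x).2 / cal (coord x) := by
  rw [← conj_al_eq]
  simp [mob, num, den, ctr, coord]

/-- In the coordinates, left translation by `exp (t Xₖ)` is smooth, jointly in `t` and the point. -/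
theorem exists_coord_expX_mul (k : Fin 3) : ∃ Ψ : ℝ × (ℝ × ℂ) → ℝ × ℂ, ContDiff ℝ ∞ Ψ ∧
    ∀ t x, coord (expX k t * x) = Ψ (t, coord x) := by
  have hconj : ContDiff ℝ ∞ (fun z : ℂ => conj z) := Complex.conjCLE.contDiff
  have hcal : ContDiff ℝ ∞ fun p : ℝ × (ℝ × ℂ) => cal p.2 := contDiff_cal.comp contDiff_snd
  have hb : ContDiff ℝ ∞ fun p : ℝ × (ℝ × ℂ) => p.2.2 := contDiff_snd.comp contDiff_snd
  have hs : ContDiff ℝ ∞ fun p : ℝ × (ℝ × ℂ) => p.2.1 := contDiff_fst.comp contDiff_snd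
  have hw : ContDiff ℝ ∞ fun p : ℝ × (ℝ × ℂ) => p.2.2 / cal p.2 := by
    simp only [div_eq_mul_inv]
    exact hb.mul (hcal.inv fun p => cal_ne_zero p.2)
  have key : ∀ m : ℝ → SL(2, ℝ), (∀ t, ∀ {z : ℂ}, ‖z‖ ≤ 1 → 0 < (den (m t) z).re) →
      ContDiff ℝ ∞ (fun t => al (m t)) → ContDiff ℝ ∞ (fun t => be (m t)) →
      ContDiff ℝ ∞ fun p : ℝ × (ℝ × ℂ) =>
        ((Complex.log (den (m p.1) (p.2.2 / cal p.2))).im + p.2.1,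
          al (m p.1) * p.2.2 + be (m p.1) * cal p.2) := by
    intro m hm ha hβ
    have hd : ContDiff ℝ ∞ fun p : ℝ × (ℝ × ℂ) => den (m p.1) (p.2.2 / cal p.2) :=
      ((hconj.comp (hβ.comp contDiff_fst)).mul hw).add (hconj.comp (ha.comp contDiff_fst))
    have hl : ContDiff ℝ ∞ fun p : ℝ × (ℝ × ℂ) =>
        Complex.log (den (m p.1) (p.2.2 / cal p.2)) := by
      refine contDiff_iff_contDiffAt.2 fun p => ?_
      have h1 : ContDiffAt ℝ ∞ Complex.log (den (m p.1) (p.2.2 / cal p.2)) :=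
        (Complex.contDiffAt_log (Or.inl (hm p.1 (norm_div_cal_le p.2)))).restrict_scalars ℝ
      exact h1.comp p hd.contDiffAt
    exact ((Complex.imCLM.contDiff.comp hl).add hs).prodMk
      (((ha.comp contDiff_fst).mul hb).add ((hβ.comp contDiff_fst).mul hcal))
  have hcosh : ContDiff ℝ ∞ fun t : ℝ => ((Real.cosh (t / 2) : ℝ) : ℂ) :=
    contDiff_ofReal'.comp (Real.contDiff_cosh.comp (contDiff_id.div_const 2))
  have hsinh : ContDiff ℝ ∞ fun t : ℝ => ((Real.sinh (t / 2) : ℝ) : ℂ) :=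
    contDiff_ofReal'.comp (Real.contDiff_sinh.comp (contDiff_id.div_const 2))
  have hbe : ∀ (y x : Cover), (coord (y * x)).2 = al y.g * (coord x).2 + be y.g * cal (coord x) := by
    intro y x
    rw [← conj_al_eq]
    exact be_mul y.g x.g
  fin_cases k
  · refine ⟨fun p => (-(p.1 / 2) + p.2.1, Complex.exp ((p.1 / 2 : ℝ) * I) * p.2.2), ?_, ?_⟩
    · refine ContDiff.prodMk ((contDiff_fst.div_const 2).neg.add hs) (ContDiff.mul ?_ hb)
      exact contDiff_cexp'.comp ((contDiff_ofReal'.comp (contDiff_fst.div_const 2)).mul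
        contDiff_const)
    · intro t x
      refine Prod.ext ?_ ?_
      · simp [coord, expX]
      · change (coord (expX 0 t * x)).2 = _
        rw [hbe]
        simp [expX, al_mat0, be_mat0]
  · refine ⟨_, key mat1 re_den_mat1 ?_ ?_, ?_⟩
    · simpa only [al_mat1] using hcosh
    · simpa only [be_mat1] using hsinh
    · intro t x
      refine Prod.ext ?_ (hbe _ _)
      change (Complex.log (den (mat1 t) (mobD x.g ctr)) + x.φ ctr).im = _
      rw [mobD_ctr, Complex.add_im]
      rfl
  · refine ⟨_, key mat2 re_den_mat2 ?_ ?_, ?_⟩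
    · simpa only [al_mat2] using hcosh
    · simpa only [be_mat2] using hsinh.mul contDiff_const
    · intro t x
      refine Prod.ext ?_ (hbe _ _)
      change (Complex.log (den (mat2 t) (mobD x.g ctr)) + x.φ ctr).im = _
      rw [mobD_ctr, Complex.add_im]
      rfl

/-- The space `C_c^∞(G)` of smooth compactly supported functions on `G`. -/
def TestFun : Submodule ℂ (Cover → ℂ) where
  carrier := {f | HasCompactSupport f ∧
    ∃ F : ℝ × ℂ → ℂ, ContDiff ℝ ∞ F ∧ ∀ x, f x = F (coord x)}
  add_mem' := by
    rintro f f' ⟨h1, F, hF, h2⟩ ⟨h1', F', hF', h2'⟩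
    exact ⟨h1.add h1', F + F', hF.add hF', fun x => by simp [h2, h2']⟩
  zero_mem' := ⟨HasCompactSupport.zero, 0, contDiff_const, fun x => rfl⟩
  smul_mem' := by
    rintro a f ⟨h1, F, hF, h2⟩
    refine ⟨h1.smul_left (f := fun _ => a), a • F, contDiff_const.smul hF, fun x => by simp [h2]⟩

theorem TestFun.continuous (f : TestFun) : Continuous f.1 := by
  obtain ⟨-, F, hF, h⟩ := f.2
  rw [funext h]
  exact hF.continuous.comp continuous_coord

theorem TestFun.hasDerivAt (k : Fin 3) (f : TestFun) (x : Cover) :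
    DifferentiableAt ℝ (fun t => f.1 (expX k t * x)) 0 := by
  obtain ⟨-, F, hF, h⟩ := f.2
  obtain ⟨Ψ, hΨ, hc⟩ := exists_coord_expX_mul k
  have e : (fun t => f.1 (expX k t * x)) = fun t => F (Ψ (t, coord x)) := by
    funext t; rw [h, hc]
  rw [e]
  have : ContDiff ℝ ∞ fun t : ℝ => F (Ψ (t, coord x)) :=
    hF.comp (hΨ.comp (contDiff_id.prodMk contDiff_const))
  exact this.differentiable (by simp) 0

/-- The right-invariant vector field attached to `Xₖ`, as an operator on `C_c^∞(G)`:
`(Xₖ f)(x) = d/dt f(exp (t Xₖ) x)` at `t = 0`. -/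
def vfield (k : Fin 3) : TestFun →ₗ[ℂ] TestFun where
  toFun f := ⟨fun x => deriv (fun t : ℝ => f.1 (expX k t * x)) 0, by
    obtain ⟨hs, F, hF, h⟩ := f.2
    obtain ⟨Ψ, hΨ, hc⟩ := exists_coord_expX_mul k
    constructor
    · refine HasCompactSupport.intro hs fun x hx => ?_
      have h1 : ∀ᶠ y in 𝓝 x, f.1 y = 0 := by
        filter_upwards [(isClosed_tsupport f.1).isOpen_compl.mem_nhds hx] with y hy
        exact image_eq_zero_of_notMem_tsupport hy
      have h2 : Filter.Tendsto (fun t : ℝ => expX k t * x) (𝓝 0) (𝓝 x) := by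
        have h3 : Continuous fun t : ℝ => expX k t * x := (continuous_expX k).mul continuous_const
        simpa [expX_zero] using h3.tendsto 0
      have h4 : (fun t : ℝ => f.1 (expX k t * x)) =ᶠ[𝓝 0] fun _ => 0 := h2.eventually h1
      rw [h4.deriv_eq, deriv_const]
    · refine ⟨fun c => fderiv ℝ (F ∘ Ψ) (0, c) (1, 0), ?_, fun x => ?_⟩
      · have h1 : ContDiff ℝ ∞ (fderiv ℝ (F ∘ Ψ)) := (hF.comp hΨ).fderiv_right (by simp)
        exact (h1.comp (contDiff_const.prodMk contDiff_id)).clm_apply contDiff_const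
      · have e : (fun t => f.1 (expX k t * x)) = fun t => (F ∘ Ψ) (t, coord x) := by
          funext t; rw [h, hc]; rfl
        change deriv (fun t => f.1 (expX k t * x)) 0 = _
        rw [e]
        have h1 : HasFDerivAt (F ∘ Ψ) (fderiv ℝ (F ∘ Ψ) (0, coord x)) (0, coord x) :=
          ((hF.comp hΨ).differentiable (by simp) _).hasFDerivAt
        have h2 : HasDerivAt (fun t : ℝ => (t, coord x)) ((1 : ℝ), (0 : ℝ × ℂ)) 0 :=
          (hasDerivAt_id (0 : ℝ)).prodMk (hasDerivAt_const (0 : ℝ) (coord x))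
        exact (h1.comp_hasDerivAt (0 : ℝ) h2).deriv⟩
  map_add' f f' := by
    apply Subtype.ext; funext x
    exact deriv_fun_add (TestFun.hasDerivAt k f x) (TestFun.hasDerivAt k f' x)
  map_smul' a f := by
    apply Subtype.ext; funext x
    exact deriv_const_mul a (TestFun.hasDerivAt k f x)

/-! ### The Dirac operator -/

/-- Compactly supported smooth `2`-spinor fields on `G`, that is, `C_c^∞(G) ⊕ C_c^∞(G)`. -/
abbrev Spinor : Type := Fin 2 → TestFun

/-- The matrices `σ₀`, `σ₁`, `σ₂`. -/
def sigma : Fin 3 → Matrix (Fin 2) (Fin 2) ℂ :=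
  ![!![1, 0; 0, -1], !![0, 1; 1, 0], !![0, I; -I, 0]]

/-- Clifford multiplication `c(Xₖ) = i σₖ` on the space `ℂ²` of spinors. -/
def cliff (k : Fin 3) : Matrix (Fin 2) (Fin 2) ℂ := I • sigma k

theorem cliff_sq (k : Fin 3) : cliff k * cliff k = -1 := by
  fin_cases k <;> ext i j <;> fin_cases i <;> fin_cases j <;>
    simp [cliff, sigma, Matrix.mul_apply, Fin.sum_univ_two]

theorem cliff_anticomm (j k : Fin 3) (h : j ≠ k) : cliff j * cliff k = -(cliff k * cliff j) := by
  fin_cases j <;> fin_cases k <;> (try exact absurd rfl h) <;> ext i j <;> fin_cases i <;>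
    fin_cases j <;> simp [cliff, sigma, Matrix.mul_apply, Fin.sum_univ_two]

/-- The Dirac operator `D = X₀ ⊗ c(X₀) + X₁ ⊗ c(X₁) + X₂ ⊗ c(X₂)` on spinor fields. -/
def dirac : Spinor →ₗ[ℂ] Spinor :=
  LinearMap.pi fun i => ∑ k : Fin 3, ∑ j : Fin 2, cliff k i j • (vfield k ∘ₗ LinearMap.proj j)


set_option linter.unusedSectionVars false

/-! ### Unitary representations and localisation -/

/-- A unitary representation of `G`: a strongly continuous homomorphism into the unitary group of
a Hilbert space. -/
structure UnitaryRep (V : Type*) [NormedAddCommGroup V] [InnerProductSpace ℂ V] where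
  /-- the homomorphism into the unitary group -/
  hom : Cover →* (V ≃ₗᵢ[ℂ] V)
  continuous_hom : ∀ v, Continuous fun x => hom x v

section Localisation

variable {V : Type*} [NormedAddCommGroup V] [InnerProductSpace ℂ V] [CompleteSpace V]

/-- The integrated form `π(a) v = ∫ a(x) π(x) v dx` of a unitary representation. -/
def UnitaryRep.intg (μ : Measure Cover) (π : UnitaryRep V) (a : Cover → ℂ) (v : V) : V :=
  ∫ x, a x • π.hom x v ∂μ

/-- The function-valued inner product `⟨ξ, η⟩ = ξ₀^* * η₀ + ξ₁^* * η₁` on spinor fields, where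
`(a^* * b)(x) = ∫ conj (a(y)) b(y x) dy`.  It is the restriction to `C_c^∞(G) ⊕ C_c^∞(G)` of the
inner product of the Hilbert module `A ⊕ A` over `A = C^*_r(G)`. -/
def moduleInner (μ : Measure Cover) (ξ η : Spinor) (x : Cover) : ℂ :=
  ∑ i, ∫ y, conj ((ξ i).1 y) * (η i).1 (y * x) ∂μ

variable (μ : Measure Cover) [μ.IsHaarMeasure] (π : UnitaryRep V)

theorem integrable_test (a : TestFun) (v : V) : Integrable (fun x => a.1 x • π.hom x v) μ := by
  refine Continuous.integrable_of_hasCompactSupport ((TestFun.continuous a).smul (π.continuous_hom v)) ?_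
  exact a.2.1.smul_right

theorem continuous_conv (a b : TestFun) :
    Continuous fun x => ∫ y, conj (a.1 y) * b.1 (y * x) ∂μ := by
  rw [← continuousOn_univ]
  refine continuousOn_integral_of_compact_support (k := tsupport a.1) a.2.1 ?_ ?_
  · have h1 := TestFun.continuous a
    have h2 := TestFun.continuous b
    exact Continuous.continuousOn ((Complex.continuous_conj.comp (h1.comp continuous_snd)).mul
      (h2.comp (continuous_snd.mul continuous_fst)))
  · intro p x _ hx
    simp [image_eq_zero_of_notMem_tsupport hx]

theorem hasCompactSupport_conv (a b : TestFun) :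
    HasCompactSupport fun x => ∫ y, conj (a.1 y) * b.1 (y * x) ∂μ := by
  have hK : IsCompact ((fun p : Cover × Cover => p.1⁻¹ * p.2) '' (tsupport a.1 ×ˢ tsupport b.1)) :=
    (a.2.1.isCompact.prod b.2.1.isCompact).image (by fun_prop)
  refine HasCompactSupport.intro hK fun x hx => ?_
  have : ∀ y, conj (a.1 y) * b.1 (y * x) = 0 := by
    intro y
    by_contra h
    refine hx ⟨(y, y * x), ⟨subset_tsupport _ ?_, subset_tsupport _ ?_⟩, by simp⟩
    · intro h0; simp [h0] at h
    · intro h0; simp [h0] at h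
  simp [this]

theorem inner_intg_intg (a b : TestFun) (v w : V) :
    ⟪π.intg μ a.1 v, π.intg μ b.1 w⟫_ℂ =
      ⟪v, ∫ x, (∫ y, conj (a.1 y) * b.1 (y * x) ∂μ) • π.hom x w ∂μ⟫_ℂ := by
  have hi : Integrable (fun x => (∫ y, conj (a.1 y) * b.1 (y * x) ∂μ) • π.hom x w) μ :=
    Continuous.integrable_of_hasCompactSupport
      ((continuous_conv μ a b).smul (π.continuous_hom w)) (hasCompactSupport_conv μ a b).smul_right
  have hc : Continuous fun x => ⟪v, π.hom x w⟫_ℂ := continuous_const.inner (π.continuous_hom w)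
  have e1 : ⟪v, ∫ x, (∫ y, conj (a.1 y) * b.1 (y * x) ∂μ) • π.hom x w ∂μ⟫_ℂ =
      ∫ x, ∫ y, conj (a.1 y) * b.1 (y * x) * ⟪v, π.hom x w⟫_ℂ ∂μ ∂μ := by
    rw [← integral_inner hi]
    refine integral_congr_ae (Filter.Eventually.of_forall fun x => ?_)
    simp only [inner_smul_right]
    rw [← integral_mul_const]
  have e2 : ∫ x, ∫ y, conj (a.1 y) * b.1 (y * x) * ⟪v, π.hom x w⟫_ℂ ∂μ ∂μ =
      ∫ y, ∫ x, conj (a.1 y) * b.1 (y * x) * ⟪v, π.hom x w⟫_ℂ ∂μ ∂μ := by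
    refine integral_integral_swap_of_hasCompactSupport ?_ ?_
    · have h1 := TestFun.continuous a
      have h2 := TestFun.continuous b
      exact ((Complex.continuous_conj.comp (h1.comp continuous_snd)).mul
        (h2.comp (continuous_snd.mul continuous_fst))).mul (hc.comp continuous_fst)
    · have hK : IsCompact ((fun p : Cover × Cover => (p.1⁻¹ * p.2, p.1)) ''
          (tsupport a.1 ×ˢ tsupport b.1)) :=
        (a.2.1.isCompact.prod b.2.1.isCompact).image (by fun_prop)
      refine HasCompactSupport.intro hK ?_
      rintro ⟨x, y⟩ hx
      by_contra h
      refine hx ⟨(y, y * x), ⟨subset_tsupport _ ?_, subset_tsupport _ ?_⟩, by simp⟩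
      · intro h0; simp [h0] at h
      · intro h0; simp [h0] at h
  have e3 : ∀ y, ∫ x, conj (a.1 y) * b.1 (y * x) * ⟪v, π.hom x w⟫_ℂ ∂μ =
      conj (a.1 y) * ⟪π.hom y v, π.intg μ b.1 w⟫_ℂ := by
    intro y
    have h1 : ⟪π.hom y v, π.intg μ b.1 w⟫_ℂ = ∫ z, b.1 z * ⟪π.hom y v, π.hom z w⟫_ℂ ∂μ := by
      rw [UnitaryRep.intg, ← integral_inner (integrable_test μ π b w)]
      simp only [inner_smul_right]
    rw [h1, ← integral_const_mul, ← integral_mul_left_eq_self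
      (fun z => conj (a.1 y) * (b.1 z * ⟪π.hom y v, π.hom z w⟫_ℂ)) y]
    refine integral_congr_ae (Filter.Eventually.of_forall fun x => ?_)
    have h2 : ⟪π.hom y v, π.hom (y * x) w⟫_ℂ = ⟪v, π.hom x w⟫_ℂ := by
      rw [map_mul]
      exact (π.hom y).inner_map_map _ _
    simp only [h2]
    ring
  rw [e1, e2]
  simp only [e3]
  have h4 : ⟪π.intg μ a.1 v, π.intg μ b.1 w⟫_ℂ =
      conj ⟪π.intg μ b.1 w, π.intg μ a.1 v⟫_ℂ := (inner_conj_symm _ _).symm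
  rw [h4]
  conv_lhs => rw [UnitaryRep.intg.eq_1 μ π a.1 v]
  rw [← integral_inner (integrable_test μ π a v), ← integral_conj]
  refine integral_congr_ae (Filter.Eventually.of_forall fun y => ?_)
  simp only [inner_smul_right, map_mul, inner_conj_symm]

theorem inner_intg_moduleInner (ξ η : Spinor) (v w : V) :
    ⟪v, π.intg μ (moduleInner μ ξ η) w⟫_ℂ =
      ∑ i, ⟪π.intg μ (ξ i).1 v, π.intg μ (η i).1 w⟫_ℂ := by
  simp only [inner_intg_intg, ← inner_sum]
  congr 1
  rw [UnitaryRep.intg, ← integral_finsetSum]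
  · simp only [moduleInner, Finset.sum_smul]
  · intro i _
    exact Continuous.integrable_of_hasCompactSupport
      ((continuous_conv μ (ξ i) (η i)).smul (π.continuous_hom w))
      (hasCompactSupport_conv μ (ξ i) (η i)).smul_right

theorem intg_add_left (a b : TestFun) (v : V) :
    π.intg μ (a + b).1 v = π.intg μ a.1 v + π.intg μ b.1 v := by
  simp only [UnitaryRep.intg]
  rw [← integral_add (integrable_test μ π a v) (integrable_test μ π b v)]
  simp [add_smul]

theorem intg_smul_left (c : ℂ) (a : TestFun) (v : V) :
    π.intg μ (c • a).1 v = c • π.intg μ a.1 v := by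
  simp only [UnitaryRep.intg]
  rw [← integral_smul]
  simp [smul_smul]

theorem intg_add_right (a : TestFun) (v w : V) :
    π.intg μ a.1 (v + w) = π.intg μ a.1 v + π.intg μ a.1 w := by
  simp only [UnitaryRep.intg]
  rw [← integral_add (integrable_test μ π a v) (integrable_test μ π a w)]
  simp

theorem intg_smul_right (c : ℂ) (a : TestFun) (v : V) :
    π.intg μ a.1 (c • v) = c • π.intg μ a.1 v := by
  simp only [UnitaryRep.intg]
  rw [← integral_smul]
  simp [smul_comm c]

/-- The algebraic tensor product of `C_c^∞(G) ⊕ C_c^∞(G)` with the representation space. -/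
def PreLoc (_μ : Measure Cover) (_π : UnitaryRep V) : Type _ := Spinor ⊗[ℂ] V

instance : AddCommGroup (PreLoc μ π) := inferInstanceAs (AddCommGroup (Spinor ⊗[ℂ] V))
instance : Module ℂ (PreLoc μ π) := inferInstanceAs (Module ℂ (Spinor ⊗[ℂ] V))

/-- The sesquilinear form on the algebraic tensor product that is determined by
`⟨ξ ⊗ v, η ⊗ w⟩ = ⟨v, π(⟨ξ, η⟩) w⟩`. -/
def locForm : Spinor ⊗[ℂ] V →ₗ⋆[ℂ] Spinor ⊗[ℂ] V →ₗ[ℂ] ℂ :=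
  TensorProduct.lift <| LinearMap.mk₂'ₛₗ (starRingEnd ℂ) (starRingEnd ℂ)
    (fun ξ v => TensorProduct.lift <| LinearMap.mk₂ ℂ
      (fun η w => ⟪v, π.intg μ (moduleInner μ ξ η) w⟫_ℂ)
      (fun η η' w => by
        simp only [inner_intg_moduleInner, Pi.add_apply, intg_add_left, inner_add_right,
          Finset.sum_add_distrib])
      (fun c η w => by
        simp only [inner_intg_moduleInner, Pi.smul_apply, intg_smul_left, inner_smul_right,
          Finset.mul_sum, smul_eq_mul])
      (fun η w w' => by
        simp only [inner_intg_moduleInner, intg_add_right, inner_add_right,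
          Finset.sum_add_distrib])
      (fun c η w => by
        simp only [inner_intg_moduleInner, intg_smul_right, inner_smul_right,
          Finset.mul_sum, smul_eq_mul]))
    (fun ξ ξ' v => TensorProduct.ext' fun η w => by
      change ⟪v, π.intg μ (moduleInner μ (ξ + ξ') η) w⟫_ℂ = ⟪v, π.intg μ (moduleInner μ ξ η) w⟫_ℂ +
        ⟪v, π.intg μ (moduleInner μ ξ' η) w⟫_ℂ
      simp only [inner_intg_moduleInner, Pi.add_apply, intg_add_left, inner_add_left,
        Finset.sum_add_distrib])
    (fun c ξ v => TensorProduct.ext' fun η w => by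
      change ⟪v, π.intg μ (moduleInner μ (c • ξ) η) w⟫_ℂ =
        conj c * ⟪v, π.intg μ (moduleInner μ ξ η) w⟫_ℂ
      simp only [inner_intg_moduleInner, Pi.smul_apply, intg_smul_left, inner_smul_left,
        Finset.mul_sum])
    (fun ξ v v' => TensorProduct.ext' fun η w => inner_add_left _ _ _)
    (fun c ξ v => TensorProduct.ext' fun η w => inner_smul_left _ _ _)

theorem locForm_tmul (ξ η : Spinor) (v w : V) :
    locForm μ π (ξ ⊗ₜ v) (η ⊗ₜ w) = ⟪v, π.intg μ (moduleInner μ ξ η) w⟫_ℂ := rfl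

/-- The map `ξ ⊗ v ↦ π(ξ i) v`. -/
def locMap (i : Fin 2) : Spinor ⊗[ℂ] V →ₗ[ℂ] V :=
  TensorProduct.lift <| LinearMap.mk₂ ℂ (fun ξ v => π.intg μ (ξ i).1 v)
    (fun ξ η v => intg_add_left μ π (ξ i) (η i) v) (fun c ξ v => intg_smul_left μ π c (ξ i) v)
    (fun ξ v w => intg_add_right μ π (ξ i) v w) (fun c ξ v => intg_smul_right μ π c (ξ i) v)

theorem locForm_eq (s t : Spinor ⊗[ℂ] V) :
    locForm μ π s t = ∑ i, ⟪locMap μ π i s, locMap μ π i t⟫_ℂ := by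
  induction s with
  | zero => simp
  | add s s' h h' =>
    simp only [map_add, LinearMap.add_apply, h, h', inner_add_left, Finset.sum_add_distrib]
  | tmul ξ v =>
    induction t with
    | zero => simp
    | add t t' h h' => simp only [map_add, h, h', inner_add_right, Finset.sum_add_distrib]
    | tmul η w => exact inner_intg_moduleInner μ π ξ η v w

theorem locForm_conj (s t : Spinor ⊗[ℂ] V) : conj (locForm μ π t s) = locForm μ π s t := by
  simp only [locForm_eq, map_sum, inner_conj_symm]

theorem locForm_nonneg (s : Spinor ⊗[ℂ] V) : 0 ≤ RCLike.re (locForm μ π s s) := by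
  rw [locForm_eq, map_sum]
  exact Finset.sum_nonneg fun i _ => inner_self_nonneg

/-- The inner product of the interior tensor product, a positive semidefinite form. -/
instance preLocCore : PreInnerProductSpace.Core ℂ (PreLoc μ π) where
  inner s t := locForm μ π s t
  conj_inner_symm s t := locForm_conj μ π s t
  re_inner_nonneg s := locForm_nonneg μ π s
  add_left s s' t := congrArg (fun f => f t) (map_add (locForm μ π) s s')
  smul_left s t c := congrArg (fun f => f t) ((locForm μ π).map_smulₛₗ c s)

instance : SeminormedAddCommGroup (PreLoc μ π) :=
  InnerProductSpace.Core.toSeminormedAddCommGroup (𝕜 := ℂ)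

instance : InnerProductSpace ℂ (PreLoc μ π) := InnerProductSpace.ofCore (preLocCore μ π)

theorem inner_preLoc (ξ η : Spinor) (v w : V) :
    ⟪(show PreLoc μ π from ξ ⊗ₜ[ℂ] v), (show PreLoc μ π from η ⊗ₜ[ℂ] w)⟫_ℂ =
      ⟪v, π.intg μ (moduleInner μ ξ η) w⟫_ℂ := rfl

/-- The Hilbert space `(A ⊕ A) ⊗_A V`, the interior tensor product of the Hilbert module
`A ⊕ A` over `A = C^*_r(G)` with the representation space `V` of `π`.  As `C_c^∞(G) ⊕ C_c^∞(G)` is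
dense in `A ⊕ A`, it is the Hausdorff completion of the algebraic tensor product
`(C_c^∞(G) ⊕ C_c^∞(G)) ⊗ V` for the form `⟨ξ ⊗ v, η ⊗ w⟩ = ⟨v, π(⟨ξ, η⟩) w⟩`. -/
abbrev Loc : Type _ := UniformSpace.Completion (PreLoc μ π)

/-- The operator `D ⊗ 1` on the algebraic tensor product. -/
def diracTensor : PreLoc μ π →ₗ[ℂ] PreLoc μ π :=
  (LinearMap.rTensor V dirac : Spinor ⊗[ℂ] V →ₗ[ℂ] Spinor ⊗[ℂ] V)

/-- The graph of the localisation of the Dirac operator at `π`, that is, of the closed unbounded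
operator `D ⊗ 1` on `(A ⊕ A) ⊗_A V`. -/
def locDiracGraph : Set (Loc μ π × Loc μ π) :=
  closure (Set.range fun t : PreLoc μ π => ((t : Loc μ π), (diracTensor μ π t : Loc μ π)))

end Localisation

/-- The spectrum of a closed operator `T` given by its graph `Γ`: the complement of the set of
all `z` such that `T - z` is a bijection of the domain of `T` onto the whole space with a bounded
inverse `R`. -/
def graphSpectrum {H : Type*} [NormedAddCommGroup H] [NormedSpace ℂ H] (Γ : Set (H × H)) : Set ℂ :=
  {z | ¬ ∃ R : H →L[ℂ] H, (∀ y, (R y, z • R y + y) ∈ Γ) ∧ ∀ p ∈ Γ, R (p.2 - z • p.1) = p.1}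

/-- The localised spectrum of the Dirac operator at `π`. -/
def localSpectrum (μ : Measure Cover) [μ.IsHaarMeasure] {V : Type*} [NormedAddCommGroup V]
    [InnerProductSpace ℂ V] [CompleteSpace V] (π : UnitaryRep V) : Set ℂ :=
  graphSpectrum (locDiracGraph μ π)


/-! ### Multiplier representations -/

/-- A continuous action of `G` on a compact space with a finite measure, together with a continuous
multiplier `c` whose absolute square is the Radon-Nikodym derivative of the action. -/
structure Multiplier (Y : Type*) [MetricSpace Y] [CompactSpace Y] [MeasurableSpace Y] [BorelSpace Y]
    (ν : Measure Y) where
  /-- the action -/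
  act : Cover → Y → Y
  /-- the multiplier -/
  c : Cover → Y → ℂ
  act_one : ∀ p, act 1 p = p
  act_mul : ∀ x y p, act (x * y) p = act x (act y p)
  continuous_act : Continuous fun p : Cover × Y => act p.1 p.2
  c_one : ∀ p, c 1 p = 1
  c_mul : ∀ x y p, c (x * y) p = c x (act y p) * c y p
  continuous_c : Continuous fun p : Cover × Y => c p.1 p.2
  invariant : ∀ x, ∀ F : Y → ℝ≥0∞, Measurable F →
    ∫⁻ p, ‖c x p‖ₑ ^ 2 * F (act x p) ∂ν = ∫⁻ p, F p ∂ν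

namespace Multiplier

variable {Y : Type*} [MetricSpace Y] [CompactSpace Y] [MeasurableSpace Y] [BorelSpace Y]
  {ν : Measure Y} (M : Multiplier Y ν)

theorem continuous_act_right (x : Cover) : Continuous (M.act x) :=
  M.continuous_act.comp (Continuous.prodMk_right x)

theorem continuous_c_right (x : Cover) : Continuous (M.c x) :=
  M.continuous_c.comp (Continuous.prodMk_right x)

theorem c_ne_zero (x : Cover) (p : Y) : M.c x p ≠ 0 := by
  intro h
  have h1 := M.c_mul x⁻¹ x p
  rw [inv_mul_cancel, M.c_one, h, mul_zero] at h1
  exact one_ne_zero h1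

theorem qmp (x : Cover) : Measure.QuasiMeasurePreserving (M.act x) ν ν := by
  refine ⟨(M.continuous_act_right x).measurable, Measure.AbsolutelyContinuous.mk fun s hs h0 => ?_⟩
  have hm := (M.continuous_act_right x).measurable
  rw [Measure.map_apply hm hs]
  have h1 := M.invariant x (s.indicator 1) (measurable_one.indicator hs)
  rw [lintegral_indicator_one hs, h0, lintegral_eq_zero_iff] at h1
  · refine measure_mono_null (fun p hp => ?_) h1
    intro h2
    have h3 : M.act x p ∈ s := hp
    simp [h3, M.c_ne_zero x p] at h2
  · exact ((M.continuous_c_right x).measurable.enorm.pow_const 2).mul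
      ((measurable_one.indicator hs).comp hm)

theorem eLpNorm_two_eq (f : Y → ℂ) :
    eLpNorm f 2 ν = (∫⁻ p, ‖f p‖ₑ ^ 2 ∂ν) ^ (1 / 2 : ℝ) := by
  rw [eLpNorm_eq_lintegral_rpow_enorm_toReal (by norm_num) (by norm_num)]
  simp

theorem eLpNorm_act (x : Cover) (f : Lp ℂ 2 ν) :
    eLpNorm (fun p => M.c x p * f (M.act x p)) 2 ν = eLpNorm f 2 ν := by
  rw [eLpNorm_two_eq, eLpNorm_two_eq]
  have h := M.invariant x (fun p => ‖f p‖ₑ ^ 2) ((Lp.stronglyMeasurable f).enorm.pow_const 2)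
  rw [← h]
  simp only [enorm_mul, mul_pow]

theorem memLp_act (x : Cover) (f : Lp ℂ 2 ν) :
    MemLp (fun p => M.c x p * f (M.act x p)) 2 ν := by
  refine ⟨?_, ?_⟩
  · exact ((M.continuous_c_right x).measurable.mul ((Lp.stronglyMeasurable f).measurable.comp
      (M.continuous_act_right x).measurable)).aestronglyMeasurable
  · rw [M.eLpNorm_act]
    exact Lp.eLpNorm_lt_top f

/-- The operator `f ↦ c(x, ·) f(x ·)` on `L²`. -/
def op (x : Cover) : Lp ℂ 2 ν →ₗᵢ[ℂ] Lp ℂ 2 ν where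
  toFun f := (M.memLp_act x f).toLp
  map_add' f g := by
    refine Lp.ext ?_
    filter_upwards [(M.memLp_act x (f + g)).coeFn_toLp, (M.memLp_act x f).coeFn_toLp,
      (M.memLp_act x g).coeFn_toLp, Lp.coeFn_add ((M.memLp_act x f).toLp) ((M.memLp_act x g).toLp),
      (M.qmp x).ae (Lp.coeFn_add f g)] with p h1 h2 h3 h4 h5
    rw [h1, h4, Pi.add_apply, h2, h3, h5, Pi.add_apply, mul_add]
  map_smul' a f := by
    refine Lp.ext ?_
    filter_upwards [(M.memLp_act x (a • f)).coeFn_toLp, (M.memLp_act x f).coeFn_toLp,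
      Lp.coeFn_smul a ((M.memLp_act x f).toLp),
      (M.qmp x).ae (Lp.coeFn_smul a f)] with p h1 h2 h3 h4
    rw [RingHom.id_apply, h1, h3, Pi.smul_apply, h2, h4, Pi.smul_apply, smul_eq_mul, smul_eq_mul]
    ring
  norm_map' f := by
    change ‖(M.memLp_act x f).toLp‖ = ‖f‖
    rw [Lp.norm_toLp, M.eLpNorm_act, Lp.norm_def]

theorem op_coeFn (x : Cover) (f : Lp ℂ 2 ν) :
    M.op x f =ᵐ[ν] fun p => M.c x p * f (M.act x p) := (M.memLp_act x f).coeFn_toLp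

theorem op_one (f : Lp ℂ 2 ν) : M.op 1 f = f := by
  refine Lp.ext ?_
  filter_upwards [M.op_coeFn 1 f] with p h
  rw [h, M.c_one, M.act_one, one_mul]

theorem op_mul (x y : Cover) (f : Lp ℂ 2 ν) : M.op (x * y) f = M.op y (M.op x f) := by
  refine Lp.ext ?_
  filter_upwards [M.op_coeFn (x * y) f, M.op_coeFn y (M.op x f), (M.qmp y).ae (M.op_coeFn x f)]
    with p h1 h2 h3
  rw [h1, h2, h3, M.c_mul, M.act_mul]
  ring

/-- The unitary operator `f ↦ c(x⁻¹, ·) f(x⁻¹ ·)`. -/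
def unit (x : Cover) : Lp ℂ 2 ν ≃ₗᵢ[ℂ] Lp ℂ 2 ν where
  toFun := M.op x⁻¹
  invFun := M.op x
  left_inv f := by rw [← M.op_mul, inv_mul_cancel, M.op_one]
  right_inv f := by rw [← M.op_mul, mul_inv_cancel, M.op_one]
  map_add' := map_add _
  map_smul' := map_smul _
  norm_map' := (M.op x⁻¹).norm_map

theorem unit_apply (x : Cover) (f : Lp ℂ 2 ν) : M.unit x f = M.op x⁻¹ f := rfl

theorem continuous_op [IsFiniteMeasure ν] (f : Lp ℂ 2 ν) : Continuous fun x => M.op x f := by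
  have hd : Dense {f : Lp ℂ 2 ν | Continuous fun x => M.op x f} := by
    refine (ContinuousMap.toLp_denseRange ℂ ν ℂ (p := 2) (by norm_num)).mono ?_
    rintro _ ⟨g, rfl⟩
    let G : Cover → C(Y, ℂ) := fun x => ⟨fun p => M.c x p * g (M.act x p),
      (M.continuous_c_right x).mul (g.continuous.comp (M.continuous_act_right x))⟩
    have hG : Continuous G := by
      refine ContinuousMap.continuous_of_continuous_uncurry _ ?_
      exact M.continuous_c.mul (g.continuous.comp M.continuous_act)
    have e : (fun x => M.op x (ContinuousMap.toLp 2 ν ℂ g)) =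
        fun x => ContinuousMap.toLp 2 ν ℂ (G x) := by
      funext x
      refine Lp.ext ?_
      filter_upwards [M.op_coeFn x (ContinuousMap.toLp 2 ν ℂ g), ContinuousMap.coeFn_toLp (p := 2) (𝕜 := ℂ) ν (G x),
        (M.qmp x).ae (ContinuousMap.coeFn_toLp (p := 2) (𝕜 := ℂ) ν g)] with p h1 h2 h3
      rw [h1, h2, h3]
      rfl
    change Continuous fun x => M.op x (ContinuousMap.toLp 2 ν ℂ g)
    rw [e]
    exact (ContinuousMap.toLp 2 ν ℂ).continuous.comp hG
  have hcl : IsClosed {f : Lp ℂ 2 ν | Continuous fun x => M.op x f} := by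
    refine isClosed_of_closure_subset fun f hf => ?_
    refine continuous_of_uniform_approx_of_continuous fun u hu => ?_
    obtain ⟨ε, hε, hεu⟩ := Metric.mem_uniformity_dist.1 hu
    obtain ⟨g, hg, hfg⟩ := Metric.mem_closure_iff.1 hf ε hε
    refine ⟨fun x => M.op x g, hg, fun x => hεu ?_⟩
    rw [(M.op x).isometry.dist_eq]
    exact hfg
  have := hd.closure_eq
  rw [hcl.closure_eq] at this
  have hf : f ∈ (Set.univ : Set (Lp ℂ 2 ν)) := trivial
  rwa [← this] at hf

/-- The unitary representation `(π(x) f)(p) = c(x⁻¹, p) f(x⁻¹ p)` of `G` on `L²`. -/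
def rep [IsFiniteMeasure ν] : UnitaryRep (Lp ℂ 2 ν) where
  hom :=
    { toFun := M.unit
      map_one' := by
        ext1 f
        rw [M.unit_apply, inv_one, M.op_one]
        rfl
      map_mul' := fun x y => by
        ext1 f
        rw [M.unit_apply, mul_inv_rev, M.op_mul]
        rfl }
  continuous_hom f := (M.continuous_op f).comp continuous_inv

theorem rep_coeFn [IsFiniteMeasure ν] (x : Cover) (f : Lp ℂ 2 ν) :
    M.rep.hom x f =ᵐ[ν] fun p => M.c x⁻¹ p * f (M.act x⁻¹ p) := M.op_coeFn x⁻¹ f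

end Multiplier

/-- The restriction of a unitary representation to an invariant subspace. -/
def UnitaryRep.restrict {V : Type*} [NormedAddCommGroup V] [InnerProductSpace ℂ V]
    (π : UnitaryRep V) (W : Submodule ℂ V) (hW : ∀ x, ∀ v ∈ W, π.hom x v ∈ W) : UnitaryRep W where
  hom :=
    { toFun := fun x =>
        { toFun := fun v => ⟨π.hom x v, hW x v v.2⟩
          invFun := fun v => ⟨π.hom x⁻¹ v, hW x⁻¹ v v.2⟩
          left_inv := fun v => Subtype.ext (by
            change π.hom x⁻¹ (π.hom x v) = v
            have h := congrArg (fun u => u v.1) (map_mul π.hom x⁻¹ x)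
            rw [inv_mul_cancel, map_one] at h
            exact h.symm)
          right_inv := fun v => Subtype.ext (by
            change π.hom x (π.hom x⁻¹ v) = v
            have h := congrArg (fun u => u v.1) (map_mul π.hom x x⁻¹)
            rw [mul_inv_cancel, map_one] at h
            exact h.symm)
          map_add' := fun v w => Subtype.ext (map_add (π.hom x) (v : V) w)
          map_smul' := fun a v => Subtype.ext (map_smul (π.hom x) a (v : V))
          norm_map' := fun v => (π.hom x).norm_map v }
      map_one' := by
        ext v
        change π.hom 1 (v : V) = v
        rw [map_one]; rfl
      map_mul' := fun x y => by
        ext v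
        change π.hom (x * y) (v : V) = π.hom x (π.hom y v)
        rw [map_mul]; rfl }
  continuous_hom v := (π.continuous_hom v).subtype_mk _


/-! ### The principal series -/

/-- The unit circle, as the boundary of the unit disc. -/
abbrev Circ : Type := Metric.sphere (0 : ℂ) 1

theorem Circ.norm_eq (z : Circ) : ‖(z : ℂ)‖ = 1 := mem_sphere_zero_iff_norm.1 z.2

/-- The inclusion of the circle into the closed disc. -/
def Circ.toDisc (z : Circ) : Disc := ⟨z, Metric.sphere_subset_closedBall z.2⟩

theorem Circ.continuous_toDisc : Continuous Circ.toDisc := continuous_subtype_val.subtype_mk _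

/-- The fractional linear transformation of the circle attached to `g`. -/
def mobC (g : SL(2, ℝ)) (z : Circ) : Circ :=
  ⟨mob g z, mem_sphere_zero_iff_norm.2 (norm_mob_eq g z.norm_eq)⟩

theorem toDisc_mobC (g : SL(2, ℝ)) (z : Circ) : (mobC g z).toDisc = mobD g z.toDisc := rfl

theorem continuous_mobC_uncurry : Continuous fun p : SL(2, ℝ) × Circ => mobC p.1 p.2 := by
  refine Continuous.subtype_mk ?_ _
  exact continuous_subtype_val.comp (continuous_mobD_uncurry.comp
    (continuous_fst.prodMk (Circ.continuous_toDisc.comp continuous_snd)))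

instance factTwoPiPos : Fact (0 < 2 * Real.pi) := ⟨Real.two_pi_pos⟩

/-- The point `e^{iθ}` of the circle. -/
def circPt (θ : AddCircle (2 * Real.pi)) : Circ := ⟨θ.toCircle, mem_sphere_zero_iff_norm.2 (Circle.norm_coe _)⟩

theorem continuous_circPt : Continuous circPt :=
  (continuous_subtype_val.comp AddCircle.continuous_toCircle).subtype_mk _

/-- The normalised arc length on the circle. -/
def circleMeasure : Measure Circ := (AddCircle.haarAddCircle (T := 2 * Real.pi)).map circPt

instance : IsProbabilityMeasure circleMeasure :=
  Measure.isProbabilityMeasure_map continuous_circPt.aemeasurable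

theorem lintegral_circleMeasure (G : ℂ → ℝ≥0∞) (hG : Measurable G) :
    ∫⁻ θ in Set.Ioo (-Real.pi) Real.pi, G (Complex.exp (2 * (θ * I))) =
      ENNReal.ofReal (2 * Real.pi) * ∫⁻ p, G (p : Circ) ∂circleMeasure := by
  have hm : Measurable fun θ : AddCircle (2 * Real.pi) => G (circPt θ : ℂ) :=
    hG.comp (measurable_subtype_coe.comp continuous_circPt.measurable)
  have h1 : ∫⁻ p, G (p : Circ) ∂circleMeasure =
      ∫⁻ θ, G (circPt θ : ℂ) ∂(AddCircle.haarAddCircle (T := 2 * Real.pi)) := by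
    exact lintegral_map (hG.comp measurable_subtype_coe) continuous_circPt.measurable
  have h2 : ∫⁻ θ : AddCircle (2 * Real.pi), G (circPt θ : ℂ) =
      ∫⁻ θ : AddCircle (2 * Real.pi), G (circPt ((2 : ℤ) • θ) : ℂ) := by
    have h := MeasureTheory.Measure.measurePreserving_zsmul (volume : Measure (AddCircle (2 * Real.pi)))
      (n := 2) (by norm_num)
    exact (h.lintegral_comp hm).symm
  have h3 := AddCircle.lintegral_preimage (2 * Real.pi) (-Real.pi)
    (fun θ : AddCircle (2 * Real.pi) => G (circPt ((2 : ℤ) • θ) : ℂ))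
  have h4 : -Real.pi + 2 * Real.pi = Real.pi := by ring
  rw [h1, ← smul_eq_mul, ← lintegral_smul_measure, ← AddCircle.volume_eq_smul_haarAddCircle, h2,
    ← h3, h4, ← restrict_Ioo_eq_restrict_Ioc]
  refine lintegral_congr fun θ => ?_
  congr 1
  simp only [circPt, AddCircle.toCircle_zsmul, AddCircle.toCircle_apply_mk]
  have h5 : 2 * Real.pi / (2 * Real.pi) = 1 := div_self Real.two_pi_pos.ne'
  rw [h5, one_mul, Circle.coe_zpow, Circle.coe_exp, ← Complex.exp_int_mul]
  norm_num

/-- The real-linear map `w ↦ g w` of `ℂ = ℝ²`. -/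
def linMap (g : SL(2, ℝ)) : ℂ →ₗ[ℝ] ℂ := Matrix.toLin Complex.basisOneI Complex.basisOneI g.1

theorem linMap_apply (g : SL(2, ℝ)) (w : ℂ) : linMap g w = al g * w + be g * conj w := by
  rw [linMap, Matrix.toLin_apply, Fin.sum_univ_two]
  apply Complex.ext <;>
    simp [Matrix.mulVec, dotProduct, Fin.sum_univ_two, al, be] <;> ring

theorem measurePreserving_linMap (g : SL(2, ℝ)) :
    MeasurePreserving (linMap g) volume volume := by
  have hd : LinearMap.det (linMap g) = 1 := by rw [linMap, LinearMap.det_toLin, g.2]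
  refine ⟨(LinearMap.continuous_of_finiteDimensional (linMap g)).measurable, ?_⟩
  rw [Measure.map_linearMap_addHaar_eq_smul_addHaar volume (by rw [hd]; exact one_ne_zero), hd]
  simp

theorem lintegral_radial (ρ : ℝ → ℝ) (hρ : ∀ θ, 0 < ρ θ) (f : ℝ → ℝ≥0∞) (K : ℂ → ℝ≥0∞)
    (hK : Measurable K)
    (h : ∀ r θ : ℝ, 0 < r → K (r * Complex.exp (θ * I)) = if r ≤ ρ θ then f θ else 0) :
    ∫⁻ w, K w = ∫⁻ θ in Set.Ioo (-Real.pi) Real.pi, ENNReal.ofReal (ρ θ ^ 2 / 2) * f θ := by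
  have hpt : ∀ p : ℝ × ℝ, Complex.polarCoord.symm p = p.1 * Complex.exp (p.2 * I) := by
    intro p
    rw [Complex.polarCoord_symm_apply, Complex.exp_mul_I, Complex.ofReal_cos, Complex.ofReal_sin]
  have hm : Measurable fun p : ℝ × ℝ => ENNReal.ofReal p.1 • K (Complex.polarCoord.symm p) := by
    simp only [hpt]
    have h1 : Measurable fun p : ℝ × ℝ => (p.1 * Complex.exp (p.2 * I) : ℂ) := by fun_prop
    exact measurable_fst.ennreal_ofReal.mul (hK.comp h1)
  rw [← Complex.lintegral_comp_polarCoord_symm, polarCoord_target, Measure.volume_eq_prod,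
    setLIntegral_prod_symm _ hm.aemeasurable]
  refine lintegral_congr fun θ => ?_
  have e1 : ∫⁻ r in Set.Ioi (0 : ℝ), ENNReal.ofReal r • K (Complex.polarCoord.symm (r, θ)) =
      ∫⁻ r in Set.Ioi (0 : ℝ), (Set.Iic (ρ θ)).indicator (fun r => ENNReal.ofReal r * f θ) r := by
    refine setLIntegral_congr_fun measurableSet_Ioi fun r hr => ?_
    simp only [hpt, h r θ hr, Set.indicator_apply, Set.mem_Iic, smul_eq_mul, mul_ite, mul_zero]
  rw [e1, setLIntegral_indicator measurableSet_Iic, Set.Iic_inter_Ioi,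
    lintegral_mul_const _ ENNReal.measurable_ofReal]
  congr 1
  have hi : IntegrableOn (fun r : ℝ => r) (Set.Ioc 0 (ρ θ)) :=
    (intervalIntegrable_iff_integrableOn_Ioc_of_le (hρ θ).le).1 intervalIntegral.intervalIntegrable_id
  rw [← ofReal_integral_eq_lintegral_ofReal hi
    ((ae_restrict_iff' measurableSet_Ioc).2 (Filter.Eventually.of_forall fun r hr => hr.1.le)),
    ← intervalIntegral.integral_of_le (hρ θ).le, integral_id]
  congr 1
  ring

theorem normSq_den_eq_normSq_num (g : SL(2, ℝ)) {z : ℂ} (hz : ‖z‖ = 1) :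
    ‖num g z‖ = ‖den g z‖ := by
  have h := normSq_den_sub g z
  rw [normSq_eq_norm_sq, normSq_eq_norm_sq, normSq_eq_norm_sq, hz] at h
  have : ‖num g z‖ ^ 2 = ‖den g z‖ ^ 2 := by linarith
  exact (sq_eq_sq₀ (norm_nonneg _) (norm_nonneg _)).1 this

theorem lintegral_mobC (g : SL(2, ℝ)) (F : Circ → ℝ≥0∞) (hF : Measurable F) :
    ∫⁻ p : Circ, ENNReal.ofReal (1 / ‖den g p‖ ^ 2) * F (mobC g p) ∂circleMeasure =
      ∫⁻ p, F p ∂circleMeasure := by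
  have hemb : MeasurableEmbedding (Subtype.val : Circ → ℂ) :=
    MeasurableEmbedding.subtype_coe Metric.isClosed_sphere.measurableSet
  set E : ℂ → ℝ≥0∞ := Function.extend Subtype.val F 0 with hE
  have hEm : Measurable E := hemb.measurable_extend hF measurable_const
  have hEv : ∀ p : Circ, E p = F p := fun p => hemb.injective.extend_apply F 0 p
  have hden : Measurable fun z : ℂ => den g z := by unfold den; fun_prop
  have hnum : Measurable fun z : ℂ => num g z := by unfold num; fun_prop
  set K : ℂ → ℝ≥0∞ := fun w => if ‖w‖ ≤ 1 then E ((w / ‖w‖) ^ 2) else 0 with hK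
  have hKm : Measurable K := by
    refine Measurable.ite (measurableSet_le measurable_norm measurable_const) (hEm.comp ?_)
      measurable_const
    fun_prop
  have hz : ∀ θ : ℝ, ‖Complex.exp (2 * (θ * I))‖ = 1 := fun θ => by
    rw [← mul_assoc, ← Complex.ofReal_ofNat, ← Complex.ofReal_mul, Complex.norm_exp_ofReal_mul_I]
  have hsq : ∀ θ : ℝ, Complex.exp (2 * (θ * I)) = Complex.exp (θ * I) ^ 2 := fun θ => by
    rw [← Complex.exp_nat_mul]; norm_num
  have i1 : ∫⁻ w, K w = ∫⁻ θ in Set.Ioo (-Real.pi) Real.pi,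
      ENNReal.ofReal (1 ^ 2 / 2) * E (Complex.exp (2 * (θ * I))) := by
    refine lintegral_radial (fun _ => 1) (fun _ => one_pos) _ K hKm fun r θ hr => ?_
    have h1 : ‖(r * Complex.exp (θ * I) : ℂ)‖ = r := by
      rw [norm_mul, Complex.norm_exp_ofReal_mul_I, mul_one, Complex.norm_real,
        Real.norm_of_nonneg hr.le]
    have h2 : (r : ℂ) ≠ 0 := by exact_mod_cast hr.ne'
    simp only [hK, h1]
    rw [mul_div_cancel_left₀ _ h2, hsq]
  have i2 : ∫⁻ w, K (linMap g w) = ∫⁻ θ in Set.Ioo (-Real.pi) Real.pi,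
      ENNReal.ofReal ((1 / ‖den g (Complex.exp (2 * (θ * I)))‖) ^ 2 / 2) *
        E (mob g (Complex.exp (2 * (θ * I)))) := by
    refine lintegral_radial (fun θ => 1 / ‖den g (Complex.exp (2 * (θ * I)))‖)
      (fun θ => one_div_pos.2 (norm_pos_iff.2 (den_ne_zero g (hz θ).le))) _ _
      (hKm.comp (measurePreserving_linMap g).measurable) fun r θ hr => ?_
    have hd : den g (Complex.exp (2 * (θ * I))) ≠ 0 := den_ne_zero g (hz θ).le
    have hn := normSq_den_eq_normSq_num g (hz θ)
    have hd' : 0 < ‖den g (Complex.exp (2 * (θ * I)))‖ := norm_pos_iff.2 hd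
    set u := Complex.exp (θ * I) with hu
    have huu : u * conj u = 1 := by
      rw [Complex.mul_conj, normSq_eq_norm_sq, hu, Complex.norm_exp_ofReal_mul_I]; simp
    have hun : ‖conj u‖ = 1 := by
      rw [RCLike.norm_conj, hu, Complex.norm_exp_ofReal_mul_I]
    rw [hsq] at hd hn hd' ⊢
    have h1 : linMap g (r * u) = r * (conj u * num g (u ^ 2)) := by
      rw [linMap_apply, map_mul, Complex.conj_ofReal, num]
      linear_combination (-(r * al g * u)) * huu
    have h2 : ‖linMap g (r * u)‖ = r * ‖den g (u ^ 2)‖ := by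
      rw [h1, norm_mul, norm_mul, hun, one_mul, hn, Complex.norm_real, Real.norm_of_nonneg hr.le]
    have h3 : (linMap g (r * u) / ‖linMap g (r * u)‖) ^ 2 = mob g (u ^ 2) := by
      have h4 : ((‖den g (u ^ 2)‖ : ℂ)) ^ 2 = den g (u ^ 2) * conj (den g (u ^ 2)) := by
        rw [Complex.mul_conj, normSq_eq_norm_sq]; push_cast; ring
      have h5 : conj (den g (u ^ 2)) = conj u ^ 2 * num g (u ^ 2) := by
        simp only [den, num, map_add, map_mul, map_pow, Complex.conj_conj]
        linear_combination (-(al g * (u * conj u + 1))) * huu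
      have h6 : num g (u ^ 2) ≠ 0 := by rw [← norm_pos_iff, hn]; exact hd'
      have h7 : conj u ≠ 0 := by rw [← norm_pos_iff, hun]; exact one_pos
      have h8 : (r : ℂ) ≠ 0 := by exact_mod_cast hr.ne'
      rw [h2, h1, div_pow, Complex.ofReal_mul, mul_pow (r : ℂ) (‖den g (u ^ 2)‖ : ℂ), h4, h5, mob]
      field_simp
    have h9 : r ≤ 1 / ‖den g (u ^ 2)‖ ↔ r * ‖den g (u ^ 2)‖ ≤ 1 := le_div_iff₀ hd'
    simp only [hK]
    rw [h3, h2]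
    simp only [← hu, h9]
  have i3 : ∫⁻ w, K (linMap g w) = ∫⁻ w, K w := (measurePreserving_linMap g).lintegral_comp hKm
  have j1 := lintegral_circleMeasure (fun z => ENNReal.ofReal (1 ^ 2 / 2) * E z)
    (hEm.const_mul _)
  have j2 := lintegral_circleMeasure
    (fun z => ENNReal.ofReal ((1 / ‖den g z‖) ^ 2 / 2) * E (mob g z))
    (((((measurable_const.div hden.norm).pow_const 2).div_const 2).ennreal_ofReal).mul
      (hEm.comp (hnum.div hden)))
  rw [i1, i2, j1, j2] at i3
  have hpi : ENNReal.ofReal (2 * Real.pi) ≠ 0 := by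
    simpa using Real.pi_pos
  have i4 := (ENNReal.mul_right_inj hpi ENNReal.ofReal_ne_top).1 i3
  have e1 : ∀ p : Circ, ENNReal.ofReal ((1 / ‖den g p‖) ^ 2 / 2) * E (mob g p) =
      ENNReal.ofReal (1 ^ 2 / 2) * (ENNReal.ofReal (1 / ‖den g p‖ ^ 2) * F (mobC g p)) := by
    intro p
    rw [← mul_assoc, ← ENNReal.ofReal_mul (by norm_num), ← hEv]
    congr 2
    rw [div_pow]
    ring
  simp only [e1, hEv] at i4
  have m1 : Measurable fun p : Circ => ENNReal.ofReal (1 / ‖den g p‖ ^ 2) * F (mobC g p) := by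
    refine Measurable.mul ?_ (hF.comp ?_)
    · exact (measurable_const.div ((hden.comp measurable_subtype_coe).norm.pow_const 2)).ennreal_ofReal
    · exact ((hnum.div hden).comp measurable_subtype_coe).subtype_mk
  rw [lintegral_const_mul _ m1, lintegral_const_mul _ hF] at i4
  exact (ENNReal.mul_right_inj (by norm_num) ENNReal.ofReal_ne_top).1 i4

theorem continuous_mobC_cover : Continuous fun p : Cover × Circ => mobC p.1.g p.2 := by
  have h : Continuous fun p : Cover × Circ => (p.1.g, p.2) :=
    (Cover.continuous_g.comp continuous_fst).prodMk continuous_snd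
  exact Continuous.comp (g := fun q : SL(2, ℝ) × Circ => mobC q.1 q.2)
    (f := fun p : Cover × Circ => (p.1.g, p.2)) continuous_mobC_uncurry h

theorem continuous_φ_circ : Continuous fun p : Cover × Circ => p.1.φ p.2.toDisc := by
  have h : Continuous fun p : Cover × Circ => (p.1, p.2.toDisc) :=
    continuous_fst.prodMk (Circ.continuous_toDisc.comp continuous_snd)
  exact Cover.continuous_φ_uncurry.comp h

/-- The multiplier `|J|^{-1-2iσ} (J / |J|)^{-2τ}` on the circle, where `J = exp φ` is the
automorphy factor and `(J / |J|)^{-2τ} = exp (-2iτ Im φ)`. -/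
def principalMultiplier (σ τ : ℝ) : Multiplier Circ circleMeasure where
  act x := mobC x.g
  c x p := Complex.exp (-(1 + 2 * σ * I) * (x.φ p.toDisc).re - 2 * τ * I * (x.φ p.toDisc).im)
  act_one p := Subtype.ext (mob_one p)
  act_mul x y p := Subtype.ext (mob_mul x.g y.g p.norm_eq.le)
  continuous_act := continuous_mobC_cover
  c_one p := by simp
  c_mul x y p := by
    rw [← Complex.exp_add, toDisc_mobC, Cover.mul_φ, Complex.add_re, Complex.add_im,
      Complex.ofReal_add, Complex.ofReal_add]
    congr 1
    ring
  continuous_c := by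
    have h1 := Complex.continuous_re.comp continuous_φ_circ
    have h2 := Complex.continuous_im.comp continuous_φ_circ
    exact Complex.continuous_exp.comp ((continuous_const.mul (Complex.continuous_ofReal.comp h1)).sub
      (continuous_const.mul (Complex.continuous_ofReal.comp h2)))
  invariant x F hF := by
    rw [← lintegral_mobC x.g F hF]
    refine lintegral_congr fun p => ?_
    congr 1
    have h1 : ‖Complex.exp (-(1 + 2 * σ * I) * (x.φ p.toDisc).re -
        2 * τ * I * (x.φ p.toDisc).im)‖ = Real.exp (-(x.φ p.toDisc).re) := by
      rw [Complex.norm_exp]; simp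
    have h2 : ‖den x.g p‖ = Real.exp (x.φ p.toDisc).re := by
      rw [← Complex.norm_exp, x.exp_φ]; rfl
    rw [← ofReal_norm, h1, h2, ← ENNReal.ofReal_pow (Real.exp_pos _).le, Real.exp_neg,
      inv_pow, one_div]

/-- The principal series representation `π_{q,τ}`, realised on `L²` of the circle by
`(π(x) f)(ζ) = |J|^{-1-2iσ} (J / |J|)^{-2τ} f(x⁻¹ ζ)` with `J` the automorphy factor of `x⁻¹` at
`ζ` and `σ = √(q - 1/4)`.  Its Casimir eigenvalue is `1/4 + σ² = q`. -/
def principalSeries (q τ : ℝ) : UnitaryRep (Lp ℂ 2 circleMeasure) :=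
  (principalMultiplier (√(q - 1 / 4)) τ).rep


/-! ### The discrete series -/

/-- The weighted area measure `(1 - |z|²)^{2ℓ-2} dA(z)` on the disc. -/
def bergmanMeasure (ℓ : ℝ) : Measure Disc :=
  (Measure.comap Subtype.val (volume : Measure ℂ) : Measure Disc).withDensity fun z =>
    ENNReal.ofReal ((1 - ‖(z : ℂ)‖ ^ 2) ^ (2 * ℓ - 2))

theorem lintegral_bergmanMeasure (ℓ : ℝ) (G : ℂ → ℝ≥0∞) (hG : Measurable G) :
    ∫⁻ p : Disc, G p ∂bergmanMeasure ℓ = ∫⁻ z in Metric.ball (0 : ℂ) 1,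
      ENNReal.ofReal ((1 - ‖z‖ ^ 2) ^ (2 * ℓ - 2)) * G z := by
  have hw : Measurable fun z : ℂ => ENNReal.ofReal ((1 - ‖z‖ ^ 2) ^ (2 * ℓ - 2)) := by fun_prop
  have hs : (Metric.ball (0 : ℂ) 1 : Set ℂ) =ᵐ[volume] Metric.closedBall (0 : ℂ) 1 := by
    rw [← Metric.ball_union_sphere]
    refine (union_ae_eq_left_of_ae_eq_empty ?_).symm
    exact ae_eq_empty.2 (Measure.addHaar_sphere volume 0 1)
  rw [bergmanMeasure, setLIntegral_congr hs]
  refine (lintegral_withDensity_eq_lintegral_mul _ (hw.comp measurable_subtype_coe)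
    (hG.comp measurable_subtype_coe)).trans ?_
  exact lintegral_subtype_comap Metric.isClosed_closedBall.measurableSet
    (fun z : ℂ => ENNReal.ofReal ((1 - ‖z‖ ^ 2) ^ (2 * ℓ - 2)) * G z)

theorem isFiniteMeasure_bergmanMeasure {ℓ : ℝ} (hℓ : 1 / 2 < ℓ) :
    IsFiniteMeasure (bergmanMeasure ℓ) := by
  refine ⟨?_⟩
  have h0 := lintegral_bergmanMeasure ℓ (fun _ => 1) measurable_const
  rw [lintegral_one] at h0
  rw [h0]
  simp only [mul_one]
  set a := 2 * ℓ - 2 with ha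
  have ha1 : -1 < a := by linarith
  have hb : ∀ r : ℝ, 0 < r → r < 1 → r * (1 - r ^ 2) ^ a ≤ (1 - r) ^ a * (1 + 2 ^ a) := by
    intro r h1 h2
    have e : (1 - r ^ 2) ^ a = (1 - r) ^ a * (1 + r) ^ a := by
      rw [← Real.mul_rpow (by linarith) (by linarith)]
      congr 1; ring
    have h3 : (1 + r) ^ a ≤ 1 + 2 ^ a := by
      rcases le_total 0 a with h | h
      · have h4 := Real.rpow_le_rpow (by linarith) (by linarith : 1 + r ≤ 2) h
        linarith
      · have h4 := Real.rpow_le_one_of_one_le_of_nonpos (by linarith : 1 ≤ 1 + r) h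
        have h5 : (0 : ℝ) ≤ 2 ^ a := Real.rpow_nonneg (by norm_num) a
        linarith
    have h6 : 0 ≤ (1 - r) ^ a := Real.rpow_nonneg (by linarith) a
    have h7 : 0 ≤ (1 + r) ^ a := Real.rpow_nonneg (by linarith) a
    rw [e]
    calc r * ((1 - r) ^ a * (1 + r) ^ a) ≤ 1 * ((1 - r) ^ a * (1 + r) ^ a) := by
          gcongr
      _ ≤ (1 - r) ^ a * (1 + 2 ^ a) := by
          rw [one_mul]; gcongr
  have hint : IntegrableOn (fun r : ℝ => (1 - r) ^ a * (1 + 2 ^ a)) (Set.Ioc 0 1) := by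
    have h1 : IntervalIntegrable (fun r : ℝ => r ^ a) volume 0 1 :=
      intervalIntegral.intervalIntegrable_rpow' ha1
    have h2 := (h1.comp_sub_left 1).symm
    simp only [sub_zero, sub_self] at h2
    exact ((intervalIntegrable_iff_integrableOn_Ioc_of_le zero_le_one).1 h2).mul_const _
  have hm : Measurable fun w : ℂ => (Metric.ball (0 : ℂ) 1).indicator
      (fun z => ENNReal.ofReal ((1 - ‖z‖ ^ 2) ^ a)) w := by
    refine Measurable.indicator ?_ Metric.isOpen_ball.measurableSet
    fun_prop
  rw [← lintegral_indicator Metric.isOpen_ball.measurableSet,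
    ← Complex.lintegral_comp_polarCoord_symm, polarCoord_target, Measure.volume_eq_prod]
  have hle : ∀ p : ℝ × ℝ, p ∈ Set.Ioi (0 : ℝ) ×ˢ Set.Ioo (-Real.pi) Real.pi →
      ENNReal.ofReal p.1 • (Metric.ball (0 : ℂ) 1).indicator
        (fun z => ENNReal.ofReal ((1 - ‖z‖ ^ 2) ^ a)) (Complex.polarCoord.symm p) ≤
      (Set.Ioc (0 : ℝ) 1).indicator (fun r => ENNReal.ofReal ((1 - r) ^ a * (1 + 2 ^ a))) p.1 := by
    rintro ⟨r, θ⟩ ⟨hr, -⟩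
    have hr0 : 0 < r := hr
    by_cases h1 : r < 1
    · have h2 : Complex.polarCoord.symm (r, θ) ∈ Metric.ball (0 : ℂ) 1 := by
        rw [mem_ball_zero_iff, Complex.norm_polarCoord_symm, abs_of_pos hr0]; exact h1
      rw [Set.indicator_of_mem h2, Set.indicator_of_mem (show r ∈ Set.Ioc (0 : ℝ) 1 from ⟨hr0, h1.le⟩),
        Complex.norm_polarCoord_symm, abs_of_pos hr0, smul_eq_mul, ← ENNReal.ofReal_mul hr0.le]
      exact ENNReal.ofReal_le_ofReal (hb r hr0 h1)
    · have h2 : Complex.polarCoord.symm (r, θ) ∉ Metric.ball (0 : ℂ) 1 := by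
        rw [mem_ball_zero_iff, Complex.norm_polarCoord_symm, abs_of_pos hr0]; exact h1
      rw [Set.indicator_of_notMem h2, smul_zero]
      exact zero_le
  have hgm : Measurable fun p : ℝ × ℝ => (Set.Ioc (0 : ℝ) 1).indicator
      (fun r => ENNReal.ofReal ((1 - r) ^ a * (1 + 2 ^ a))) p.1 := by
    have : Measurable ((Set.Ioc (0 : ℝ) 1).indicator
      (fun r => ENNReal.ofReal ((1 - r) ^ a * (1 + 2 ^ a)))) := by
      refine Measurable.indicator ?_ measurableSet_Ioc
      fun_prop
    exact this.comp measurable_fst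
  refine lt_of_le_of_lt (setLIntegral_mono hgm hle) ?_
  rw [setLIntegral_prod_symm _ hgm.aemeasurable]
  dsimp only
  rw [lintegral_const]
  refine ENNReal.mul_lt_top ?_ (by simp)
  refine lt_of_le_of_lt (setLIntegral_le_lintegral _ _) ?_
  rw [lintegral_indicator measurableSet_Ioc]
  exact hint.lintegral_lt_top

theorem hasDerivAt_mob (g : SL(2, ℝ)) {z : ℂ} (hz : ‖z‖ ≤ 1) :
    HasDerivAt (mob g) (1 / den g z ^ 2) z := by
  have h0 := den_ne_zero g hz
  have h1 : HasDerivAt (num g) (al g) z := by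
    have h := ((hasDerivAt_id z).const_mul (al g)).add_const (be g)
    rw [mul_one] at h
    exact h
  have h2 : HasDerivAt (den g) (conj (be g)) z := by
    have h := ((hasDerivAt_id z).const_mul (conj (be g))).add_const (conj (al g))
    rw [mul_one] at h
    exact h
  convert! h1.div h2 h0 using 1
  have h3 : al g * conj (al g) - be g * conj (be g) = 1 := by
    rw [Complex.mul_conj, Complex.mul_conj, ← Complex.ofReal_sub, normSq_al_sub, Complex.ofReal_one]
  rw [den, num]
  congr 1
  linear_combination -h3

theorem lintegral_mobD (ℓ : ℝ) (g : SL(2, ℝ)) (F : Disc → ℝ≥0∞) (hF : Measurable F) :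
    ∫⁻ p : Disc, ENNReal.ofReal (‖den g p‖ ^ (-4 * ℓ)) * F (mobD g p) ∂bergmanMeasure ℓ =
      ∫⁻ p, F p ∂bergmanMeasure ℓ := by
  have hemb : MeasurableEmbedding (Subtype.val : Disc → ℂ) :=
    MeasurableEmbedding.subtype_coe Metric.isClosed_closedBall.measurableSet
  set E : ℂ → ℝ≥0∞ := Function.extend Subtype.val F 0 with hE
  have hEm : Measurable E := hemb.measurable_extend hF measurable_const
  have hEv : ∀ p : Disc, E p = F p := fun p => hemb.injective.extend_apply F 0 p
  have hden : Measurable fun z : ℂ => den g z := by unfold den; fun_prop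
  have hnum : Measurable fun z : ℂ => num g z := by unfold num; fun_prop
  have e1 : ∀ p : Disc, ENNReal.ofReal (‖den g p‖ ^ (-4 * ℓ)) * F (mobD g p) =
      (fun z : ℂ => ENNReal.ofReal (‖den g z‖ ^ (-4 * ℓ)) * E (mob g z)) p := fun p => by
    rw [← hEv]; rfl
  have e2 : ∀ p : Disc, F p = E p := fun p => (hEv p).symm
  simp only [e1]
  simp only [e2]
  rw [lintegral_bergmanMeasure ℓ
    (fun z : ℂ => ENNReal.ofReal (‖den g z‖ ^ (-4 * ℓ)) * E (mob g z))
    (((hden.norm.pow_const _).ennreal_ofReal).mul (hEm.comp (hnum.div hden))),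
    lintegral_bergmanMeasure ℓ E hEm]
  have himg : mob g '' Metric.ball (0 : ℂ) 1 = Metric.ball (0 : ℂ) 1 := by
    ext z
    simp only [Set.mem_image, mem_ball_zero_iff]
    constructor
    · rintro ⟨w, hw, rfl⟩
      exact norm_mob_lt g hw
    · intro hz
      refine ⟨mob g⁻¹ z, norm_mob_lt g⁻¹ hz, ?_⟩
      rw [← mob_mul g g⁻¹ hz.le, mul_inv_cancel, mob_one]
  have hinj : Set.InjOn (mob g) (Metric.ball (0 : ℂ) 1) := by
    intro z hz w hw h
    rw [mem_ball_zero_iff] at hz hw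
    have h1 := congrArg (mob g⁻¹) h
    rwa [← mob_mul g⁻¹ g hz.le, ← mob_mul g⁻¹ g hw.le, inv_mul_cancel, mob_one, mob_one] at h1
  have hder : ∀ z ∈ Metric.ball (0 : ℂ) 1, HasFDerivWithinAt (mob g)
      ((ContinuousLinearMap.toSpanSingleton ℂ (1 / den g z ^ 2)).restrictScalars ℝ)
      (Metric.ball (0 : ℂ) 1) z := fun z hz =>
    ((hasDerivAt_mob g (mem_ball_zero_iff.1 hz).le).hasFDerivAt.restrictScalars ℝ).hasFDerivWithinAt
  have hdet : ∀ z : ℂ, ((ContinuousLinearMap.toSpanSingleton ℂ (1 / den g z ^ 2)).restrictScalars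
      ℝ).det = 1 / ‖den g z‖ ^ 4 := by
    intro z
    rw [ContinuousLinearMap.det]
    simp [LinearMap.det_restrictScalars, Algebra.norm_complex_eq, normSq_eq_norm_sq]
    ring
  conv_rhs => rw [← himg]
  rw [lintegral_image_eq_lintegral_abs_det_fderiv_mul volume Metric.isOpen_ball.measurableSet hder
    hinj]
  refine setLIntegral_congr_fun Metric.isOpen_ball.measurableSet fun z hz => ?_
  have hz1 : ‖z‖ < 1 := mem_ball_zero_iff.1 hz
  have hd : 0 < ‖den g z‖ := norm_pos_iff.2 (den_ne_zero g hz1.le)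
  have hp : 0 ≤ 1 - ‖z‖ ^ 2 := by nlinarith [norm_nonneg z]
  have h1 := one_sub_normSq_mob g hz1.le
  rw [normSq_eq_norm_sq, normSq_eq_norm_sq, normSq_eq_norm_sq] at h1
  rw [hdet, h1, abs_of_nonneg (by positivity), ← mul_assoc, ← mul_assoc,
    ← ENNReal.ofReal_mul (Real.rpow_nonneg hp _), ← ENNReal.ofReal_mul (by positivity)]
  congr 2
  have k1 : (‖den g z‖ ^ 2) ^ (2 * ℓ - 2) = ‖den g z‖ ^ (4 * ℓ) / ‖den g z‖ ^ 4 := by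
    rw [← Real.rpow_natCast ‖den g z‖ 2, ← Real.rpow_natCast ‖den g z‖ 4, ← Real.rpow_mul hd.le,
      ← Real.rpow_sub hd]
    congr 1
    push_cast
    ring
  have k2 : ‖den g z‖ ^ (-4 * ℓ) = (‖den g z‖ ^ (4 * ℓ))⁻¹ := by
    rw [← Real.rpow_neg hd.le]
    congr 1
    ring
  have k3 : 0 < ‖den g z‖ ^ (4 * ℓ) := Real.rpow_pos_of_pos hd _
  rw [Real.div_rpow hp (by positivity), k1, k2]
  field_simp

theorem continuous_mobD_cover : Continuous fun p : Cover × Disc => mobD p.1.g p.2 := by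
  have h : Continuous fun p : Cover × Disc => (p.1.g, p.2) :=
    (Cover.continuous_g.comp continuous_fst).prodMk continuous_snd
  exact Continuous.comp (g := fun q : SL(2, ℝ) × Disc => mobD q.1 q.2)
    (f := fun p : Cover × Disc => (p.1.g, p.2)) continuous_mobD_uncurry h

theorem enorm_sq_exp (ℓ : ℝ) (x : Cover) (p : Disc) (u : ℂ) (hu : u.re = -2 * ℓ * (x.φ p).re) :
    ‖Complex.exp u‖ₑ ^ 2 = ENNReal.ofReal (‖den x.g p‖ ^ (-4 * ℓ)) := by
  have h2 : ‖den x.g p‖ = Real.exp (x.φ p).re := by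
    rw [← Complex.norm_exp, x.exp_φ]
  rw [← ofReal_norm, Complex.norm_exp, h2, ← ENNReal.ofReal_pow (Real.exp_pos _).le,
    ← Real.exp_mul, ← Real.exp_nat_mul, hu]
  congr 2
  push_cast
  ring

/-- The multiplier `J^{-2ℓ} = exp (-2ℓφ)` on the disc, where `J = exp φ` is the automorphy
factor. -/
def holMultiplier (ℓ : ℝ) : Multiplier Disc (bergmanMeasure ℓ) where
  act x := mobD x.g
  c x p := Complex.exp (-2 * ℓ * x.φ p)
  act_one := mobD_one
  act_mul x y p := mobD_mul x.g y.g p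
  continuous_act := continuous_mobD_cover
  c_one p := by simp
  c_mul x y p := by
    rw [← Complex.exp_add, Cover.mul_φ]
    congr 1
    ring
  continuous_c := Complex.continuous_exp.comp (continuous_const.mul Cover.continuous_φ_uncurry)
  invariant x F hF := by
    rw [← lintegral_mobD ℓ x.g F hF]
    refine lintegral_congr fun p => ?_
    rw [enorm_sq_exp ℓ x p _ (by simp)]

/-- The multiplier `conj J^{-2ℓ}` on the disc, where `J = exp φ` is the automorphy factor. -/
def antiMultiplier (ℓ : ℝ) : Multiplier Disc (bergmanMeasure ℓ) where
  act x := mobD x.g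
  c x p := Complex.exp (-2 * ℓ * conj (x.φ p))
  act_one := mobD_one
  act_mul x y p := mobD_mul x.g y.g p
  continuous_act := continuous_mobD_cover
  c_one p := by simp
  c_mul x y p := by
    rw [← Complex.exp_add, Cover.mul_φ, map_add]
    congr 1
    ring
  continuous_c := Complex.continuous_exp.comp (continuous_const.mul
    (Complex.continuous_conj.comp Cover.continuous_φ_uncurry))
  invariant x F hF := by
    rw [← lintegral_mobD ℓ x.g F hF]
    refine lintegral_congr fun p => ?_
    rw [enorm_sq_exp ℓ x p _ (by simp)]

/-- The square-integrable holomorphic functions on the disc. -/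
def holL2 (ℓ : ℝ) : Submodule ℂ (Lp ℂ 2 (bergmanMeasure ℓ)) where
  carrier := {f | ∃ F : ℂ → ℂ, DifferentiableOn ℂ F (Metric.ball 0 1) ∧
    ∀ᵐ p ∂bergmanMeasure ℓ, f p = F p}
  add_mem' := by
    rintro f g ⟨F, hF, hf⟩ ⟨G, hG, hg⟩
    refine ⟨F + G, hF.add hG, ?_⟩
    filter_upwards [hf, hg, Lp.coeFn_add f g] with p h1 h2 h3
    rw [h3, Pi.add_apply, h1, h2, Pi.add_apply]
  zero_mem' := by
    refine ⟨fun _ => 0, differentiableOn_const 0, ?_⟩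
    filter_upwards [Lp.coeFn_zero ℂ 2 (bergmanMeasure ℓ)] with p h
    rw [h, Pi.zero_apply]
  smul_mem' := by
    rintro a f ⟨F, hF, hf⟩
    refine ⟨a • F, hF.const_smul a, ?_⟩
    filter_upwards [hf, Lp.coeFn_smul a f] with p h1 h2
    rw [h2, Pi.smul_apply, h1, Pi.smul_apply]

/-- The square-integrable antiholomorphic functions on the disc. -/
def antiL2 (ℓ : ℝ) : Submodule ℂ (Lp ℂ 2 (bergmanMeasure ℓ)) where
  carrier := {f | ∃ F : ℂ → ℂ, DifferentiableOn ℂ F (Metric.ball 0 1) ∧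
    ∀ᵐ p ∂bergmanMeasure ℓ, f p = conj (F p)}
  add_mem' := by
    rintro f g ⟨F, hF, hf⟩ ⟨G, hG, hg⟩
    refine ⟨F + G, hF.add hG, ?_⟩
    filter_upwards [hf, hg, Lp.coeFn_add f g] with p h1 h2 h3
    rw [h3, Pi.add_apply, h1, h2, Pi.add_apply, map_add]
  zero_mem' := by
    refine ⟨fun _ => 0, differentiableOn_const 0, ?_⟩
    filter_upwards [Lp.coeFn_zero ℂ 2 (bergmanMeasure ℓ)] with p h
    rw [h, Pi.zero_apply, map_zero]
  smul_mem' := by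
    rintro a f ⟨F, hF, hf⟩
    refine ⟨conj a • F, hF.const_smul (conj a), ?_⟩
    filter_upwards [hf, Lp.coeFn_smul a f] with p h1 h2
    rw [h2, Pi.smul_apply, h1, Pi.smul_apply, smul_eq_mul, smul_eq_mul, map_mul, Complex.conj_conj]

/-- A continuous logarithm of the automorphy factor is holomorphic in the open disc. -/
theorem exists_differentiableOn_φ (x : Cover) : ∃ Φ : ℂ → ℂ,
    DifferentiableOn ℂ Φ (Metric.ball 0 1) ∧ ∀ p : Disc, Φ p = x.φ p := by
  classical
  let Φ : ℂ → ℂ := fun z => if h : z ∈ Metric.closedBall (0 : ℂ) 1 then x.φ ⟨z, h⟩ else 0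
  have hΦ : ∀ p : Disc, Φ p = x.φ p := fun p => dif_pos p.2
  have hc : ContinuousOn Φ (Metric.closedBall (0 : ℂ) 1) := by
    rw [continuousOn_iff_continuous_domRestrict]
    have : (Metric.closedBall (0 : ℂ) 1).domRestrict Φ = x.φ := funext hΦ
    rw [this]
    exact x.φ.continuous
  refine ⟨Φ, fun z hz => ?_, hΦ⟩
  have hn : Metric.ball (0 : ℂ) 1 ∈ 𝓝 z := Metric.isOpen_ball.mem_nhds hz
  have hcz : ContinuousAt Φ z := (hc.mono Metric.ball_subset_closedBall).continuousAt hn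
  have he : ∀ w ∈ Metric.ball (0 : ℂ) 1, Complex.exp (Φ w) = den x.g w := fun w hw => by
    have h1 := x.exp_φ ⟨w, Metric.ball_subset_closedBall hw⟩
    rwa [← hΦ] at h1
  have him : ∀ᶠ w in 𝓝 z, |(Φ w - Φ z).im| < Real.pi := by
    have h1 : ContinuousAt (fun w => |(Φ w - Φ z).im|) z :=
      (Complex.continuous_im.continuousAt.comp (hcz.sub continuousAt_const)).abs
    refine h1.eventually_lt_const ?_
    simpa using Real.pi_pos
  have hev : Φ =ᶠ[𝓝 z] fun w => Complex.log (den x.g w / den x.g z) + Φ z := by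
    filter_upwards [hn, him] with w hw hi
    rw [abs_lt] at hi
    rw [← he w hw, ← he z hz, ← Complex.exp_sub, Complex.log_exp hi.1 hi.2.le]
    ring
  have hd0 : den x.g z ≠ 0 := den_ne_zero x.g (mem_ball_zero_iff.1 hz).le
  have hd : DifferentiableAt ℂ (fun w => den x.g w / den x.g z) z := by
    unfold den; fun_prop
  refine (DifferentiableAt.congr_of_eventuallyEq ?_ hev).differentiableWithinAt
  refine (hd.clog ?_).add_const _
  rw [div_self hd0]
  exact Complex.one_mem_slitPlane

theorem differentiableOn_comp_mob {F : ℂ → ℂ} (hF : DifferentiableOn ℂ F (Metric.ball 0 1))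
    (g : SL(2, ℝ)) : DifferentiableOn ℂ (fun z => F (mob g z)) (Metric.ball 0 1) := by
  refine hF.comp (fun z hz => ?_) fun z hz => ?_
  · exact (hasDerivAt_mob g (mem_ball_zero_iff.1 hz).le).differentiableAt.differentiableWithinAt
  · exact mem_ball_zero_iff.2 (norm_mob_lt g (mem_ball_zero_iff.1 hz))

theorem op_mem_holL2 (ℓ : ℝ) (x : Cover) (f : Lp ℂ 2 (bergmanMeasure ℓ)) (hf : f ∈ holL2 ℓ) :
    (holMultiplier ℓ).op x f ∈ holL2 ℓ := by
  obtain ⟨F, hF, h⟩ := hf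
  obtain ⟨Φ, hΦ, hΦx⟩ := exists_differentiableOn_φ x
  refine ⟨fun z => Complex.exp (-2 * ℓ * Φ z) * F (mob x.g z),
    (hΦ.const_mul _).cexp.mul (differentiableOn_comp_mob hF x.g), ?_⟩
  filter_upwards [(holMultiplier ℓ).op_coeFn x f, ((holMultiplier ℓ).qmp x).ae h] with p h1 h2
  rw [h1, h2, hΦx]
  rfl

theorem op_mem_antiL2 (ℓ : ℝ) (x : Cover) (f : Lp ℂ 2 (bergmanMeasure ℓ)) (hf : f ∈ antiL2 ℓ) :
    (antiMultiplier ℓ).op x f ∈ antiL2 ℓ := by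
  obtain ⟨F, hF, h⟩ := hf
  obtain ⟨Φ, hΦ, hΦx⟩ := exists_differentiableOn_φ x
  refine ⟨fun z => Complex.exp (-2 * ℓ * Φ z) * F (mob x.g z),
    (hΦ.const_mul _).cexp.mul (differentiableOn_comp_mob hF x.g), ?_⟩
  filter_upwards [(antiMultiplier ℓ).op_coeFn x f, ((antiMultiplier ℓ).qmp x).ae h] with p h1 h2
  rw [h1, h2, map_mul, ← Complex.exp_conj, hΦx]
  simp only [map_mul, map_neg, Complex.conj_ofReal, map_ofNat]
  rfl

/-- The weighted Bergman space `W_{ℓ,+}` of square-integrable holomorphic functions on the disc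
(this space of functions is closed in `L²`; taking the closure makes completeness manifest). -/
def holSpace (ℓ : ℝ) : Submodule ℂ (Lp ℂ 2 (bergmanMeasure ℓ)) := (holL2 ℓ).topologicalClosure

/-- The space `W_{ℓ,-}` of square-integrable antiholomorphic functions on the disc. -/
def antiSpace (ℓ : ℝ) : Submodule ℂ (Lp ℂ 2 (bergmanMeasure ℓ)) := (antiL2 ℓ).topologicalClosure

instance (ℓ : ℝ) : CompleteSpace (holSpace ℓ) :=
  (Submodule.isClosed_topologicalClosure (holL2 ℓ)).completeSpace_coe

instance (ℓ : ℝ) : CompleteSpace (antiSpace ℓ) :=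
  (Submodule.isClosed_topologicalClosure (antiL2 ℓ)).completeSpace_coe

theorem mem_closure_of_forall {ℓ : ℝ} (M : Multiplier Disc (bergmanMeasure ℓ))
    (W : Submodule ℂ (Lp ℂ 2 (bergmanMeasure ℓ))) (h : ∀ x, ∀ f ∈ W, M.op x f ∈ W) (x : Cover)
    (f : Lp ℂ 2 (bergmanMeasure ℓ)) (hf : f ∈ W.topologicalClosure) :
    M.op x f ∈ W.topologicalClosure :=
  map_mem_closure (M.op x).continuous hf fun g hg => h x g hg

/-- The discrete series representation `ω_{ℓ,+}` of lowest weight `ℓ`, for `ℓ > 1/2`: it acts on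
the square-integrable holomorphic functions on the disc by `(ω(x) f)(z) = J^{-2ℓ} f(x⁻¹ z)`, where
`J` is the automorphy factor of `x⁻¹` at `z`. -/
def discretePlus (ℓ : ℝ) (hℓ : 1 / 2 < ℓ) : UnitaryRep (holSpace ℓ) :=
  haveI := isFiniteMeasure_bergmanMeasure hℓ
  (holMultiplier ℓ).rep.restrict (holSpace ℓ) fun x f hf =>
    mem_closure_of_forall (holMultiplier ℓ) (holL2 ℓ) (op_mem_holL2 ℓ) x⁻¹ f hf

/-- The discrete series representation `ω_{ℓ,-}` of highest weight `-ℓ`, for `ℓ > 1/2`: it acts on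
the square-integrable antiholomorphic functions on the disc by
`(ω(x) f)(z) = conj J^{-2ℓ} f(x⁻¹ z)`, where `J` is the automorphy factor of `x⁻¹` at `z`. -/
def discreteMinus (ℓ : ℝ) (hℓ : 1 / 2 < ℓ) : UnitaryRep (antiSpace ℓ) :=
  haveI := isFiniteMeasure_bergmanMeasure hℓ
  (antiMultiplier ℓ).rep.restrict (antiSpace ℓ) fun x f hf =>
    mem_closure_of_forall (antiMultiplier ℓ) (antiL2 ℓ) (op_mem_antiL2 ℓ) x⁻¹ f hf


end SL2Dirac

end

/-! Pairing `ξ ⊗ v ↦ (π(ξ₀) v, π(ξ₁) v)` identifies `(A ⊕ A) ⊗_A V` with `V ⊕ V` (`locEquiv`). Left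
invariance of Haar measure turns the right-invariant field `Xₖ` into the derivative at `t = 0` of
`π(exp tXₖ)⁻¹`. These derivatives are skew-symmetric because `π` is unitary, and the matrices
`c(Xₖ)` are skew-adjoint, so `D` becomes a symmetric operator.

Each of the three representations has a total sequence of weight vectors `e n` on which the rotation
generator acts by `i x`, with `x = n + x₀`, and `X₁ ± iX₂` shift the index with coefficients `-(x +
s)` and `x - s` (`IsLadder`). The Casimir eigenvalue is `q = s(1 - s)`. Then `D` preserves the span
of `(e n, 0)` and `(0, e (n - 1))`. Its matrix there has trace `-1` and determinant `-(q + 2x(x -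
1))`, whence the eigenvalues `-1/2 ± √(1/4 + q + 2x(x - 1))`. Where the ladder ends only one of the
two vectors survives, and `D` acts on it by a scalar; this is the isolated eigenvalue `-ℓ` of the
discrete series.

The analytic difficulty is that the domain of `D ⊗ 1` consists of the vectors `π(f) v` and their
sums, among which weight vectors need not occur. They are recovered in the closure by the mean
ergodic theorem (`mem_closure_of_isometry`). The unitary `π(exp X₀)⁻¹ ⊗ diag(1, e^i)` preserves the
domain, and its eigenspaces are at most two-dimensional because `π` is irrational. Averaging
projects the graph onto such an eigenspace, and a dense subspace of a finite-dimensional space is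
everything (`IsLadder.mem_closure`).

Finally, a closed symmetric operator whose eigenvectors are total and whose set of eigenvalues is
closed has exactly these eigenvalues as its spectrum (`graphSpectrum_eq_of_eigen`). What remains is
to exhibit the ladders: `ζ ^ n` on the circle with `s = 1/2 + i√(q - 1/4)`, and `z ^ n` or `conj z ^
n` on the disc with `s = ℓ`. Totality of the latter comes from Taylor expansion on smaller discs. -/

noncomputable section

namespace SL2Dirac

/-! ### Symmetric operators given by their graphs -/

section SymmetricRelations

variable {H : Type*} [NormedAddCommGroup H] [InnerProductSpace ℂ H]

/-- A relation on a Hilbert space, thought of as the graph of an operator, is symmetric. -/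
def IsSymmRel (Γ : Set (H × H)) : Prop :=
  ∀ p ∈ Γ, ∀ q ∈ Γ, ⟪p.1, q.2⟫_ℂ = ⟪p.2, q.1⟫_ℂ

theorem IsSymmRel.closure {Γ : Set (H × H)} (h : IsSymmRel Γ) : IsSymmRel (closure Γ) := by
  have h1 : ∀ p ∈ Γ, ∀ q ∈ _root_.closure Γ, ⟪p.1, q.2⟫_ℂ = ⟪p.2, q.1⟫_ℂ := by
    intro p hp q hq
    refine closure_minimal (t := {q | ⟪p.1, q.2⟫_ℂ = ⟪p.2, q.1⟫_ℂ}) (fun q hq => by exact h p hp q hq)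
      (isClosed_eq ?_ ?_) hq <;> fun_prop
  intro p hp q hq
  refine closure_minimal (t := {p | ⟪p.1, q.2⟫_ℂ = ⟪p.2, q.1⟫_ℂ}) (fun p hp => by exact h1 p hp q hq)
    (isClosed_eq ?_ ?_) hp <;> fun_prop

/-- The eigenspace at `c` of the operator with graph `Γ`. -/
def eigen (Γ : Submodule ℂ (H × H)) (c : ℂ) : Submodule ℂ H :=
  Γ.comap (LinearMap.prod LinearMap.id (c • LinearMap.id))

theorem mem_eigen {Γ : Submodule ℂ (H × H)} {c : ℂ} {v : H} : v ∈ eigen Γ c ↔ (v, c • v) ∈ Γ :=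
  Iff.rfl

/-- Symmetry gives `(z - c) ⟪v, w⟫ = 0`, and only `c` has to be real for this. With `z` arbitrary
the same fact yields both the mutual orthogonality of the eigenspaces and the uniqueness of the
resolvent. -/
theorem inner_eq_zero_of_mem_eigen {Γ : Submodule ℂ (H × H)} (hs : IsSymmRel (Γ : Set (H × H)))
    {c : ℝ} {z : ℂ} (h : (c : ℂ) ≠ z) {v w : H} (hv : v ∈ eigen Γ c) (hw : w ∈ eigen Γ z) :
    ⟪v, w⟫_ℂ = 0 := by
  have h1 := hs _ hv _ hw
  simp only [LinearMap.prod_apply, Function.prod, LinearMap.id_apply, LinearMap.smul_apply,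
    inner_smul_left, inner_smul_right, Complex.conj_ofReal] at h1
  have h2 : (z - c) * ⟪v, w⟫_ℂ = 0 := by linear_combination h1
  exact (mul_eq_zero.1 h2).resolve_left (sub_ne_zero.2 h.symm)

/-- The operator is diagonal: off `Λ` the resolvent must be multiplication by `(c - z)⁻¹` on the
eigenspace at `c`. As the eigenspaces are orthogonal, it is bounded by the inverse of the distance
from `z` to `Λ`, which is positive because `Λ` is closed. Self-adjointness need not be assumed
beforehand. -/
theorem graphSpectrum_eq_of_eigen [CompleteSpace H] (Γ : Submodule ℂ (H × H))
    (hcl : IsClosed (Γ : Set (H × H))) (hs : IsSymmRel (Γ : Set (H × H))) {Λ : Set ℝ}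
    (hΛ : IsClosed Λ) (hd : Dense ((⨆ c : Λ, eigen Γ (c : ℝ) : Submodule ℂ H) : Set H))
    (hn : ∀ c ∈ Λ, ∃ v ≠ 0, v ∈ eigen Γ (c : ℝ)) :
    graphSpectrum (Γ : Set (H × H)) = (fun c : ℝ => (c : ℂ)) '' Λ := by
  classical
  ext z
  constructor
  · intro hz
    by_contra hzΛ
    refine hz ?_
    have hopen : IsOpen ((fun c : ℝ => (c : ℂ)) '' Λ)ᶜ :=
      (Complex.isUniformEmbedding_ofReal.isClosedEmbedding.isClosedMap Λ hΛ).isOpen_compl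
    obtain ⟨δ, hδ, hball⟩ := Metric.isOpen_iff.1 hopen z hzΛ
    have hdist : ∀ c : Λ, δ ≤ ‖(((c : ℝ) : ℂ)) - z‖ := by
      intro c
      by_contra hlt
      rw [not_le, ← dist_eq_norm] at hlt
      exact hball hlt ⟨c, c.2, rfl⟩
    have hne : ∀ c : Λ, (((c : ℝ) : ℂ)) - z ≠ 0 := fun c => by
      rw [← norm_pos_iff]; exact hδ.trans_le (hdist c)
    have horth : OrthogonalFamily ℂ (fun c : Λ => eigen Γ (c : ℝ))
        (fun c => (eigen Γ (c : ℝ)).subtypeₗᵢ) := by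
      intro c c' hcc v w
      refine inner_eq_zero_of_mem_eigen hs ?_ v.2 w.2
      exact_mod_cast fun h => hcc (Subtype.ext h)
    -- `e` sums a finite family of eigenvectors and `f` sums their images under the expected
    -- resolvent; `R` is the continuous map with `R ∘ e = f`.
    let e : (Π₀ c : Λ, eigen Γ (c : ℝ)) →ₗ[ℂ] H :=
      DFinsupp.lsum ℂ fun c => (eigen Γ (c : ℝ)).subtype
    let f : (Π₀ c : Λ, eigen Γ (c : ℝ)) →ₗ[ℂ] H :=
      DFinsupp.lsum ℂ fun c => ((((c : ℝ) : ℂ)) - z)⁻¹ • (eigen Γ (c : ℝ)).subtype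
    have he : ∀ x, e x = ∑ c ∈ x.support, (eigen Γ (c : ℝ)).subtypeₗᵢ (x c) := fun x => by
      simp [e, DFinsupp.lsum_apply_apply, DFinsupp.sumAddHom_apply, DFinsupp.sum]
    have hf : ∀ x, f x = ∑ c ∈ x.support,
        (eigen Γ (c : ℝ)).subtypeₗᵢ (((((c : ℝ) : ℂ)) - z)⁻¹ • x c) := fun x => by
      simp [f, DFinsupp.lsum_apply_apply, DFinsupp.sumAddHom_apply, DFinsupp.sum]
    have hbound : ∀ x, ‖f x‖ ≤ δ⁻¹ * ‖e x‖ := by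
      intro x
      refine le_of_sq_le_sq ?_ (by positivity)
      rw [mul_pow, he, hf, horth.norm_sum, horth.norm_sum, Finset.mul_sum]
      refine Finset.sum_le_sum fun c _ => ?_
      rw [norm_smul, mul_pow, norm_inv]
      have := hdist c
      gcongr
    have hdr : DenseRange e := by
      have h1 : (⨆ c : Λ, eigen Γ (c : ℝ) : Submodule ℂ H) ≤ LinearMap.range e := by
        refine iSup_le fun c v hv => ⟨DFinsupp.single c ⟨v, hv⟩, ?_⟩
        simp [e]
      exact hd.mono h1
    let R := f.extendOfNorm e
    have hR : ∀ x, R (e x) = f x := fun x => LinearMap.extendOfNorm_eq hdr ⟨_, hbound⟩ x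
    have hΓ : ∀ y, (R y, z • R y + y) ∈ Γ := by
      intro y
      refine hdr.induction (P := fun y => (R y, z • R y + y) ∈ Γ) ?_ ?_ y
      · rintro _ ⟨x, rfl⟩
        rw [hR, hf, he, Finset.smul_sum, ← Finset.sum_add_distrib, prod_mk_sum]
        refine Γ.sum_mem fun c _ => ?_
        have h1 : ((((c : ℝ) : ℂ)) - z)⁻¹ • (x c : H) ∈ eigen Γ (c : ℝ) :=
          Submodule.smul_mem _ _ (x c).2
        rw [mem_eigen] at h1
        convert! h1 using 2
        simp only [map_smul, Submodule.coe_subtypeₗᵢ, Submodule.coe_subtype, smul_smul]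
        rw [← one_smul ℂ (x c : H), smul_smul, smul_smul, ← add_smul]
        congr 1
        field_simp [hne c]
        ring
      · exact hcl.preimage (by fun_prop)
    refine ⟨R, hΓ, fun p hp => ?_⟩
    -- Two points of `Γ` with the same value of `T - z` differ by an eigenvector at `z`. It is
    -- orthogonal to all eigenvectors with eigenvalue in `Λ`, a total set, hence zero.
    set y := p.2 - z • p.1 with hy
    have h1 : p - (R y, z • R y + y) ∈ Γ := Γ.sub_mem hp (hΓ y)
    have h2 : p.1 - R y ∈ eigen Γ z := by
      rw [mem_eigen]
      convert! h1 using 1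
      refine Prod.ext rfl ?_
      simp only [hy, Prod.snd_sub, smul_sub]
      abel
    have h3 : (⨆ c : Λ, eigen Γ (c : ℝ) : Submodule ℂ H) ≤ (ℂ ∙ (p.1 - R y))ᗮ := by
      refine iSup_le fun c v hv => ?_
      rw [Submodule.mem_orthogonal_singleton_iff_inner_left]
      exact inner_eq_zero_of_mem_eigen hs (sub_ne_zero.1 (hne c)) hv h2
    have h4 : ((ℂ ∙ (p.1 - R y))ᗮ : Submodule ℂ H) = ⊤ := by
      rw [← SetLike.coe_set_eq, Submodule.top_coe, ← (hd.mono h3).closure_eq,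
        (Submodule.isClosed_orthogonal _).closure_eq]
    have h5 : p.1 - R y ∈ (ℂ ∙ (p.1 - R y))ᗮ := h4 ▸ Submodule.mem_top
    rw [Submodule.mem_orthogonal_singleton_iff_inner_left, inner_self_eq_zero, sub_eq_zero] at h5
    exact h5.symm
  -- At an eigenvalue, `T - c` kills a nonzero vector and so has no left inverse.
  · rintro ⟨c, hc, rfl⟩ ⟨R, -, hR⟩
    obtain ⟨v, hv0, hv⟩ := hn c hc
    have h1 := hR _ hv
    simp at h1
    exact hv0 h1.symm

theorem birkhoffAverage_mem {E : Type*} [NormedAddCommGroup E] [NormedSpace ℂ E]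
    (S : Submodule ℂ E) (f : E → E) (h : ∀ x ∈ S, f x ∈ S) {x : E} (hx : x ∈ S) (n : ℕ) :
    birkhoffAverage ℂ f _root_.id n x ∈ S := by
  refine S.smul_mem _ (S.sum_mem fun k _ => ?_)
  dsimp only [_root_.id]
  clear * - h hx
  induction k with
  | zero => exact hx
  | succ k ih => rw [Function.iterate_succ_apply']; exact h _ ih

variable {J : Type*} {b d : J → H} {χ : J → ℂ}

/-- Replaces the adjoint relation `U* b = conj χ • b`, so that `U` need not be surjective. -/
theorem inner_isometry_of_eigen (U : H →ₗᵢ[ℂ] H) {b : H} {χ : ℂ} (hχ : ‖χ‖ = 1)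
    (hb : U b = χ • b) (x : H) : ⟪b, U x⟫_ℂ = χ * ⟪b, x⟫_ℂ := by
  have h1 : ⟪U b, U x⟫_ℂ = ⟪b, x⟫_ℂ := U.inner_map_map b x
  rw [hb, inner_smul_left] at h1
  rw [← h1, ← mul_assoc, Complex.mul_conj, Complex.normSq_eq_norm_sq, hχ]
  simp

/-- Let `Γ` be the graph of a densely defined operator whose domain is invariant under an
isometry `U`, and which acts on a total family `b` of eigenvectors of `U` in the weak sense by
`b j ↦ d j`.  If the eigenvalues of `U` have finite multiplicity, then the closure of `Γ` contains
the pairs `(b j, d j)`. -/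
theorem mem_closure_of_isometry [CompleteSpace H] (Γ : Submodule ℂ (H × H)) (U : H →ₗᵢ[ℂ] H)
    (hdom : Dense (Prod.fst '' (Γ : Set (H × H))))
    (hU : ∀ p ∈ Γ, ∃ y, (U p.1, y) ∈ Γ)
    (hw : ∀ p ∈ Γ, ∀ i, ⟪b i, p.2⟫_ℂ = ⟪d i, p.1⟫_ℂ)
    (hsymm : ∀ i j, ⟪b i, d j⟫_ℂ = ⟪d i, b j⟫_ℂ)
    (htot : ∀ x, (∀ i, ⟪b i, x⟫_ℂ = 0) → x = 0)
    (hχ : ∀ i, ‖χ i‖ = 1) (hUb : ∀ i, U (b i) = χ i • b i) (hUd : ∀ i, U (d i) = χ i • d i)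
    (hfin : ∀ j, {i | χ i = χ j}.Finite) (j : J) : (b j, d j) ∈ closure (Γ : Set (H × H)) := by
  -- Invariance of the domain suffices: pairing with the total family `b` determines the second
  -- entry of a point of `Γ` from the first, and by this test the entry over `U p.1` is `U p.2`.
  have hUΓ : ∀ p ∈ Γ, (U p.1, U p.2) ∈ Γ := by
    intro p hp
    obtain ⟨y, hy⟩ := hU p hp
    have h1 : y - U p.2 = 0 := htot _ fun i => by
      rw [inner_sub_right, hw _ hy i, inner_isometry_of_eigen U (hχ i) (hUb i),
        inner_isometry_of_eigen U (hχ i) (hUd i), hw p hp i, sub_self]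
    rwa [← sub_eq_zero.1 h1]
  -- Rescaled so that the eigenspace of `U` at `χ j` becomes the fixed space `B` of a contraction,
  -- as the mean ergodic theorem requires.
  let N : H →L[ℂ] H := (χ j)⁻¹ • U.toContinuousLinearMap
  have hχ0 : χ j ≠ 0 := by rw [← norm_pos_iff, hχ]; exact one_pos
  have hN : ‖N‖ ≤ 1 := by
    refine N.opNorm_le_bound zero_le_one fun x => ?_
    simp [N, norm_smul, hχ]
  have hNΓ : ∀ p ∈ Γ, (N p.1, N p.2) ∈ Γ := fun p hp => Γ.smul_mem (χ j)⁻¹ (hUΓ p hp)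
  have hNit : ∀ (p : H × H) (k : ℕ), (fun p : H × H => (N p.1, N p.2))^[k] p =
      (N^[k] p.1, N^[k] p.2) := by
    intro p k
    induction k with
    | zero => rfl
    | succ k ih => simp only [Function.iterate_succ_apply', ih]
  set B : Submodule ℂ H := N.eqLocus (1 : H →L[ℂ] H) with hB
  have hBmem : ∀ x, x ∈ B ↔ N x = x := fun x => Iff.rfl
  have hbB : b j ∈ B := by
    rw [hBmem]; simp [N, hUb, smul_smul, hχ0]
  let S : Set J := {i | χ i = χ j}
  have : Finite S := hfin j
  -- A vector of `B` is orthogonal to every `b i` with another eigenvalue, so the finitely many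
  -- remaining coefficients determine it; hence `B` is finite-dimensional.
  have hBinj : Function.Injective
      ((LinearMap.pi fun i : S => (innerSL ℂ (b i) : H →ₗ[ℂ] ℂ)) ∘ₗ B.subtype) := by
    rw [← LinearMap.ker_eq_bot, LinearMap.ker_eq_bot']
    rintro ⟨x, hx⟩ h0
    refine Subtype.ext (htot x fun i => ?_)
    by_cases hi : χ i = χ j
    · exact congrFun h0 ⟨i, hi⟩
    · have h1 : U x = χ j • x := by
        rw [hBmem] at hx
        conv_rhs => rw [← hx]
        simp [N, smul_smul, hχ0]
      have h2 := inner_isometry_of_eigen U (hχ i) (hUb i) x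
      rw [h1, inner_smul_right] at h2
      have h3 : (χ i - χ j) * ⟪b i, x⟫_ℂ = 0 := by linear_combination -h2
      exact (mul_eq_zero.1 h3).resolve_left (sub_ne_zero.2 hi)
  have : FiniteDimensional ℂ B := Module.Finite.of_injective _ hBinj
  let P : H →L[ℂ] B := B.orthogonalProjectionOnto
  -- The Birkhoff averages of both entries converge to their projections onto `B`, and the averaged
  -- pairs stay in `Γ`.
  have hP : ∀ p ∈ Γ, ((P p.1 : H), (P p.2 : H)) ∈ closure (Γ : Set (H × H)) := by
    intro p hp
    have t1 := N.tendsto_birkhoffAverage_orthogonalProjection hN p.1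
    have t2 := N.tendsto_birkhoffAverage_orthogonalProjection hN p.2
    refine mem_closure_of_tendsto (t1.prodMk_nhds t2) (Filter.Eventually.of_forall fun n => ?_)
    have h1 := birkhoffAverage_mem Γ (fun p : H × H => (N p.1, N p.2)) hNΓ hp n
    convert! h1 using 1
    simp only [birkhoffAverage, birkhoffSum, hNit, _root_.id, ← prod_mk_sum]
    rfl
  let D : Submodule ℂ B := (Γ.map (LinearMap.fst ℂ H H)).map (P : H →ₗ[ℂ] B)
  -- The projected domain is dense in `B`, and subspaces of a finite-dimensional space are closed.
  -- So `b j` is the projection of a vector of the domain.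
  have hD : D = ⊤ := by
    have h1 : (D : Set B) = P '' (Prod.fst '' (Γ : Set (H × H))) := rfl
    have h2 : Dense (D : Set B) := by
      rw [h1]
      refine (Function.Surjective.denseRange fun x => ⟨x, ?_⟩ :
        DenseRange P).dense_image P.continuous hdom
      exact B.orthogonalProjectionOnto_mem_subspace_eq_self x
    rw [← SetLike.coe_set_eq, ← D.closed_of_finiteDimensional.closure_eq, h2.closure_eq]
    rfl
  have hbD : (⟨b j, hbB⟩ : B) ∈ D := hD ▸ Submodule.mem_top
  obtain ⟨_, ⟨p, hp, rfl⟩, h1⟩ := hbD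
  have h2 : (P p.1 : H) = b j := congrArg Subtype.val h1
  have h3 := hP p hp
  rw [h2] at h3
  have hw' : ∀ q ∈ closure (Γ : Set (H × H)), ∀ i, ⟪b i, q.2⟫_ℂ = ⟪d i, q.1⟫_ℂ := by
    intro q hq i
    refine closure_minimal (fun q hq => hw q hq i) (isClosed_eq ?_ ?_) hq <;> fun_prop
  -- The weak formula for the action survives in the closure and identifies the second entry.
  have h4 : (P p.2 : H) - d j = 0 := htot _ fun i => by
    rw [inner_sub_right, hw' _ h3 i, hsymm, sub_self]
  rwa [← sub_eq_zero.1 h4]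

end SymmetricRelations

/-! ### Coordinates on the covering group -/

theorem normSq_cal (c : ℝ × ℂ) : normSq (cal c) = 1 + normSq c.2 := by
  have h := normSq_nonneg c.2
  rw [cal, map_mul, normSq_ofReal, normSq_eq_norm_sq (Complex.exp _), Complex.norm_exp_ofReal_mul_I,
    Real.mul_self_sqrt (by positivity)]
  simp

/-- The element of `SL(2,ℝ)` with prescribed values `α = conj (cal c)` and `β = c.2`. -/
def matOf (c : ℝ × ℂ) : SL(2, ℝ) :=
  ⟨!![(cal c).re + c.2.re, c.2.im + (cal c).im; c.2.im - (cal c).im, (cal c).re - c.2.re], by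
    rw [Matrix.det_fin_two_of]
    have h := normSq_cal c
    rw [normSq_apply, normSq_apply] at h
    linear_combination h⟩

theorem al_matOf (c : ℝ × ℂ) : al (matOf c) = conj (cal c) := by
  apply Complex.ext
  · simp [al, matOf]
  · simp only [al, matOf, Matrix.SpecialLinearGroup.coe_mk, Matrix.of_apply, Matrix.cons_val',
      Matrix.cons_val_zero, Matrix.cons_val_one, conj_im]
    ring

theorem be_matOf (c : ℝ × ℂ) : be (matOf c) = c.2 := by
  apply Complex.ext <;> simp [be, matOf]

theorem SL_ext_al_be {g h : SL(2, ℝ)} (ha : al g = al h) (hb : be g = be h) : g = h := by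
  have h1 := congrArg Complex.re ha
  have h2 := congrArg Complex.im ha
  have h3 := congrArg Complex.re hb
  have h4 := congrArg Complex.im hb
  simp only [al, be] at h1 h2 h3 h4
  apply Subtype.ext
  ext i j
  fin_cases i <;> fin_cases j
  · change g 0 0 = h 0 0; linarith
  · change g 0 1 = h 0 1; linarith
  · change g 1 0 = h 1 0; linarith
  · change g 1 1 = h 1 1; linarith

/-- The automorphy factor is `cal c * (1 + conj β * z / cal c)`. Since `|β| < |cal c|`, the second
factor stays in the right half-plane, where the principal logarithm is continuous. -/
theorem re_one_add_pos (c : ℝ × ℂ) {z : ℂ} (hz : ‖z‖ ≤ 1) :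
    0 < (1 + conj c.2 * z / cal c).re := by
  have h0 : ‖c.2‖ < ‖cal c‖ := by
    have h := normSq_cal c
    rw [normSq_eq_norm_sq, normSq_eq_norm_sq] at h
    exact lt_of_pow_lt_pow_left₀ 2 (norm_nonneg _) (by linarith)
  have hp : 0 < ‖cal c‖ := norm_pos_iff.2 (cal_ne_zero c)
  have h1 : ‖conj c.2 * z / cal c‖ < 1 := by
    rw [norm_div, norm_mul, RCLike.norm_conj, div_lt_one hp]
    nlinarith [norm_nonneg c.2, norm_nonneg z]
  have h2 := (abs_le.1 (Complex.abs_re_le_norm (conj c.2 * z / cal c))).1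
  rw [add_re, one_re]
  linarith

theorem continuous_cal_div : Continuous fun p : (ℝ × ℂ) × Disc =>
    1 + conj p.1.2 * (p.2 : ℂ) / cal p.1 := by
  have h1 : Continuous fun p : (ℝ × ℂ) × Disc => cal p.1 :=
    contDiff_cal.continuous.comp continuous_fst
  have h2 : Continuous fun p : (ℝ × ℂ) × Disc => (p.2 : ℂ) :=
    continuous_subtype_val.comp continuous_snd
  have h3 : Continuous fun p : (ℝ × ℂ) × Disc => conj p.1.2 :=
    Complex.continuous_conj.comp (continuous_snd.comp continuous_fst)
  exact continuous_const.add ((h3.mul h2).div h1 fun p => cal_ne_zero _)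

/-- The logarithm of the automorphy factor in terms of the coordinates. -/
def logOf (p : (ℝ × ℂ) × Disc) : ℂ :=
  Complex.log (1 + conj p.1.2 * (p.2 : ℂ) / cal p.1) +
    ((Real.log (√(1 + normSq p.1.2)) : ℝ) + p.1.1 * I)

theorem continuous_logOf : Continuous logOf := by
  refine (continuous_cal_div.clog fun p => Or.inl (re_one_add_pos p.1 p.2.norm_le)).add ?_
  have h1 : Continuous fun p : (ℝ × ℂ) × Disc => √(1 + normSq p.1.2) :=
    (continuous_const.add
      (contDiff_normSq.continuous.comp (continuous_snd.comp continuous_fst))).sqrt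
  have h2 : Continuous fun p : (ℝ × ℂ) × Disc => Real.log (√(1 + normSq p.1.2)) := by
    refine h1.log fun p => ?_
    have := normSq_nonneg p.1.2
    positivity
  have h3 : Continuous fun p : (ℝ × ℂ) × Disc => (p.1.1 : ℂ) :=
    Complex.continuous_ofReal.comp (continuous_fst.comp continuous_fst)
  exact (Complex.continuous_ofReal.comp h2).add (h3.mul continuous_const)

/-- The point of `G` with given coordinates. -/
def ofCoord (c : ℝ × ℂ) : Cover where
  g := matOf c
  φ := ⟨fun z => logOf (c, z), continuous_logOf.comp (by fun_prop)⟩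
  exp_φ z := by
    have h0 : 1 + conj c.2 * (z : ℂ) / cal c ≠ 0 := fun h => by
      have := re_one_add_pos c z.norm_le
      simp [h] at this
    have h1 := normSq_nonneg c.2
    have h2 : 0 < √(1 + normSq c.2) := by positivity
    have h3 : Complex.exp ((Real.log (√(1 + normSq c.2)) : ℝ) + c.1 * I) = cal c := by
      rw [Complex.exp_add, ← Complex.ofReal_exp, Real.exp_log h2, cal]
    change Complex.exp (_ + _) = _
    rw [Complex.exp_add, h3, Complex.exp_log h0, den, al_matOf, be_matOf, Complex.conj_conj]
    field_simp [cal_ne_zero c]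
    ring

theorem coord_ofCoord (c : ℝ × ℂ) : coord (ofCoord c) = c := by
  refine Prod.ext ?_ (be_matOf c)
  simp [coord, ofCoord, ctr, logOf]

theorem continuous_ofCoord : Continuous ofCoord := by
  refine Cover.isInducing.continuous_iff.2 (Continuous.prodMk ?_ ?_)
  · have h1 : Continuous fun c : ℝ × ℂ => (cal c).re :=
      Complex.continuous_re.comp contDiff_cal.continuous
    have h2 : Continuous fun c : ℝ × ℂ => (cal c).im :=
      Complex.continuous_im.comp contDiff_cal.continuous
    have h3 : Continuous fun c : ℝ × ℂ => c.2.re := Complex.continuous_re.comp continuous_snd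
    have h4 : Continuous fun c : ℝ × ℂ => c.2.im := Complex.continuous_im.comp continuous_snd
    refine continuous_SL_of fun i j => ?_
    fin_cases i <;> fin_cases j
    · exact h1.add h3
    · exact h4.add h2
    · exact h4.sub h2
    · exact h1.sub h3
  · exact ContinuousMap.continuous_of_continuous_uncurry _ continuous_logOf

instance : PreconnectedSpace Disc :=
  Subtype.preconnectedSpace (convex_closedBall (0 : ℂ) 1).isPreconnected

/-- `exp` is a covering map and the disc is connected, so two continuous logarithms of the same
function that agree at one point agree everywhere. -/
theorem Cover.ext_ctr {x y : Cover} (hg : x.g = y.g) (hφ : x.φ ctr = y.φ ctr) : x = y := by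
  refine Cover.ext hg (ContinuousMap.ext fun z => ?_)
  refine congrFun (Complex.isCoveringMap_exp.eq_of_comp_eq x.φ.continuous y.φ.continuous ?_ ctr hφ)
    z
  funext w
  refine Subtype.ext ?_
  change Complex.exp (x.φ w) = Complex.exp (y.φ w)
  rw [x.exp_φ, y.exp_φ, hg]

theorem coord_injective : Function.Injective coord := by
  intro x y h
  have ha : al x.g = al y.g := by
    rw [← Complex.conj_conj (al x.g), conj_al_eq, h, ← conj_al_eq, Complex.conj_conj]
  have hg : x.g = y.g := SL_ext_al_be ha (congrArg Prod.snd h)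
  refine Cover.ext_ctr hg (Complex.ext ?_ (congrArg Prod.fst h))
  have h1 : ∀ w : Cover, Real.exp (w.φ ctr).re = ‖den w.g ctr‖ := fun w => by
    rw [← w.exp_φ, Complex.norm_exp]
  exact Real.exp_injective (by rw [h1, h1, hg])

/-- The coordinates as a homeomorphism. -/
def coordHomeo : Cover ≃ₜ ℝ × ℂ where
  toFun := coord
  invFun := ofCoord
  left_inv _ := coord_injective (coord_ofCoord _)
  right_inv := coord_ofCoord
  continuous_toFun := continuous_coord
  continuous_invFun := continuous_ofCoord

/-- A smooth bump on `ℝ × ℂ` pulled back along the coordinates. The real function `r` is kept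
alongside so that positivity of its integral can be used when it is normalised to an approximate
identity. -/
theorem exists_testFun_bump {U : Set Cover} (hU : U ∈ 𝓝 (1 : Cover)) :
    ∃ (f : TestFun) (r : Cover → ℝ), (∀ x, f.1 x = r x) ∧ (∀ x, 0 ≤ r x) ∧ r 1 = 1 ∧
      Function.support r ⊆ U := by
  have hV : coordHomeo '' U ∈ 𝓝 (coordHomeo 1) := coordHomeo.isOpenMap.image_mem_nhds hU
  obtain ⟨F, hF, hFc, hFs, hFr, hF1⟩ := exists_contDiff_tsupport_subset (n := ⊤) hV
  refine ⟨⟨fun x => (F (coordHomeo x) : ℂ), ?_, fun c => (F c : ℂ),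
    contDiff_ofReal'.comp hFs, fun x => rfl⟩, fun x => F (coordHomeo x), fun x => rfl,
    fun x => (hFr ⟨_, rfl⟩).1, hF1, fun x hx => ?_⟩
  · exact (hFc.comp_homeomorph coordHomeo).comp_left (g := fun r : ℝ => (r : ℂ)) (by simp)
  · obtain ⟨y, hy, hxy⟩ := hF (subset_tsupport _ hx)
    rwa [← coordHomeo.injective hxy]

/-! ### One-parameter subgroups -/

/-- Both arguments lie in `(-π/2, π/2)`, so their sum stays within the range on which the principal
logarithm is additive. -/
theorem posLift_mul {g h : SL(2, ℝ)} (hg : ∀ z : Disc, 0 < (den g z).re)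
    (hh : ∀ z : Disc, 0 < (den h z).re) (hgh : ∀ z : Disc, 0 < (den (g * h) z).re) :
    posLift (g * h) hgh = posLift g hg * posLift h hh := by
  refine Cover.ext rfl (ContinuousMap.ext fun z => ?_)
  change Complex.log (den (g * h) z) = Complex.log (den g (mobD h z)) + Complex.log (den h z)
  have h1 := abs_lt.1 (Complex.abs_arg_lt_pi_div_two_iff.2 (Or.inl (hg (mobD h z))))
  have h2 := abs_lt.1 (Complex.abs_arg_lt_pi_div_two_iff.2 (Or.inl (hh z)))
  rw [den_mul g h z.norm_le]
  exact Complex.log_mul (den_ne_zero g (mobD h z).norm_le) (den_ne_zero h z.norm_le)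
    ⟨by rw [coe_mobD] at h1; linarith [h1.1, h2.1], by rw [coe_mobD] at h1; linarith [h1.2, h2.2]⟩

theorem posLift_congr {g h : SL(2, ℝ)} (e : g = h) (hg : ∀ z : Disc, 0 < (den g z).re)
    (hh : ∀ z : Disc, 0 < (den h z).re) : posLift g hg = posLift h hh := by
  subst e; rfl

theorem expX_add (k : Fin 3) (s t : ℝ) : expX k (s + t) = expX k s * expX k t := by
  -- `exp (t X₁)` and `exp (t X₂)` both have `α = cosh (t/2)` and `β = u sinh (t/2)`, with `u = 1`
  -- and `u = i` respectively; one addition formula serves both.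
  have ha : ∀ {m : ℝ → SL(2, ℝ)}, (∀ t, al (m t) = (Real.cosh (t / 2) : ℂ)) → ∀ {u : ℂ},
      u * conj u = 1 → (∀ t, be (m t) = (Real.sinh (t / 2) : ℂ) * u) →
      m (s + t) = m s * m t := by
    intro m h1 u hu h2
    have e : (s + t) / 2 = s / 2 + t / 2 := by ring
    refine SL_ext_al_be ?_ ?_
    · rw [al_mul, h1, h1, h1, h2, h2, map_mul, Complex.conj_ofReal, e, Real.cosh_add]
      push_cast
      linear_combination (-(Complex.sinh (s / 2) * Complex.sinh (t / 2))) * hu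
    · rw [be_mul, h1, h1, h2, h2, h2, Complex.conj_ofReal, e, Real.sinh_add]
      push_cast
      ring
  fin_cases k
  · refine Cover.ext (SL_ext_al_be ?_ ?_) (ContinuousMap.ext fun z => ?_)
    · change al (mat0 (s + t)) = al (mat0 s * mat0 t)
      rw [al_mul, be_mat0, al_mat0, al_mat0, al_mat0, zero_mul, add_zero, ← Complex.exp_add]
      congr 1
      push_cast
      ring
    · change be (mat0 (s + t)) = be (mat0 s * mat0 t)
      rw [be_mul, be_mat0, be_mat0, be_mat0]
      simp
    · change -(((s + t) / 2 : ℝ) * I) = -((s / 2 : ℝ) * I) + -((t / 2 : ℝ) * I)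
      push_cast
      ring
  · have e : mat1 (s + t) = mat1 s * mat1 t := ha al_mat1 (u := 1) (by simp) (by simp [be_mat1])
    exact (posLift_congr e (fun z => re_den_mat1 (s + t) z.norm_le)
      fun z => e ▸ re_den_mat1 (s + t) z.norm_le).trans
      (posLift_mul (fun z => re_den_mat1 s z.norm_le) (fun z => re_den_mat1 t z.norm_le) _)
  · have e : mat2 (s + t) = mat2 s * mat2 t := ha al_mat2 (u := I) (by simp) be_mat2
    exact (posLift_congr e (fun z => re_den_mat2 (s + t) z.norm_le)
      fun z => e ▸ re_den_mat2 (s + t) z.norm_le).trans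
      (posLift_mul (fun z => re_den_mat2 s z.norm_le) (fun z => re_den_mat2 t z.norm_le) _)

/-- Left translation of test functions by a one-parameter subgroup. -/
def TestFun.translate (k : Fin 3) (t : ℝ) : TestFun →ₗ[ℂ] TestFun where
  toFun f := ⟨fun x => f.1 (expX k t * x), by
    obtain ⟨hs, F, hF, h⟩ := f.2
    obtain ⟨Ψ, hΨ, hc⟩ := exists_coord_expX_mul k
    refine ⟨hs.comp_homeomorph (Homeomorph.mulLeft (expX k t)), fun c => F (Ψ (t, c)),
      hF.comp (hΨ.comp (contDiff_const.prodMk contDiff_id)), fun x => ?_⟩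
    change f.1 (expX k t * x) = F (Ψ (t, coord x))
    rw [← hc, ← h]⟩
  map_add' f f' := rfl
  map_smul' a f := rfl

theorem TestFun.hasDerivAt_expX (k : Fin 3) (f : TestFun) (x : Cover) (t : ℝ) :
    HasDerivAt (fun t => f.1 (expX k t * x)) ((vfield k f).1 (expX k t * x)) t := by
  have h1 : HasDerivAt (fun s => f.1 (expX k s * (expX k t * x)))
      ((vfield k f).1 (expX k t * x)) (t - t) := by
    rw [sub_self]
    exact (TestFun.hasDerivAt k f (expX k t * x)).hasDerivAt
  have h2 := h1.comp_sub_const t t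
  refine h2.congr_of_eventuallyEq (Filter.Eventually.of_forall fun s => ?_)
  change _ = f.1 (expX k (s - t) * (expX k t * x))
  rw [← mul_assoc, ← expX_add, sub_add_cancel]

/-! ### The integrated form -/

section Integrated

set_option linter.unusedSectionVars false

variable {V : Type*} [NormedAddCommGroup V] [InnerProductSpace ℂ V] [CompleteSpace V]
  (μ : Measure Cover) [μ.IsHaarMeasure] (π : UnitaryRep V)

theorem UnitaryRep.hom_mul_apply (x y : Cover) (v : V) :
    π.hom (x * y) v = π.hom x (π.hom y v) := by rw [map_mul]; rfl

theorem UnitaryRep.hom_one_apply (v : V) : π.hom 1 v = v := by rw [map_one]; rfl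

/-- Left invariance of `μ` moves the group action onto the argument of `f`. This is why the vector
fields appear as derivatives of `π(exp tXₖ)⁻¹`, with the inverse. -/
theorem hom_inv_intg (f : TestFun) (v : V) (x : Cover) :
    π.hom x⁻¹ (π.intg μ f.1 v) = ∫ y, f.1 (x * y) • π.hom y v ∂μ := by
  have h1 := (π.hom x⁻¹).toContinuousLinearEquiv.toContinuousLinearMap.integral_comp_comm
    (integrable_test μ π f v)
  rw [UnitaryRep.intg]
  refine h1.symm.trans ?_
  rw [← integral_mul_left_eq_self _ x]
  refine integral_congr_ae (Filter.Eventually.of_forall fun y => ?_)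
  change π.hom x⁻¹ (f.1 (x * y) • π.hom (x * y) v) = f.1 (x * y) • π.hom y v
  rw [map_smul, ← π.hom_mul_apply, inv_mul_cancel_left]

theorem hom_inv_intg_expX (f : TestFun) (v : V) (k : Fin 3) (t : ℝ) :
    π.hom (expX k t)⁻¹ (π.intg μ f.1 v) = π.intg μ (TestFun.translate k t f).1 v :=
  hom_inv_intg μ π f v (expX k t)

theorem hasDerivAt_hom_intg (k : Fin 3) (f : TestFun) (v : V) :
    HasDerivAt (fun t => π.hom (expX k t)⁻¹ (π.intg μ f.1 v)) (π.intg μ (vfield k f).1 v) 0 := by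
  simp only [hom_inv_intg]
  have hc := TestFun.continuous f
  have hc' := TestFun.continuous (vfield k f)
  have hv := π.continuous_hom v
  obtain ⟨C, hC⟩ := hc'.bounded_above_of_compact_support (vfield k f).2.1
  -- A compact set containing the supports of all the translates with `|t| ≤ 1`; a constant on `K`
  -- dominates the derivative.
  let K : Set Cover := (fun p : ℝ × Cover => (expX k p.1)⁻¹ * p.2) ''
    (Set.Icc (-1) 1 ×ˢ tsupport (vfield k f).1)
  have hK : IsCompact K := by
    refine (isCompact_Icc.prod (vfield k f).2.1.isCompact).image ?_
    exact ((continuous_expX k).comp continuous_fst).inv.mul continuous_snd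
  have h := hasDerivAt_integral_of_dominated_loc_of_deriv_le (μ := μ) (x₀ := (0 : ℝ))
    (s := Set.Icc (-1) 1)
    (F := fun t y => f.1 (expX k t * y) • π.hom y v)
    (F' := fun t y => (vfield k f).1 (expX k t * y) • π.hom y v)
    (bound := K.indicator fun _ => C * ‖v‖)
    (Icc_mem_nhds (by norm_num) (by norm_num))
    (Filter.Eventually.of_forall fun t =>
      ((hc.comp (continuous_const.mul continuous_id)).smul hv).aestronglyMeasurable)
    (by simpa [expX_zero] using integrable_test μ π f v)
    ((hc'.comp (continuous_const.mul continuous_id)).smul hv).aestronglyMeasurable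
    (Filter.Eventually.of_forall fun y t ht => ?_)
    ((integrable_indicator_iff hK.measurableSet).2 (integrableOn_const hK.measure_ne_top))
    (Filter.Eventually.of_forall fun y t _ =>
      (TestFun.hasDerivAt_expX k f y t).smul_const (π.hom y v))
  · simpa [expX_zero, UnitaryRep.intg] using h.2
  · by_cases hy : expX k t * y ∈ tsupport (vfield k f).1
    · have hyK : y ∈ K := ⟨(t, expX k t * y), ⟨ht, hy⟩, by simp⟩
      rw [Set.indicator_of_mem hyK, norm_smul, LinearIsometryEquiv.norm_map]
      exact mul_le_mul_of_nonneg_right (hC _) (norm_nonneg _)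
    · rw [image_eq_zero_of_notMem_tsupport hy, zero_smul, norm_zero]
      refine Set.indicator_nonneg (fun _ _ => ?_) _
      exact mul_nonneg ((norm_nonneg _).trans (hC 1)) (norm_nonneg _)

/-- Approximate identity: a bump supported where `π(x) v` is within `ε/2` of `v`, divided by its
integral. It makes the vectors `π(f) v` dense. -/
theorem exists_intg_near (v : V) {ε : ℝ} (hε : 0 < ε) :
    ∃ f : TestFun, ‖π.intg μ f.1 v - v‖ < ε := by
  have hU : {x | ‖π.hom x v - v‖ < ε / 2} ∈ 𝓝 (1 : Cover) := by
    have h1 : Continuous fun x => ‖π.hom x v - v‖ := ((π.continuous_hom v).sub continuous_const).norm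
    refine (isOpen_lt h1 continuous_const).mem_nhds ?_
    simp only [Set.mem_ofPred_eq, π.hom_one_apply, sub_self, norm_zero]
    positivity
  obtain ⟨f, r, hfr, hr0, hr1, hrU⟩ := exists_testFun_bump hU
  have hrc : Continuous r := by
    have h1 : r = fun x => (f.1 x).re := by funext x; rw [hfr, Complex.ofReal_re]
    rw [h1]
    exact Complex.continuous_re.comp (TestFun.continuous f)
  have hrs : HasCompactSupport r := by
    have h1 : r = fun x => (f.1 x).re := by funext x; rw [hfr, Complex.ofReal_re]
    rw [h1]
    exact f.2.1.comp_left (g := Complex.re) rfl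
  have hri : Integrable r μ := hrc.integrable_of_hasCompactSupport hrs
  set c := ∫ x, r x ∂μ with hc
  have hcpos : 0 < c := by
    refine hrc.integral_pos_of_hasCompactSupport_nonneg_nonzero hrs hr0 (x := 1) ?_
    rw [hr1]; exact one_ne_zero
  refine ⟨((c : ℂ)⁻¹) • f, ?_⟩
  have hc0 : (c : ℂ) ≠ 0 := by exact_mod_cast hcpos.ne'
  have hrv : Integrable (fun x => (r x : ℂ) • v) μ := hri.ofReal.smul_const v
  have hfi : Integrable (fun x => (r x : ℂ) • π.hom x v) μ := by
    simpa only [hfr] using integrable_test μ π f v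
  have h2 : π.intg μ f.1 v - (c : ℂ) • v = ∫ x, (r x : ℂ) • (π.hom x v - v) ∂μ := by
    simp only [smul_sub]
    rw [integral_sub hfi hrv, integral_smul_const, UnitaryRep.intg, hc, integral_complex_ofReal]
    simp only [hfr]
  have h3 : ‖∫ x, (r x : ℂ) • (π.hom x v - v) ∂μ‖ ≤ c * (ε / 2) := by
    rw [hc, ← integral_mul_const]
    refine norm_integral_le_of_norm_le (hri.mul_const _) (Filter.Eventually.of_forall fun x => ?_)
    rw [norm_smul, Complex.norm_real, Real.norm_of_nonneg (hr0 x)]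
    by_cases hx : r x = 0
    · simp [hx]
    · exact mul_le_mul_of_nonneg_left (hrU hx).le (hr0 x)
  have h4 : π.intg μ (((c : ℂ)⁻¹) • f).1 v - v = (c : ℂ)⁻¹ • (π.intg μ f.1 v - (c : ℂ) • v) := by
    rw [intg_smul_left, smul_sub, smul_smul, inv_mul_cancel₀ hc0, one_smul]
  rw [h4, norm_smul, norm_inv, Complex.norm_real, Real.norm_of_nonneg hcpos.le, h2,
    inv_mul_lt_iff₀ hcpos]
  nlinarith

end Integrated

/-! ### Invariance of the spectrum under isometric isomorphism -/

section Transport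

variable {H H' : Type*} [NormedAddCommGroup H] [NormedSpace ℂ H] [NormedAddCommGroup H']
  [NormedSpace ℂ H']

theorem graphSpectrum_image_subset (e : H ≃ₗᵢ[ℂ] H') (Γ : Set (H × H)) :
    graphSpectrum (Prod.map e e '' Γ) ⊆ graphSpectrum Γ := by
  rintro z hz ⟨R, h1, h2⟩
  refine hz ⟨e.toContinuousLinearEquiv.toContinuousLinearMap ∘L R ∘L
    e.symm.toContinuousLinearEquiv.toContinuousLinearMap, fun y => ?_, ?_⟩
  · refine ⟨_, h1 (e.symm y), ?_⟩
    simp [Prod.map]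
  · rintro _ ⟨p, hp, rfl⟩
    have h3 := congrArg e (h2 p hp)
    simpa using h3

theorem graphSpectrum_image (e : H ≃ₗᵢ[ℂ] H') (Γ : Set (H × H)) :
    graphSpectrum (Prod.map e e '' Γ) = graphSpectrum Γ := by
  refine (graphSpectrum_image_subset e Γ).antisymm ?_
  have h := graphSpectrum_image_subset e.symm (Prod.map e e '' Γ)
  rwa [← Set.image_comp, Prod.map_comp_map, ← LinearIsometryEquiv.coe_trans,
    LinearIsometryEquiv.self_trans_symm, LinearIsometryEquiv.coe_refl, Prod.map_id,
    Set.image_id] at h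

end Transport

/-! ### The localised Dirac operator on `V ⊕ V` -/

section Localisation

set_option linter.unusedSectionVars false

variable {V : Type*} [NormedAddCommGroup V] [InnerProductSpace ℂ V] [CompleteSpace V]

/-- The Hilbert space `V ⊕ V`. -/
abbrev Dbl (V : Type*) : Type _ := PiLp 2 fun _ : Fin 2 => V

variable (μ : Measure Cover) [μ.IsHaarMeasure] (π : UnitaryRep V)

/-- The isometry `ξ ⊗ v ↦ (π(ξ₀) v, π(ξ₁) v)`. -/
def spinMap : PreLoc μ π →ₗ[ℂ] Dbl V :=
  (WithLp.linearEquiv 2 ℂ (Fin 2 → V)).symm.toLinearMap ∘ₗ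
    (LinearMap.pi (locMap μ π) : Spinor ⊗[ℂ] V →ₗ[ℂ] Fin 2 → V)

theorem norm_spinMap (t : PreLoc μ π) : ‖spinMap μ π t‖ = ‖t‖ := by
  have h : ‖spinMap μ π t‖ ^ 2 = ‖t‖ ^ 2 := by
    rw [@norm_sq_eq_re_inner ℂ, @norm_sq_eq_re_inner ℂ (PreLoc μ π), PiLp.inner_apply]
    exact congrArg RCLike.re (locForm_eq μ π t t).symm
  exact (sq_eq_sq₀ (norm_nonneg _) (norm_nonneg _)).1 h

/-- Each component is approximated separately, by a spinor supported in that component; `ε/2` in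
each of the two gives less than `ε` for the `ℓ²` norm. -/
theorem denseRange_spinMap : DenseRange (spinMap μ π) := by
  intro x
  rw [Metric.mem_closure_iff]
  intro ε hε
  have h : ∀ i, ∃ f : TestFun, ‖π.intg μ f.1 (x i) - x i‖ < ε / 2 := fun i =>
    exists_intg_near μ π (x i) (half_pos hε)
  choose f hf using h
  let t : Spinor ⊗[ℂ] V := ∑ i, (Pi.single i (f i) : Spinor) ⊗ₜ x i
  refine ⟨_, ⟨t, rfl⟩, ?_⟩
  have h1 : ∀ i, locMap μ π i t = π.intg μ (f i).1 (x i) := by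
    have h0 : ∀ v, π.intg μ (0 : TestFun).1 v = 0 := fun v => by simp [UnitaryRep.intg]
    intro i
    have h2 : ∀ j, locMap μ π i ((Pi.single j (f j) : Spinor) ⊗ₜ x j) =
        π.intg μ ((Pi.single j (f j) : Spinor) i).1 (x j) := fun j => rfl
    simp only [t, map_sum, h2]
    rw [Finset.sum_eq_single i, Pi.single_eq_same]
    · intro j _ hj
      rw [Pi.single_eq_of_ne hj.symm, h0]
    · simp
  rw [dist_eq_norm, PiLp.norm_eq_of_L2, Fin.sum_univ_two]
  have h3 : ∀ i, ‖(x - spinMap μ π t) i‖ < ε / 2 := by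
    intro i
    change ‖x i - locMap μ π i t‖ < ε / 2
    rw [norm_sub_rev, h1]
    exact hf i
  rw [Real.sqrt_lt' hε]
  nlinarith [h3 0, h3 1, norm_nonneg ((x - spinMap μ π t) 0), norm_nonneg ((x - spinMap μ π t) 1)]

/-- The Hilbert space `(A ⊕ A) ⊗_A V` is isomorphic to `V ⊕ V`. -/
def locEquiv : Loc μ π ≃ₗᵢ[ℂ] Dbl V :=
  (LinearEquiv.refl ℂ (PreLoc μ π)).extendOfIsometry
    (UniformSpace.Completion.toComplL (𝕜 := ℂ) (E := PreLoc μ π)).toLinearMap (spinMap μ π)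
    (UniformSpace.Completion.denseRange_coe) (denseRange_spinMap μ π) fun t => by
      rw [LinearEquiv.refl_apply, norm_spinMap]
      exact (UniformSpace.Completion.norm_coe t).symm

theorem locEquiv_coe (t : PreLoc μ π) : locEquiv μ π (t : Loc μ π) = spinMap μ π t :=
  LinearEquiv.extendOfIsometry_eq _ _ _ _ _ _ t

/-- The graph of the Dirac operator on the vectors `∑ (π(ξ₀) v, π(ξ₁) v)`. -/
def spinGraph : Submodule ℂ (Dbl V × Dbl V) :=
  LinearMap.range ((spinMap μ π).prod (spinMap μ π ∘ₗ diracTensor μ π))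

/-- Removes the abstract completion: from here on only a closed relation in `V ⊕ V` has to be
studied. -/
theorem localSpectrum_eq :
    localSpectrum μ π = graphSpectrum ((spinGraph μ π).topologicalClosure : Set (Dbl V × Dbl V)) := by
  rw [localSpectrum, ← graphSpectrum_image (locEquiv μ π), locDiracGraph]
  congr 1
  have h := ((locEquiv μ π).toHomeomorph.prodCongr (locEquiv μ π).toHomeomorph).image_closure
    (Set.range fun t : PreLoc μ π => ((t : Loc μ π), (diracTensor μ π t : Loc μ π)))
  refine h.trans ?_
  rw [Submodule.topologicalClosure_coe, ← Set.range_comp]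
  congr 1
  ext p
  refine exists_congr fun t => Eq.congr ?_ rfl
  exact Prod.ext (locEquiv_coe μ π t) (locEquiv_coe μ π _)

/-- The Dirac operator on the continuously differentiable vectors of `V ⊕ V`. -/
def diracRel : Set (Dbl V × Dbl V) :=
  {p | ∃ a : Fin 3 → Fin 2 → V,
    (∀ k i, HasDerivAt (fun t => π.hom (expX k t)⁻¹ (p.1 i)) (a k i) 0) ∧
      ∀ i, p.2 i = ∑ k, ∑ j, cliff k i j • a k j}

/-- Differentiate the constant function `⟪π(x) v, π(x) w⟫` along the one-parameter subgroup. -/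
theorem inner_deriv_add {k : Fin 3} {v w a b : V}
    (hv : HasDerivAt (fun t => π.hom (expX k t)⁻¹ v) a 0)
    (hw : HasDerivAt (fun t => π.hom (expX k t)⁻¹ w) b 0) : ⟪v, b⟫_ℂ + ⟪a, w⟫_ℂ = 0 := by
  have h := hv.inner ℂ hw
  simp only [LinearIsometryEquiv.inner_map_map, expX_zero, inv_one, π.hom_one_apply] at h
  exact h.unique (hasDerivAt_const _ _)

theorem conj_cliff (k : Fin 3) (i j : Fin 2) : conj (cliff k i j) = -cliff k j i := by
  fin_cases k <;> fin_cases i <;> fin_cases j <;> simp [cliff, sigma]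

/-- The skew-symmetry of the derivatives and that of the Clifford matrices contribute two signs,
which cancel. -/
theorem isSymmRel_diracRel : IsSymmRel (diracRel π) := by
  rintro p ⟨a, ha, hp⟩ q ⟨b, hb, hq⟩
  have h : ∀ k i j, ⟪p.1 i, b k j⟫_ℂ = -⟪a k i, q.1 j⟫_ℂ := fun k i j =>
    eq_neg_of_add_eq_zero_left (inner_deriv_add π (ha k i) (hb k j))
  simp only [PiLp.inner_apply, hp, hq, inner_sum, sum_inner, inner_smul_left, inner_smul_right,
    conj_cliff, h]
  rw [Finset.sum_comm]
  conv_rhs => rw [Finset.sum_comm]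
  refine Finset.sum_congr rfl fun k _ => ?_
  rw [Finset.sum_comm]
  refine Finset.sum_congr rfl fun i _ => Finset.sum_congr rfl fun j _ => ?_
  ring

/-- The vector field attached to `Xₖ` on spinor fields. -/
def vfieldSpinor (k : Fin 3) : Spinor →ₗ[ℂ] Spinor :=
  LinearMap.pi fun i => vfield k ∘ₗ LinearMap.proj i

theorem hasDerivAt_locMap (k : Fin 3) (i : Fin 2) (t : Spinor ⊗[ℂ] V) :
    HasDerivAt (fun s => π.hom (expX k s)⁻¹ (locMap μ π i t))
      (locMap μ π i (LinearMap.rTensor V (vfieldSpinor k) t)) 0 := by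
  induction t with
  | zero => simpa using hasDerivAt_const (0 : ℝ) (0 : V)
  | add t t' h h' => simpa only [map_add] using h.fun_add h'
  | tmul ξ v => exact hasDerivAt_hom_intg μ π k (ξ i) v

theorem locMap_diracTensor (i : Fin 2) (t : Spinor ⊗[ℂ] V) :
    locMap μ π i (LinearMap.rTensor V dirac t) =
      ∑ k, ∑ j, cliff k i j • locMap μ π j (LinearMap.rTensor V (vfieldSpinor k) t) := by
  induction t with
  | zero => simp
  | add t t' h h' => simp only [map_add, h, h', smul_add, Finset.sum_add_distrib]
  | tmul ξ v =>
    let L : TestFun →ₗ[ℂ] V :=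
      { toFun := fun f => π.intg μ f.1 v
        map_add' := fun f g => intg_add_left μ π f g v
        map_smul' := fun c f => intg_smul_left μ π c f v }
    change L (dirac ξ i) = ∑ k, ∑ j, cliff k i j • L (vfield k (ξ j))
    simp [dirac]

/-- Places the graph inside a symmetric relation that also contains the weight vectors, so the two
can be paired before the weight vectors are known to lie in the closure. -/
theorem spinGraph_subset : (spinGraph μ π : Set (Dbl V × Dbl V)) ⊆ diracRel π := by
  rintro _ ⟨t, rfl⟩
  exact ⟨fun k i => locMap μ π i (LinearMap.rTensor V (vfieldSpinor k) t),
    fun k i => hasDerivAt_locMap μ π k i t, fun i => locMap_diracTensor μ π i t⟩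

/-- The unitary operator `π(exp X₀)⁻¹ ⊗ diag(1, e^i)` on `V ⊕ V`. -/
def rotate : Dbl V →ₗᵢ[ℂ] Dbl V where
  toFun x := WithLp.toLp 2 fun i => ![1, Complex.exp I] i • π.hom (expX 0 1)⁻¹ (x i)
  map_add' x y := by
    ext i
    simp
  map_smul' c x := by
    ext i
    simp [smul_comm c]
  norm_map' x := by
    have h : ‖Complex.exp I‖ = 1 := by
      simpa using Complex.norm_exp_ofReal_mul_I 1
    rw [PiLp.norm_eq_of_L2, PiLp.norm_eq_of_L2]
    congr 1
    refine Finset.sum_congr rfl fun i _ => ?_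
    fin_cases i <;> simp [norm_smul, h]

/-- On vectors `π(f) v` the rotation is a left translation of `f`, which is again a test function.
Only the domain is followed here; commutation with `D` is recovered weakly in
`mem_closure_of_isometry`. -/
theorem rotate_spinGraph (p : Dbl V × Dbl V) (hp : p ∈ spinGraph μ π) :
    ∃ y, (rotate π p.1, y) ∈ spinGraph μ π := by
  obtain ⟨t, rfl⟩ := hp
  let T : Spinor →ₗ[ℂ] Spinor := LinearMap.pi fun i =>
    ![1, Complex.exp I] i • (TestFun.translate 0 1 ∘ₗ LinearMap.proj i)
  refine ⟨_, LinearMap.rTensor V T t, Prod.ext ?_ rfl⟩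
  ext i
  change locMap μ π i (LinearMap.rTensor V T t) =
    ![1, Complex.exp I] i • π.hom (expX 0 1)⁻¹ (locMap μ π i t)
  induction (show Spinor ⊗[ℂ] V from t) with
  | zero => simp
  | add t t' h h' => simp only [map_add, smul_add, h, h']
  | tmul ξ v =>
    change π.intg μ (![1, Complex.exp I] i • TestFun.translate 0 1 (ξ i)).1 v =
      ![1, Complex.exp I] i • π.hom (expX 0 1)⁻¹ (π.intg μ (ξ i).1 v)
    rw [intg_smul_left, hom_inv_intg_expX]

theorem dense_fst_spinGraph : Dense (Prod.fst '' (spinGraph μ π : Set (Dbl V × Dbl V))) := by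
  refine (denseRange_spinMap μ π).mono ?_
  rintro _ ⟨t, rfl⟩
  exact ⟨_, ⟨t, rfl⟩, rfl⟩

end Localisation

theorem isClosed_of_finite_inter_closedBall {E : Type*} [NormedAddCommGroup E] {A : Set E}
    (h : ∀ R : ℝ, (A ∩ Metric.closedBall 0 R).Finite) : IsClosed A := by
  refine isClosed_of_closure_subset fun x hx => ?_
  have h1 : x ∈ Metric.ball (0 : E) (‖x‖ + 1) := by simp
  have h2 := Metric.isOpen_ball.inter_closure ⟨h1, hx⟩
  have h3 : Metric.ball (0 : E) (‖x‖ + 1) ∩ A ⊆ A ∩ Metric.closedBall 0 (‖x‖ + 1) :=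
    fun y hy => ⟨hy.2, Metric.ball_subset_closedBall hy.1⟩
  have h4 := closure_mono h3 h2
  rw [(h _).isClosed.closure_eq] at h4
  exact h4.1

/-! ### Eigenvectors from a quadratic relation -/

section EigenTwo

variable {H : Type*} [NormedAddCommGroup H] [InnerProductSpace ℂ H] {Γ : Submodule ℂ (H × H)}
  {b d : H} {ρ : ℝ}

/-- The hypotheses express `(D + 1/2)² b = ρ² b`, which factors as `(D + 1/2 - ρ)(D + 1/2 + ρ) b =
0`. The resulting eigenvector may be zero. -/
theorem mem_eigen_of_sq (h1 : (b, d) ∈ Γ) (h2 : (d, ((ρ : ℂ) ^ 2 - 1 / 4) • b - d) ∈ Γ) :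
    d + (1 / 2 + ρ : ℂ) • b ∈ eigen Γ ((-1 / 2 + ρ : ℝ) : ℂ) := by
  rw [mem_eigen]
  convert! Γ.add_mem h2 (Γ.smul_mem (1 / 2 + ρ : ℂ) h1) using 1
  refine Prod.ext rfl ?_
  simp only [Prod.snd_add, Prod.smul_snd]
  push_cast
  module

/-- For `ρ ≠ 0` the vector `b` is a combination of `(D + 1/2 ± ρ) b`. For `ρ = 0` symmetry rules out
a Jordan block. -/
theorem mem_sup_eigen (hs : IsSymmRel (Γ : Set (H × H))) (h1 : (b, d) ∈ Γ)
    (h2 : (d, ((ρ : ℂ) ^ 2 - 1 / 4) • b - d) ∈ Γ) :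
    b ∈ eigen Γ ((-1 / 2 + ρ : ℝ) : ℂ) ⊔ eigen Γ ((-1 / 2 - ρ : ℝ) : ℂ) := by
  have hp := mem_eigen_of_sq h1 h2
  have hm := mem_eigen_of_sq (ρ := -ρ) h1 (by simpa using h2)
  rw [← sub_eq_add_neg] at hm
  by_cases hρ : ρ = 0
  · subst hρ
    rw [mem_eigen] at hp
    -- Symmetry turns `(D + 1/2)² b = 0` into `‖(D + 1/2) b‖² = 0`.
    have h3 := hs _ h1 _ hp
    have h4 : d + (1 / 2 : ℂ) • b = 0 := by
      rw [← inner_self_eq_zero (𝕜 := ℂ)]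
      simp only [Complex.ofReal_zero, add_zero, inner_smul_right] at h3
      rw [inner_add_left, ← h3, inner_smul_left]
      norm_num [map_ofNat]
    refine Submodule.mem_sup_left ?_
    rw [mem_eigen]
    convert! h1 using 2
    rw [eq_neg_of_add_eq_zero_left h4]
    push_cast
    module
  · have hρ' : (ρ : ℂ) ≠ 0 := by exact_mod_cast hρ
    have h3 : b = (1 / (2 * ρ) : ℂ) • (d + (1 / 2 + ρ : ℂ) • b) +
        (-1 / (2 * ρ) : ℂ) • (d + (1 / 2 + (-ρ : ℝ) : ℂ) • b) := by
      have h4 : (1 / (2 * ρ) : ℂ) * (1 / 2 + ρ) + (-1 / (2 * ρ)) * (1 / 2 + (-ρ : ℝ)) = 1 := by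
        push_cast
        field_simp
        ring
      have h5 : (1 / (2 * ρ) : ℂ) + (-1 / (2 * ρ)) = 0 := by ring
      calc b = ((1 / (2 * ρ) : ℂ) + (-1 / (2 * ρ))) • d +
          ((1 / (2 * ρ) : ℂ) * (1 / 2 + ρ) + (-1 / (2 * ρ)) * (1 / 2 + (-ρ : ℝ))) • b := by
            rw [h4, h5, zero_smul, zero_add, one_smul]
        _ = _ := by module
    rw [h3]
    exact Submodule.add_mem_sup (Submodule.smul_mem _ _ hp) (Submodule.smul_mem _ _ hm)

end EigenTwo

/-! ### Ladders of weight vectors -/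

/-- A total sequence of weight vectors in a unitary representation of `G`: the rotations act on
`e n` by the weight `n + x₀`, and `X₁ ± i X₂` map `e n` to explicit multiples of
`e (n ± 1)`. -/
structure IsLadder {V : Type*} [NormedAddCommGroup V] [InnerProductSpace ℂ V] (π : UnitaryRep V)
    (e : ℤ → V) (x₀ : ℝ) (s : ℂ) : Prop where
  total : ∀ v, (∀ n, ⟪e n, v⟫_ℂ = 0) → v = 0
  rot : ∀ n, π.hom (expX 0 1)⁻¹ (e n) = Complex.exp (((n + x₀ : ℝ) : ℂ) * I) • e n
  deriv : ∀ n, e n ≠ 0 → ∃ a : Fin 3 → V,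
    (∀ k, HasDerivAt (fun t => π.hom (expX k t)⁻¹ (e n)) (a k) 0) ∧
    a 0 = (((n + x₀ : ℝ) : ℂ) * I) • e n ∧
    a 1 + I • a 2 = (-(((n + x₀ : ℝ) : ℂ) + s)) • e (n + 1) ∧
    a 1 - I • a 2 = (((n + x₀ : ℝ) : ℂ) - s) • e (n - 1)
  bot : ∀ n, e n ≠ 0 → e (n - 1) = 0 → ((n + x₀ : ℝ) : ℂ) = s
  top : ∀ n, e n ≠ 0 → e (n + 1) = 0 → ((n + x₀ : ℝ) : ℂ) + s = 0

section Ladder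

set_option linter.unusedSectionVars false

variable {V : Type*} [NormedAddCommGroup V] [InnerProductSpace ℂ V]

/-- The basis vectors `(e n, 0)` and `(0, e (n - 1))` of `V ⊕ V`. -/
def dblVec (e : ℤ → V) (j : Fin 2 × ℤ) : Dbl V :=
  WithLp.toLp 2 (Pi.single j.1 (e (j.2 - (j.1 : ℕ))))

theorem dblVec_ne_zero {e : ℤ → V} {j : Fin 2 × ℤ} :
    dblVec e j ≠ 0 ↔ e (j.2 - (j.1 : ℕ)) ≠ 0 := by
  rw [not_iff_not, dblVec, WithLp.toLp_eq_zero, Pi.single_eq_zero_iff]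

theorem dblVec_zero_apply (e : ℤ → V) (n : ℤ) : dblVec e (0, n) = WithLp.toLp 2 ![e n, 0] := by
  ext i
  fin_cases i <;> simp [dblVec]

theorem dblVec_one_apply (e : ℤ → V) (n : ℤ) :
    dblVec e (1, n) = WithLp.toLp 2 ![0, e (n - 1)] := by
  ext i
  fin_cases i <;> simp [dblVec]

/-- The images of the basis vectors under the Dirac operator. -/
def dblImage (e : ℤ → V) (x₀ : ℝ) (s : ℂ) (j : Fin 2 × ℤ) : Dbl V :=
  if j.1 = 0 then
    (-((j.2 + x₀ : ℝ) : ℂ)) • dblVec e (0, j.2) +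
      (I * (((j.2 + x₀ : ℝ) : ℂ) - s)) • dblVec e (1, j.2)
  else (-I * (((j.2 + x₀ : ℝ) : ℂ) - 1 + s)) • dblVec e (0, j.2) +
      (((j.2 + x₀ : ℝ) : ℂ) - 1) • dblVec e (1, j.2)

variable [CompleteSpace V] {π : UnitaryRep V} {e : ℤ → V} {x₀ : ℝ} {s : ℂ}

/-- Off the diagonal, `c(X₁)X₁ + c(X₂)X₂` is `i(X₁ - iX₂)` from the first component to the second
and `i(X₁ + iX₂)` back. The first lowers and the second raises the weight, so shifting the second
component by one index makes each pair stable. -/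
theorem IsLadder.mem_diracRel (h : IsLadder π e x₀ s) (j : Fin 2 × ℤ) (hj : dblVec e j ≠ 0) :
    (dblVec e j, dblImage e x₀ s j) ∈ diracRel π := by
  rw [dblVec_ne_zero] at hj
  obtain ⟨a, ha, h0, hp, hm⟩ := h.deriv _ hj
  obtain ⟨i, n⟩ := j
  have hz : ∀ k, HasDerivAt (fun t => π.hom (expX k t)⁻¹ (0 : V)) 0 0 := fun k => by
    simpa using hasDerivAt_const (0 : ℝ) (0 : V)
  fin_cases i
  · simp only [Fin.zero_eta, Fin.isValue, Nat.cast_zero, sub_zero] at *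
    refine ⟨fun k => ![a k, 0], fun k i => ?_, fun i => ?_⟩
    · rw [dblVec_zero_apply]
      fin_cases i
      · exact ha k
      · exact hz k
    · rw [dblImage, if_pos rfl, dblVec_zero_apply, dblVec_one_apply]
      fin_cases i
      · simp only [Fin.sum_univ_three, Fin.sum_univ_two, cliff, sigma]
        simp [h0, smul_smul]
        rw [mul_comm I, mul_assoc, I_mul_I]
        module
      · simp only [Fin.sum_univ_three, Fin.sum_univ_two, cliff, sigma]
        simp
        rw [mul_smul, ← Complex.ofReal_intCast, ← Complex.ofReal_add, ← hm, smul_sub, smul_smul,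
          I_mul_I]
        module
  · simp only [Fin.mk_one, Fin.isValue, Nat.cast_one] at *
    refine ⟨fun k => ![0, a k], fun k i => ?_, fun i => ?_⟩
    · rw [dblVec_one_apply]
      fin_cases i
      · exact hz k
      · exact ha k
    · rw [dblImage, if_neg (by simp), dblVec_zero_apply, dblVec_one_apply]
      rw [sub_add_cancel] at hp
      fin_cases i
      · simp only [Fin.sum_univ_three, Fin.sum_univ_two, cliff, sigma]
        simp
        have h3 : I • a 1 + -a 2 = I • (a 1 + I • a 2) := by
          rw [smul_add, smul_smul, I_mul_I, neg_one_smul]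
        rw [h3, hp]
        push_cast
        module
      · simp only [Fin.sum_univ_three, Fin.sum_univ_two, cliff, sigma]
        simp
        rw [h0, smul_smul, ← neg_smul]
        congr 1
        push_cast
        linear_combination ((n : ℂ) - 1 + x₀) * I_mul_I

theorem inner_dblVec (j : Fin 2 × ℤ) (x : Dbl V) :
    ⟪dblVec e j, x⟫_ℂ = ⟪e (j.2 - (j.1 : ℕ)), x j.1⟫_ℂ := by
  obtain ⟨i, n⟩ := j
  rw [PiLp.inner_apply, Fin.sum_univ_two]
  fin_cases i <;> simp [dblVec]

theorem IsLadder.total_dbl (h : IsLadder π e x₀ s) (x : Dbl V)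
    (hx : ∀ j : {j // dblVec e j ≠ 0}, ⟪dblVec e j, x⟫_ℂ = 0) : x = 0 := by
  ext i
  refine h.total _ fun n => ?_
  have h1 := inner_dblVec (e := e) (i, n + (i : ℕ)) x
  simp only [add_sub_cancel_right] at h1
  rw [← h1]
  by_cases h0 : dblVec e (i, n + (i : ℕ)) = 0
  · rw [h0, inner_zero_left]
  · exact hx ⟨_, h0⟩

theorem IsLadder.rotate_dblVec (h : IsLadder π e x₀ s) (j : Fin 2 × ℤ) :
    rotate π (dblVec e j) = Complex.exp (((j.2 + x₀ : ℝ) : ℂ) * I) • dblVec e j := by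
  obtain ⟨i, n⟩ := j
  fin_cases i
  · ext i
    simp only [Fin.zero_eta, dblVec_zero_apply]
    fin_cases i
    · simpa [rotate] using h.rot n
    · simp [rotate]
  · ext i
    simp only [Fin.mk_one, dblVec_one_apply]
    fin_cases i
    · simp [rotate]
    -- The factor `e^i` in `rotate` compensates for the index `n - 1` in the second component, so
    -- both vectors of a pair have the same character.
    · have h1 : Complex.exp I * Complex.exp ((((n - 1 : ℤ) + x₀ : ℝ) : ℂ) * I) =
          Complex.exp (((n + x₀ : ℝ) : ℂ) * I) := by
        rw [← Complex.exp_add]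
        congr 1
        push_cast
        ring
      have h2 := congrArg (fun v => Complex.exp I • v) (h.rot (n - 1))
      simp only [smul_smul, h1] at h2
      simpa [rotate] using h2

theorem IsLadder.rotate_dblImage (h : IsLadder π e x₀ s) (j : Fin 2 × ℤ) :
    rotate π (dblImage e x₀ s j) =
      Complex.exp (((j.2 + x₀ : ℝ) : ℂ) * I) • dblImage e x₀ s j := by
  rw [dblImage]
  split_ifs <;> rw [map_add, map_smul, map_smul, h.rotate_dblVec, h.rotate_dblVec, smul_add,
    smul_comm, smul_comm (Complex.exp _) (_ : ℂ) (dblVec e (1, j.2))]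

/-- The single rotation `exp X₀` already separates all weights: `m - n = 2πk` with `k ≠ 0` would
make `π` rational. -/
theorem exp_int_add_mul_I_injective (x₀ : ℝ) :
    Function.Injective fun n : ℤ => Complex.exp (((n + x₀ : ℝ) : ℂ) * I) := by
  intro m n hmn
  obtain ⟨k, hk⟩ := Complex.exp_eq_exp_iff_exists_int.1 hmn
  have h1 : (m : ℝ) - n = k * (2 * Real.pi) := by
    have h2 := congrArg Complex.im hk
    simp at h2
    linarith
  by_cases hk0 : k = 0
  · subst hk0
    have h2 : (m : ℝ) = n := by simpa [sub_eq_zero] using h1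
    exact_mod_cast h2
  · exfalso
    have hk0' : (k : ℝ) ≠ 0 := by exact_mod_cast hk0
    refine irrational_pi ⟨((m - n : ℤ) : ℚ) / (2 * k), ?_⟩
    push_cast
    rw [h1]
    field_simp

variable (μ : Measure Cover) [μ.IsHaarMeasure]

theorem IsLadder.mem_closure (h : IsLadder π e x₀ s) (j : Fin 2 × ℤ) (hj : dblVec e j ≠ 0) :
    (dblVec e j, dblImage e x₀ s j) ∈ (spinGraph μ π).topologicalClosure := by
  refine mem_closure_of_isometry (J := {j // dblVec e j ≠ 0}) (b := fun j => dblVec e j)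
    (d := fun j => dblImage e x₀ s j)
    (χ := fun j => Complex.exp (((j.1.2 + x₀ : ℝ) : ℂ) * I)) (spinGraph μ π) (rotate π)
    (dense_fst_spinGraph μ π) (rotate_spinGraph μ π)
    (fun p hp i => isSymmRel_diracRel π _ (h.mem_diracRel i i.2) p (spinGraph_subset μ π hp))
    (fun i j => isSymmRel_diracRel π _ (h.mem_diracRel i i.2) _ (h.mem_diracRel j j.2))
    h.total_dbl (fun i => Complex.norm_exp_ofReal_mul_I _) (fun i => h.rotate_dblVec i)
    (fun i => h.rotate_dblImage i) (fun j => ?_) ⟨j, hj⟩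
  -- Finite multiplicity: each character occurs on at most the two vectors of one pair.
  have h1 : ({(0, j.1.2), (1, j.1.2)} : Set (Fin 2 × ℤ)).Finite := Set.toFinite _
  refine (h1.preimage Subtype.val_injective.injOn).subset fun i hi => ?_
  have h2 : i.1.2 = j.1.2 := exp_int_add_mul_I_injective x₀ hi
  obtain ⟨⟨i1, i2⟩, hi'⟩ := i
  simp only at h2
  subst h2
  fin_cases i1 <;> simp

/-- Cayley–Hamilton for the matrix of `D` on a pair, in the form `D² + D = ρ² - 1/4`. It persists at
an end of the ladder, because there the coefficient of the missing vector is zero. -/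
theorem IsLadder.sq_mem_closure (h : IsLadder π e x₀ s) (j : Fin 2 × ℤ) (hj : dblVec e j ≠ 0)
    {ρ : ℝ} (hρ : (ρ : ℂ) ^ 2 = 1 / 4 + s * (1 - s) +
      2 * ((j.2 + x₀ : ℝ) : ℂ) * (((j.2 + x₀ : ℝ) : ℂ) - 1)) :
    (dblImage e x₀ s j, ((ρ : ℂ) ^ 2 - 1 / 4) • dblVec e j - dblImage e x₀ s j) ∈
      (spinGraph μ π).topologicalClosure := by
  obtain ⟨i, n⟩ := j
  rw [hρ]
  simp only
  set x : ℂ := ((n + x₀ : ℝ) : ℂ) with hx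
  have d0 : dblImage e x₀ s (0, n) = (-x) • dblVec e (0, n) + (I * (x - s)) • dblVec e (1, n) :=
    if_pos rfl
  have d1 : dblImage e x₀ s (1, n) =
      (-I * (x - 1 + s)) • dblVec e (0, n) + (x - 1) • dblVec e (1, n) := if_neg (by simp)
  have hI := I_mul_I
  -- Either the other vector of the pair is nonzero, and its own pair lies in the closure, or the
  -- ladder ends here and `bot` kills its coefficient; `e1` is the counterpart with `top`.
  have e0 : (x - s = 0 ∨ dblVec e (1, n) ≠ 0) ∨ dblVec e (0, n) = 0 := by
    by_cases h0 : dblVec e (0, n) = 0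
    · exact Or.inr h0
    · refine Or.inl ?_
      by_cases h1 : dblVec e (1, n) = 0
      · left
        rw [← not_not (a := dblVec e (1, n) = 0), ← ne_eq, dblVec_ne_zero, not_not] at h1
        rw [← ne_eq, dblVec_ne_zero] at h0
        have := h.bot n (by simpa using h0) (by simpa using h1)
        rw [hx, this, sub_self]
      · exact Or.inr h1
  have e1 : (x - 1 + s = 0 ∨ dblVec e (0, n) ≠ 0) ∨ dblVec e (1, n) = 0 := by
    by_cases h1 : dblVec e (1, n) = 0
    · exact Or.inr h1
    · refine Or.inl ?_
      by_cases h0 : dblVec e (0, n) = 0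
      · left
        rw [← not_not (a := dblVec e (0, n) = 0), ← ne_eq, dblVec_ne_zero, not_not] at h0
        rw [← ne_eq, dblVec_ne_zero] at h1
        have := h.top (n - 1) (by simpa using h1) (by simpa using h0)
        rw [hx, ← this]
        push_cast
        ring
      · exact Or.inr h0
  fin_cases i
  · simp only [Fin.zero_eta] at hj ⊢
    have m0 := h.mem_closure μ _ hj
    rcases e0.resolve_right hj with h1 | h1
    · convert! Submodule.smul_mem _ (-x) m0 using 1
      refine Prod.ext ?_ ?_
      · simp [d0, h1]
      · simp only [Prod.smul_snd, d0, h1, mul_zero, zero_smul, add_zero, smul_smul, ← sub_smul]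
        congr 1
        linear_combination (x - 1 + s) * h1
    · convert! Submodule.add_mem _ (Submodule.smul_mem _ (-x) m0)
        (Submodule.smul_mem _ (I * (x - s)) (h.mem_closure μ _ h1)) using 1
      refine Prod.ext d0 ?_
      simp only [Prod.snd_add, Prod.smul_snd, d0, d1, smul_add, smul_smul]
      rw [add_add_add_comm, ← add_smul, ← add_smul, ← sub_sub, ← sub_smul, sub_eq_add_neg,
        ← neg_smul]
      congr 2
      · linear_combination ((x - s) * (x - 1 + s)) * hI
      · ring
  · simp only [Fin.mk_one] at hj ⊢
    have m1 := h.mem_closure μ _ hj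
    rcases e1.resolve_right hj with h1 | h1
    · convert! Submodule.smul_mem _ (x - 1) m1 using 1
      refine Prod.ext ?_ ?_
      · simp [d1, h1]
      · simp only [Prod.smul_snd, d1, h1, mul_zero, zero_smul, zero_add, smul_smul, ← sub_smul]
        congr 1
        linear_combination (x - s) * h1
    · convert! Submodule.add_mem _ (Submodule.smul_mem _ (-I * (x - 1 + s)) (h.mem_closure μ _ h1))
        (Submodule.smul_mem _ (x - 1) m1) using 1
      refine Prod.ext d1 ?_
      simp only [Prod.snd_add, Prod.smul_snd, d0, d1, smul_add, smul_smul]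
      rw [add_add_add_comm, ← add_smul, ← add_smul, sub_add_eq_sub_sub_swap, ← sub_smul,
        sub_eq_add_neg, ← neg_smul, add_comm]
      congr 2
      · ring
      · linear_combination ((x - s) * (x - 1 + s)) * hI

end Ladder

/-! ### The spectrum attached to a ladder -/

section LadderSpectrum

set_option linter.unusedSectionVars false

variable {V : Type*} [NormedAddCommGroup V] [InnerProductSpace ℂ V] [CompleteSpace V]
  {π : UnitaryRep V} {e : ℤ → V} {x₀ : ℝ} {s : ℂ}

/-- The eigenvalues of the Dirac operator on the representation spanned by a ladder. -/
def ladderSpectrum (e : ℤ → V) (x₀ q : ℝ) : Set ℝ :=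
  {r | ∃ n : ℤ, e n ≠ 0 ∧ e (n - 1) ≠ 0 ∧
      (r = -1 / 2 + √(1 / 4 + q + 2 * (n + x₀) * (n + x₀ - 1)) ∨
        r = -1 / 2 - √(1 / 4 + q + 2 * (n + x₀) * (n + x₀ - 1)))} ∪
    {r | ∃ n : ℤ, e n ≠ 0 ∧ e (n - 1) = 0 ∧ r = -(n + x₀)} ∪
    {r | ∃ n : ℤ, e n = 0 ∧ e (n - 1) ≠ 0 ∧ r = n + x₀ - 1}

/-- The eigenvalues tend to infinity with `|n|`, so every bounded set contains only finitely many.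
-/
theorem isClosed_ladderSpectrum (e : ℤ → V) (x₀ q : ℝ) : IsClosed (ladderSpectrum e x₀ q) := by
  refine isClosed_of_finite_inter_closedBall fun R => ?_
  -- With `x = n + x₀` one has `2x(x - 1) = x² + (x - 1)² - 1`, so a square root bounded by `R +
  -- 1/2` bounds `x²` by `(R + 1/2)² + 1 - q - 1/4`. The summand `|R|` accounts for the linear
  -- families `-x` and `x - 1`.
  let M := |(R + 1 / 2) ^ 2 + 1 - q - 1 / 4| + 2 + |R|
  have hM0 : 0 ≤ |(R + 1 / 2) ^ 2 + 1 - q - 1 / 4| := abs_nonneg _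
  have hfin : {n : ℤ | |(n : ℝ) + x₀| ≤ M}.Finite := by
    refine (Set.finite_Icc ⌊-M - x₀⌋ ⌈M - x₀⌉).subset fun n hn => ?_
    have hn' := abs_le.1 (Set.mem_ofPred_eq ▸ hn)
    constructor
    · exact_mod_cast (Int.floor_le _).trans (by linarith [hn'.1] : -M - x₀ ≤ (n : ℝ))
    · exact_mod_cast (by linarith [hn'.2] : (n : ℝ) ≤ M - x₀).trans (Int.le_ceil _)
  have hx : ∀ n : ℤ, √(1 / 4 + q + 2 * (n + x₀) * (n + x₀ - 1)) ≤ R + 1 / 2 →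
      |(n : ℝ) + x₀| ≤ M := by
    intro n hn
    have h1 : 0 ≤ R + 1 / 2 := (Real.sqrt_nonneg _).trans hn
    have h2 := (Real.sqrt_le_left h1).1 hn
    have h3 : |(n : ℝ) + x₀| ^ 2 ≤ (R + 1 / 2) ^ 2 + 1 - q - 1 / 4 := by
      rw [sq_abs]
      nlinarith [sq_nonneg ((n : ℝ) + x₀ - 1)]
    have h4 := h3.trans (le_abs_self _)
    have h5 : |(n : ℝ) + x₀| ≤ |(R + 1 / 2) ^ 2 + 1 - q - 1 / 4| + 1 := by
      nlinarith [abs_nonneg ((n : ℝ) + x₀), sq_nonneg (|(n : ℝ) + x₀| - 1)]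
    have h6 := abs_nonneg R
    simp only [M]
    linarith
  refine ((((hfin.image fun n : ℤ => -1 / 2 + √(1 / 4 + q + 2 * (n + x₀) * (n + x₀ - 1))).union
    (hfin.image fun n : ℤ => -1 / 2 - √(1 / 4 + q + 2 * (n + x₀) * (n + x₀ - 1)))).union
    (hfin.image fun n : ℤ => -(n + x₀))).union
    (hfin.image fun n : ℤ => n + x₀ - 1)).subset ?_
  rintro r ⟨hr, hR⟩
  rw [mem_closedBall_zero_iff, Real.norm_eq_abs] at hR
  have hR' := abs_le.1 hR
  have hRR := hR.trans (le_abs_self R)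
  rcases hr with (⟨n, -, -, rfl | rfl⟩ | ⟨n, -, -, rfl⟩) | ⟨n, -, -, rfl⟩
  · exact Or.inl (Or.inl (Or.inl ⟨n, hx n (by linarith [hR'.2]), rfl⟩))
  · exact Or.inl (Or.inl (Or.inr ⟨n, hx n (by linarith [hR'.1]), rfl⟩))
  · refine Or.inl (Or.inr ⟨n, ?_, rfl⟩)
    rw [abs_neg] at hRR
    simp only [Set.mem_ofPred_eq, M]
    linarith
  · refine Or.inr ⟨n, ?_, rfl⟩
    have h1 : |(n : ℝ) + x₀| ≤ |(n : ℝ) + x₀ - 1| + 1 := by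
      have := abs_add_le ((n : ℝ) + x₀ - 1) 1
      rwa [sub_add_cancel, abs_one] at this
    simp only [Set.mem_ofPred_eq, M]
    linarith

variable (μ : Measure Cover) [μ.IsHaarMeasure]

/-- Every nonzero vector of a pair is a sum of eigenvectors, so the eigenspaces are total. The
hypothesis `hnn` makes the square roots genuine, since `√` of a negative real would be `0`. -/
theorem IsLadder.localSpectrum_eq (h : IsLadder π e x₀ s) {q : ℝ} (hq : s * (1 - s) = q)
    (hnn : ∀ n : ℤ, (e n ≠ 0 ∨ e (n - 1) ≠ 0) → 0 ≤ 1 / 4 + q + 2 * (n + x₀) * (n + x₀ - 1)) :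
    localSpectrum μ π = (fun r : ℝ => (r : ℂ)) '' ladderSpectrum e x₀ q := by
  rw [SL2Dirac.localSpectrum_eq]
  set Γ := (spinGraph μ π).topologicalClosure with hΓ
  have hs : IsSymmRel (Γ : Set (Dbl V × Dbl V)) := by
    rw [hΓ, Submodule.topologicalClosure_coe]
    exact IsSymmRel.closure fun p hp q hq => isSymmRel_diracRel π p (spinGraph_subset μ π hp) q
      (spinGraph_subset μ π hq)
  have n0 : ∀ n : ℤ, dblVec e (0, n) ≠ 0 ↔ e n ≠ 0 := fun n => by
    rw [dblVec_ne_zero]; simp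
  have n1 : ∀ n : ℤ, dblVec e (1, n) ≠ 0 ↔ e (n - 1) ≠ 0 := fun n => by
    rw [dblVec_ne_zero]; simp
  have d0 : ∀ n : ℤ, dblImage e x₀ s (0, n) = (-((n + x₀ : ℝ) : ℂ)) • dblVec e (0, n) +
      (I * (((n + x₀ : ℝ) : ℂ) - s)) • dblVec e (1, n) := fun n => if_pos rfl
  have d1 : ∀ n : ℤ, dblImage e x₀ s (1, n) =
      (-I * (((n + x₀ : ℝ) : ℂ) - 1 + s)) • dblVec e (0, n) +
        (((n + x₀ : ℝ) : ℂ) - 1) • dblVec e (1, n) := fun n => if_neg (by simp)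
  have hρ : ∀ n : ℤ, (e n ≠ 0 ∨ e (n - 1) ≠ 0) → ∀ ρ : ℝ,
      ρ ^ 2 = 1 / 4 + q + 2 * (n + x₀) * (n + x₀ - 1) → (ρ : ℂ) ^ 2 = 1 / 4 + s * (1 - s) +
        2 * ((n + x₀ : ℝ) : ℂ) * (((n + x₀ : ℝ) : ℂ) - 1) := by
    intro n hn ρ hρ
    rw [hq, ← Complex.ofReal_pow, hρ]
    push_cast
    ring
  have bot : ∀ n, e n ≠ 0 → e (n - 1) = 0 →
      dblVec e (0, n) ∈ eigen Γ ((-(n + x₀) : ℝ) : ℂ) := by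
    intro n h0 h1
    rw [mem_eigen]
    convert! h.mem_closure μ (0, n) ((n0 n).2 h0) using 2
    rw [d0, not_not.1 (mt (n1 n).1 (not_not.2 h1)), smul_zero, add_zero, Complex.ofReal_neg]
  have top : ∀ n, e n = 0 → e (n - 1) ≠ 0 →
      dblVec e (1, n) ∈ eigen Γ ((n + x₀ - 1 : ℝ) : ℂ) := by
    intro n h0 h1
    rw [mem_eigen]
    convert! h.mem_closure μ (1, n) ((n1 n).2 h1) using 2
    rw [d1, not_not.1 (mt (n0 n).1 (not_not.2 h0)), smul_zero, zero_add, Complex.ofReal_sub,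
      Complex.ofReal_one]
  have key : ∀ n, e n ≠ 0 → e (n - 1) ≠ 0 → ∀ ρ : ℝ,
      ρ ^ 2 = 1 / 4 + q + 2 * (n + x₀) * (n + x₀ - 1) →
      ∃ v ≠ 0, v ∈ eigen Γ ((-1 / 2 + ρ : ℝ) : ℂ) := by
    intro n h0 h1 ρ hρn
    have hρ' := hρ n (Or.inl h0) ρ hρn
    have a0 := h.mem_closure μ (0, n) ((n0 n).2 h0)
    have a1 := h.mem_closure μ (1, n) ((n1 n).2 h1)
    have b0 := h.sq_mem_closure μ (0, n) ((n0 n).2 h0) hρ'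
    have b1 := h.sq_mem_closure μ (1, n) ((n1 n).2 h1) hρ'
    -- If `D + 1/2 + ρ` killed both vectors of the pair, its diagonal entries `-x + 1/2 + ρ` and `x
    -- - 1/2 + ρ` would vanish, forcing `ρ = 0`. In that case the vectors themselves are
    -- eigenvectors.
    by_contra! hcon
    have c0 := not_imp_not.1 (fun hne => hcon _ hne) (mem_eigen_of_sq a0 b0)
    have c1 := not_imp_not.1 (fun hne => hcon _ hne) (mem_eigen_of_sq a1 b1)
    rw [d0, dblVec_zero_apply, dblVec_one_apply] at c0
    rw [d1, dblVec_zero_apply, dblVec_one_apply] at c1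
    have f0 := congrArg (fun v : Dbl V => v 0) c0
    have f1 := congrArg (fun v : Dbl V => v 1) c1
    simp only [PiLp.add_apply, PiLp.smul_apply, Matrix.cons_val_zero, Matrix.cons_val_one,
      smul_zero, add_zero, zero_add, ← add_smul, PiLp.zero_apply, smul_eq_zero, h0, h1,
      or_false] at f0 f1
    have hρ0 : ρ = 0 := by
      have : (ρ : ℂ) = 0 := by linear_combination (f0 + f1) / 2
      exact_mod_cast this
    have g := mem_sup_eigen hs a0 b0
    rw [hρ0, add_zero, sub_zero, sup_idem] at g
    rw [hρ0, add_zero] at hcon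
    exact hcon _ ((n0 n).2 h0) g
  refine graphSpectrum_eq_of_eigen Γ (spinGraph μ π).isClosed_topologicalClosure hs
    (isClosed_ladderSpectrum e x₀ q) ?_ ?_
  · set S := ⨆ c : ladderSpectrum e x₀ q, eigen Γ ((c : ℝ) : ℂ) with hS
    have hle : ∀ r ∈ ladderSpectrum e x₀ q, eigen Γ (r : ℂ) ≤ S := fun r hr =>
      le_iSup (fun c : ladderSpectrum e x₀ q => eigen Γ ((c : ℝ) : ℂ)) ⟨r, hr⟩
    have hmem : ∀ j, dblVec e j ∈ S := by
      have hboth : ∀ n, e n ≠ 0 → e (n - 1) ≠ 0 → ∀ i, dblVec e (i, n) ∈ S := by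
        intro n h0 h1 i
        have hne : dblVec e (i, n) ≠ 0 := by
          fin_cases i
          · exact (n0 n).2 h0
          · exact (n1 n).2 h1
        have hsq := Real.sq_sqrt (hnn n (Or.inl h0))
        have g := mem_sup_eigen hs (h.mem_closure μ (i, n) hne)
          (h.sq_mem_closure μ (i, n) hne (hρ n (Or.inl h0) _ hsq))
        exact sup_le (hle _ (Or.inl (Or.inl ⟨n, h0, h1, Or.inl rfl⟩)))
          (hle _ (Or.inl (Or.inl ⟨n, h0, h1, Or.inr rfl⟩))) g
      rintro ⟨i, n⟩
      by_cases h0 : e n = 0 <;> by_cases h1 : e (n - 1) = 0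
      · have hz : dblVec e (i, n) = 0 := by
          fin_cases i
          · exact not_not.1 (mt (n0 n).1 (not_not.2 h0))
          · exact not_not.1 (mt (n1 n).1 (not_not.2 h1))
        rw [hz]
        exact S.zero_mem
      · fin_cases i
        · rw [Fin.zero_eta, not_not.1 (mt (n0 n).1 (not_not.2 h0))]
          exact S.zero_mem
        · exact hle _ (Or.inr ⟨n, h0, h1, rfl⟩) (top n h0 h1)
      · fin_cases i
        · exact hle _ (Or.inl (Or.inr ⟨n, h0, h1, rfl⟩)) (bot n h0 h1)
        · rw [Fin.mk_one, not_not.1 (mt (n1 n).1 (not_not.2 h1))]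
          exact S.zero_mem
      · exact hboth n h0 h1 i
    -- `S` contains all the vectors `dblVec e j`, and these are total.
    have h2 : Sᗮ = ⊥ := by
      rw [Submodule.eq_bot_iff]
      intro x hx
      exact h.total_dbl x fun j => (Submodule.mem_orthogonal S x).1 hx _ (hmem j)
    rw [Submodule.dense_iff_topologicalClosure_eq_top]
    exact (Submodule.topologicalClosure_eq_top_iff).2 h2
  · rintro r ((⟨n, h0, h1, rfl | rfl⟩ | ⟨n, h0, h1, rfl⟩) | ⟨n, h0, h1, rfl⟩)
    · exact key n h0 h1 _ (Real.sq_sqrt (hnn n (Or.inl h0)))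
    · rw [sub_eq_add_neg]
      exact key n h0 h1 _ (by rw [neg_sq]; exact Real.sq_sqrt (hnn n (Or.inl h0)))
    · exact ⟨_, (n0 n).2 h0, bot n h0 h1⟩
    · exact ⟨_, (n1 n).2 h1, top n h0 h1⟩

end LadderSpectrum

/-! ### Infinitesimal action of the one-parameter subgroups -/

theorem den_expX_zero (k : Fin 3) (z : ℂ) : den (expX k 0).g z = 1 := by
  rw [expX_zero]; exact den_one z

theorem hasDerivAt_cosh_half : HasDerivAt (fun t : ℝ => ((Real.cosh (t / 2) : ℝ) : ℂ)) 0 0 := by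
  have h := ((Real.hasDerivAt_cosh (0 / 2)).comp (0 : ℝ) ((hasDerivAt_id (0 : ℝ)).div_const 2))
  simpa using h.ofReal_comp

theorem hasDerivAt_sinh_half :
    HasDerivAt (fun t : ℝ => ((Real.sinh (t / 2) : ℝ) : ℂ)) (1 / 2) 0 := by
  have h := ((Real.hasDerivAt_sinh (0 / 2)).comp (0 : ℝ) ((hasDerivAt_id (0 : ℝ)).div_const 2))
  simpa using h.ofReal_comp

theorem hasDerivAt_al_be (k : Fin 3) :
    HasDerivAt (fun t : ℝ => al (expX k t).g) (![I / 2, 0, 0] k) 0 ∧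
      HasDerivAt (fun t : ℝ => be (expX k t).g) (![0, 1 / 2, I / 2] k) 0 := by
  fin_cases k
  · change HasDerivAt (fun t : ℝ => al (mat0 t)) _ 0 ∧ HasDerivAt (fun t : ℝ => be (mat0 t)) _ 0
    simp only [al_mat0, be_mat0]
    refine ⟨?_, hasDerivAt_const _ _⟩
    have h := (((hasDerivAt_id (0 : ℝ)).div_const 2).ofReal_comp.mul_const I).cexp
    simpa [div_eq_inv_mul] using h
  · change HasDerivAt (fun t : ℝ => al (mat1 t)) _ 0 ∧ HasDerivAt (fun t : ℝ => be (mat1 t)) _ 0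
    simp only [al_mat1, be_mat1]
    exact ⟨hasDerivAt_cosh_half, hasDerivAt_sinh_half⟩
  · change HasDerivAt (fun t : ℝ => al (mat2 t)) _ 0 ∧ HasDerivAt (fun t : ℝ => be (mat2 t)) _ 0
    simp only [al_mat2, be_mat2]
    refine ⟨hasDerivAt_cosh_half, ?_⟩
    have h := hasDerivAt_sinh_half.mul_const I
    simpa [div_eq_inv_mul] using h

theorem hasDerivAt_conj {f : ℝ → ℂ} {f' : ℂ} {t : ℝ} (h : HasDerivAt f f' t) :
    HasDerivAt (fun t => conj (f t)) (conj f') t :=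
  (Complex.conjCLE.toContinuousLinearMap.hasFDerivAt (x := f t)).comp_hasDerivAt t h

theorem hasDerivAt_den_expX (k : Fin 3) (z : ℂ) :
    HasDerivAt (fun t : ℝ => den (expX k t).g z) (![-(I / 2), z / 2, -(I * z / 2)] k) 0 := by
  obtain ⟨ha, hb⟩ := hasDerivAt_al_be k
  have h := ((hasDerivAt_conj hb).mul_const z).add (hasDerivAt_conj ha)
  convert! h using 1
  fin_cases k <;> simp [map_ofNat] <;> ring

/-- At `t = 0` the automorphy factor is `1`, so it and its logarithm have the same derivative. -/
theorem hasDerivAt_φ_expX (k : Fin 3) (z : Disc) :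
    HasDerivAt (fun t : ℝ => (expX k t).φ z) (![-(I / 2), z / 2, -(I * z / 2)] k) 0 := by
  have hlog : HasDerivAt (fun t : ℝ => Complex.log (den (expX k t).g z))
      (![-(I / 2), z / 2, -(I * z / 2)] k) 0 := by
    have h := (hasDerivAt_den_expX k z).clog_real (by rw [den_expX_zero]; exact one_mem_slitPlane)
    rwa [den_expX_zero, div_one] at h
  fin_cases k
  · have h := (((hasDerivAt_id (0 : ℝ)).div_const 2).ofReal_comp.mul_const I).neg
    convert! h using 1
    simp [div_eq_inv_mul]
  · exact hlog
  · exact hlog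

theorem hasDerivAt_mob_expX (k : Fin 3) (z : ℂ) :
    HasDerivAt (fun t : ℝ => mob (expX k t).g z)
      (![I * z, (1 - z ^ 2) / 2, I * (1 + z ^ 2) / 2] k) 0 := by
  obtain ⟨ha, hb⟩ := hasDerivAt_al_be k
  have hn : HasDerivAt (fun t : ℝ => num (expX k t).g z) _ 0 := (ha.mul_const z).add hb
  have h := hn.div (hasDerivAt_den_expX k z) (by rw [den_expX_zero]; exact one_ne_zero)
  have hn0 : num (expX k 0).g z = z := by
    rw [expX_zero]
    simp [num, al_one, be_one]
  rw [den_expX_zero, hn0] at h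
  convert! h using 1
  fin_cases k <;> simp <;> ring

theorem mob_mat0 (t : ℝ) (z : ℂ) : mob (mat0 t) z = Complex.exp ((t : ℂ) * I) * z := by
  rw [mob, num, den, be_mat0, al_mat0, ← Complex.exp_conj, map_mul, Complex.conj_ofReal,
    Complex.conj_I, map_zero, zero_mul, zero_add, add_zero, div_eq_mul_inv, ← Complex.exp_neg,
    mul_right_comm, ← Complex.exp_add]
  congr 2
  push_cast
  ring

/-! ### Differentiating multiplier representations -/

namespace Multiplier

variable {Y : Type*} [MetricSpace Y] [CompactSpace Y] [MeasurableSpace Y] [BorelSpace Y]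
  {ν : Measure Y} (M : Multiplier Y ν)

/-- The operator `f ↦ c(x, ·) f(x ·)` on continuous functions. -/
def opC (x : Cover) (f : C(Y, ℂ)) : C(Y, ℂ) :=
  ⟨fun p => M.c x p * f (M.act x p),
    (M.continuous_c_right x).mul (f.continuous.comp (M.continuous_act_right x))⟩

theorem continuous_opC (f : C(Y, ℂ)) : Continuous fun x => M.opC x f :=
  ContinuousMap.continuous_of_continuous_uncurry _
    (M.continuous_c.mul (f.continuous.comp M.continuous_act))

theorem op_toLp [IsFiniteMeasure ν] (x : Cover) (f : C(Y, ℂ)) :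
    M.op x (ContinuousMap.toLp 2 ν ℂ f) = ContinuousMap.toLp 2 ν ℂ (M.opC x f) := by
  refine Lp.ext ?_
  filter_upwards [M.op_coeFn x (ContinuousMap.toLp 2 ν ℂ f),
    ContinuousMap.coeFn_toLp (p := 2) (𝕜 := ℂ) ν (M.opC x f),
    (M.qmp x).ae (ContinuousMap.coeFn_toLp (p := 2) (𝕜 := ℂ) ν f)] with p h1 h2 h3
  rw [h1, h2, h3]
  rfl

theorem hom_inv_toLp [IsFiniteMeasure ν] (x : Cover) (f : C(Y, ℂ)) :
    M.rep.hom x⁻¹ (ContinuousMap.toLp 2 ν ℂ f) = ContinuousMap.toLp 2 ν ℂ (M.opC x f) := by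
  rw [← op_toLp]
  change M.op x⁻¹⁻¹ _ = _
  rw [inv_inv]

/-- Upgrades a pointwise derivative at `0` to a derivative in the supremum norm. The group law gives
the pointwise derivative at every `t`, namely the translate of `f'`. This is continuous in `t` for
the supremum norm, so the fundamental theorem of calculus applies in `C(Y, ℂ)`. -/
theorem hasDerivAt_opC (k : Fin 3) (f f' : C(Y, ℂ))
    (h : ∀ p, HasDerivAt (fun t => M.c (expX k t) p * f (M.act (expX k t) p)) (f' p) 0) :
    HasDerivAt (fun t => M.opC (expX k t) f) f' 0 := by
  have h1 : ∀ t p, HasDerivAt (fun t => M.opC (expX k t) f p) (M.opC (expX k t) f' p) t := by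
    intro t p
    have h2 := ((h (M.act (expX k t) p)).const_mul (M.c (expX k t) p))
    rw [← sub_self t] at h2
    refine (h2.comp_sub_const t t).congr_of_eventuallyEq (Filter.Eventually.of_forall fun s => ?_)
    change M.c (expX k s) p * f (M.act (expX k s) p) = M.c (expX k t) p *
      (M.c (expX k (s - t)) (M.act (expX k t) p) * f (M.act (expX k (s - t)) (M.act (expX k t) p)))
    rw [← mul_assoc, mul_comm (M.c (expX k t) p), ← M.c_mul, ← M.act_mul, ← expX_add,
      sub_add_cancel]
  have hc : Continuous fun t => M.opC (expX k t) f' :=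
    (M.continuous_opC f').comp (continuous_expX k)
  have h2 : ∀ t, M.opC (expX k t) f =
      M.opC (expX k 0) f + ∫ s in (0 : ℝ)..t, M.opC (expX k s) f' := by
    intro t
    ext p
    have e1 : (∫ s in (0 : ℝ)..t, M.opC (expX k s) f') p =
        ∫ s in (0 : ℝ)..t, M.opC (expX k s) f' p :=
      ((ContinuousMap.evalCLM ℝ p).intervalIntegral_comp_comm (hc.intervalIntegrable 0 t)).symm
    rw [ContinuousMap.add_apply, e1, intervalIntegral.integral_eq_sub_of_hasDerivAt
      (fun s _ => h1 s p)
      (((ContinuousMap.evalCLM ℝ p).continuous.comp hc).intervalIntegrable 0 t)]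
    ring
  have h3 := (intervalIntegral.integral_hasDerivAt_right (hc.intervalIntegrable 0 0)
    (hc.stronglyMeasurableAtFilter _ _) hc.continuousAt).const_add (M.opC (expX k 0) f)
  have h4 : M.opC (expX k 0) f' = f' := by
    ext p
    change M.c (expX k 0) p * f' (M.act (expX k 0) p) = f' p
    rw [expX_zero, M.c_one, M.act_one, one_mul]
  rw [h4] at h3
  exact h3.congr_of_eventuallyEq (Filter.Eventually.of_forall h2)

theorem hasDerivAt_hom_toLp [IsFiniteMeasure ν] (k : Fin 3) (f f' : C(Y, ℂ))
    (h : ∀ p, HasDerivAt (fun t => M.c (expX k t) p * f (M.act (expX k t) p)) (f' p) 0) :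
    HasDerivAt (fun t => M.rep.hom (expX k t)⁻¹ (ContinuousMap.toLp 2 ν ℂ f))
      (ContinuousMap.toLp 2 ν ℂ f') 0 := by
  simp only [hom_inv_toLp]
  exact ((ContinuousMap.toLp 2 ν ℂ).restrictScalars ℝ).hasFDerivAt.comp_hasDerivAt 0
    (M.hasDerivAt_opC k f f' h)

end Multiplier

/-! ### The principal series -/

theorem Circ.ne_zero (z : Circ) : (z : ℂ) ≠ 0 := by
  rw [← norm_pos_iff, z.norm_eq]; exact one_pos

/-- The monomial `ζ ^ n` on the circle. -/
def circMono (n : ℤ) : C(Circ, ℂ) :=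
  ⟨fun z => (z : ℂ) ^ n, continuous_subtype_val.zpow₀ n fun z => Or.inl (Circ.ne_zero z)⟩

theorem circMono_apply (n : ℤ) (z : Circ) : circMono n z = (z : ℂ) ^ n := rfl

theorem toLp_circMono_ne_zero (n : ℤ) : ContinuousMap.toLp 2 circleMeasure ℂ (circMono n) ≠ 0 := by
  intro h
  have h1 := ContinuousMap.coeFn_toLp (p := 2) (𝕜 := ℂ) circleMeasure (circMono n)
  rw [h] at h1
  have h2 : ∀ᵐ z ∂circleMeasure, False := by
    filter_upwards [h1, Lp.coeFn_zero ℂ 2 circleMeasure] with z h3 h4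
    rw [h4, Pi.zero_apply, circMono_apply] at h3
    exact zpow_ne_zero n (Circ.ne_zero z) h3.symm
  exact IsProbabilityMeasure.ne_zero circleMeasure (by simpa using h2)

/-- Pulled back along `circPt`, the monomials become the Fourier basis of the additive circle. -/
theorem eq_zero_of_inner_circMono (v : Lp ℂ 2 circleMeasure)
    (h : ∀ n, ⟪ContinuousMap.toLp 2 circleMeasure ℂ (circMono n), v⟫_ℂ = 0) : v = 0 := by
  have hmp : MeasurePreserving circPt (AddCircle.haarAddCircle (T := 2 * Real.pi)) circleMeasure :=
    ⟨continuous_circPt.measurable, rfl⟩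
  let Φ := Lp.compMeasurePreservingₗᵢ ℂ (E := ℂ) (p := 2) circPt hmp
  have e1 : ∀ n, Φ (ContinuousMap.toLp 2 circleMeasure ℂ (circMono n)) = fourierLp 2 n := by
    intro n
    refine Lp.ext ?_
    filter_upwards [Lp.coeFn_compMeasurePreserving
      (ContinuousMap.toLp 2 circleMeasure ℂ (circMono n)) hmp, coeFn_fourierLp 2 n,
      hmp.quasiMeasurePreserving.ae
        (ContinuousMap.coeFn_toLp (p := 2) (𝕜 := ℂ) circleMeasure (circMono n))] with θ h1 h2 h3
    refine h1.trans ?_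
    rw [Function.comp_apply, h3, h2, circMono_apply, fourier_apply, AddCircle.toCircle_zsmul]
    simp [circPt]
  have e2 : Φ v = 0 := by
    refine (fourierBasis (T := 2 * Real.pi)).repr.injective ?_
    rw [map_zero]
    ext n
    rw [HilbertBasis.repr_apply_apply, coe_fourierBasis, ← e1, Φ.inner_map_map, h]
    rfl
  exact (map_eq_zero_iff Φ Φ.injective).1 e2

theorem conj_circ (z : Circ) : conj (z : ℂ) = (z : ℂ)⁻¹ := by
  refine eq_inv_of_mul_eq_one_left ?_
  rw [mul_comm, Complex.mul_conj, Complex.normSq_eq_norm_sq, z.norm_eq]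
  simp

theorem hasDerivAt_exp_mul_comp {u w : ℝ → ℂ} {u' w' p f' : ℂ} {f : ℂ → ℂ} (hu : HasDerivAt u u' 0)
    (hw : HasDerivAt w w' 0) (hu0 : u 0 = 0) (hw0 : w 0 = p) (hf : HasDerivAt f f' p) :
    HasDerivAt (fun t => Complex.exp (u t) * f (w t)) (u' * f p + w' * f') 0 := by
  subst hw0
  have h := hu.cexp.mul (hf.scomp (0 : ℝ) hw)
  refine HasDerivAt.congr_deriv h ?_
  simp [hu0]

/-- Passes from the separate derivatives along `X₁` and `X₂` to the combinations `X₁ ± iX₂` required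
of a ladder. -/
theorem exists_deriv_of_hasDerivAt {V : Type*} [NormedAddCommGroup V] [InnerProductSpace ℂ V]
    {γ : Fin 3 → ℝ → V} {u v w : V} {x s : ℂ}
    (h : ∀ k, HasDerivAt (γ k) (![(x * I) • u, (-(x + s) / 2) • v + ((x - s) / 2) • w,
      (I * (x + s) / 2) • v + (I * (x - s) / 2) • w] k) 0) :
    ∃ a : Fin 3 → V, (∀ k, HasDerivAt (γ k) (a k) 0) ∧ a 0 = (x * I) • u ∧
      a 1 + I • a 2 = (-(x + s)) • v ∧ a 1 - I • a 2 = (x - s) • w := by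
  refine ⟨_, h, rfl, ?_, ?_⟩ <;>
  · have h1 : I * (I * (x + s) / 2) = -(x + s) / 2 := by linear_combination (x + s) / 2 * I_mul_I
    have h2 : I * (I * (x - s) / 2) = -(x - s) / 2 := by linear_combination (x - s) / 2 * I_mul_I
    simp only [Matrix.cons_val, smul_add, smul_smul, h1, h2]
    module

/-- `ζ ^ n` has weight `n + τ`, and `s = 1/2 + iσ` gives `s(1 - s) = 1/4 + σ²`. No monomial
vanishes, so the ladder is infinite in both directions. -/
theorem isLadder_principalSeries (q τ : ℝ) : IsLadder (principalSeries q τ)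
    (fun n => ContinuousMap.toLp 2 circleMeasure ℂ (circMono n)) τ
    (1 / 2 + (√(q - 1 / 4) : ℝ) * I) where
  total := eq_zero_of_inner_circMono
  bot n _ h := absurd h (toLp_circMono_ne_zero _)
  top n _ h := absurd h (toLp_circMono_ne_zero _)
  rot n := by
    refine (Multiplier.hom_inv_toLp _ _ _).trans ?_
    rw [← map_smul]
    congr 1
    ext z
    change Complex.exp (-(1 + 2 * (√(q - 1 / 4) : ℝ) * I) * (-((1 / 2 : ℝ) * I)).re -
      2 * τ * I * (-((1 / 2 : ℝ) * I) : ℂ).im) * (mob (mat0 1) z) ^ n =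
        Complex.exp (((n + τ : ℝ) : ℂ) * I) * (z : ℂ) ^ n
    rw [mob_mat0, mul_zpow, ← Complex.exp_int_mul, ← mul_assoc, ← Complex.exp_add]
    congr 2
    simp
    ring
  deriv n _ := by
    set σ := √(q - 1 / 4)
    set x : ℂ := ((n + τ : ℝ) : ℂ) with hx
    set s : ℂ := 1 / 2 + (σ : ℝ) * I with hs
    let F : Fin 3 → C(Circ, ℂ) := ![(x * I) • circMono n,
      (-(x + s) / 2) • circMono (n + 1) + ((x - s) / 2) • circMono (n - 1),
      (I * (x + s) / 2) • circMono (n + 1) + (I * (x - s) / 2) • circMono (n - 1)]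
    refine exists_deriv_of_hasDerivAt fun k => ?_
    have hd : HasDerivAt (fun t => (principalSeries q τ).hom (expX k t)⁻¹
        (ContinuousMap.toLp 2 circleMeasure ℂ (circMono n)))
        (ContinuousMap.toLp 2 circleMeasure ℂ (F k)) 0 := by
      refine Multiplier.hasDerivAt_hom_toLp _ k _ _ fun p => ?_
      have hφ := hasDerivAt_φ_expX k p.toDisc
      have hm := hasDerivAt_mob_expX k (p : ℂ)
      have hre := (Complex.reCLM.hasFDerivAt.comp_hasDerivAt (0 : ℝ) hφ).ofReal_comp
      have him := (Complex.imCLM.hasFDerivAt.comp_hasDerivAt (0 : ℝ) hφ).ofReal_comp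
      have hp := Circ.ne_zero p
      have h := hasDerivAt_exp_mul_comp ((hre.const_mul (-(1 + 2 * (σ : ℝ) * I))).fun_sub
        (him.const_mul (2 * τ * I))) hm (by simp [expX_zero]) (by rw [expX_zero]; exact mob_one _)
        (hasDerivAt_zpow n (p : ℂ) (Or.inl hp))
      refine HasDerivAt.congr_deriv h ?_
      clear h hre him hm hφ
      -- Real and imaginary parts are written through the conjugate, and `conj ζ = ζ⁻¹` on the
      -- circle; the derivatives then become Laurent monomials.
      simp only [Complex.reCLM_apply, Complex.imCLM_apply, Complex.re_eq_add_conj,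
        Complex.im_eq_sub_conj, zpow_sub_one₀ hp, Circ.toDisc, F, hs, hx]
      fin_cases k <;>
        simp [circMono_apply, conj_circ, map_ofNat, zpow_add_one₀ hp, zpow_sub_one₀ hp] <;>
        field_simp <;> ring
    convert! hd using 1
    fin_cases k <;> simp [F]

open Filter

/-! ### Orthogonal expansions in the weighted Bergman spaces -/

theorem measurePreserving_mobD_mat0 (ℓ t : ℝ) :
    MeasurePreserving (mobD (mat0 t)) (bergmanMeasure ℓ) (bergmanMeasure ℓ) := by
  refine ⟨(mobD _).continuous.measurable, ?_⟩
  refine Measure.ext_of_lintegral _ fun F hF => ?_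
  rw [lintegral_map hF (mobD _).continuous.measurable, ← lintegral_mobD ℓ (mat0 t) F hF]
  refine lintegral_congr fun p => ?_
  have h : ‖den (mat0 t) p‖ = 1 := by
    rw [den, be_mat0, al_mat0, map_zero, zero_mul, zero_add, RCLike.norm_conj,
      Complex.norm_exp_ofReal_mul_I]
  rw [h, Real.one_rpow, ENNReal.ofReal_one, one_mul]

/-- The monomial `z ^ n` on the disc. -/
def discMono (n : ℕ) : C(Disc, ℂ) := ⟨fun z => (z : ℂ) ^ n, by fun_prop⟩

theorem discMono_apply (n : ℕ) (z : Disc) : discMono n z = (z : ℂ) ^ n := rfl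

/-- The concentric closed disc of radius `r` inside the closed unit disc. -/
def subDisc (r : ℝ) : Set Disc := {p | ‖(p : ℂ)‖ ≤ r}

theorem measurableSet_subDisc (r : ℝ) : MeasurableSet (subDisc r) :=
  (isClosed_le (by fun_prop) continuous_const).measurableSet

theorem ae_norm_lt_one (ℓ : ℝ) : ∀ᵐ p : Disc ∂bergmanMeasure ℓ, ‖(p : ℂ)‖ < 1 := by
  have hm : Measurable ((Metric.ball (0 : ℂ) 1)ᶜ.indicator (1 : ℂ → ℝ≥0∞)) :=
    measurable_one.indicator Metric.isOpen_ball.measurableSet.compl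
  have h := lintegral_bergmanMeasure ℓ _ hm
  rw [setLIntegral_congr_fun (g := fun _ => 0) Metric.isOpen_ball.measurableSet fun z hz => by
    simp only [Set.indicator_of_notMem (fun h => h hz : z ∉ (Metric.ball (0 : ℂ) 1)ᶜ), mul_zero],
    lintegral_zero, lintegral_eq_zero_iff (by fun_prop)] at h
  filter_upwards [h] with p hp
  by_contra hn
  have h1 : (p : ℂ) ∈ (Metric.ball (0 : ℂ) 1)ᶜ := fun h => hn (mem_ball_zero_iff.1 h)
  simp only [Set.indicator_of_mem h1, Pi.one_apply, Pi.zero_apply, one_ne_zero] at hp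

/-- The unit circle is a null set, so discs of radius `r < 1` exhaust the measure as `r → 1`. On
them Taylor series converge uniformly. -/
theorem aecover_subDisc (ℓ : ℝ) : AECover (bergmanMeasure ℓ) (𝓝[<] (1 : ℝ)) subDisc where
  ae_eventually_mem := by
    filter_upwards [ae_norm_lt_one ℓ] with p hp
    filter_upwards [Ioo_mem_nhdsLT hp] with r hr using hr.1.le
  measurableSet := measurableSet_subDisc

theorem tendsto_setIntegral_inner_subDisc {ℓ : ℝ} (f g : Lp ℂ 2 (bergmanMeasure ℓ)) :
    Tendsto (fun r => ∫ p in subDisc r, ⟪f p, g p⟫_ℂ ∂bergmanMeasure ℓ) (𝓝[<] 1)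
      (𝓝 ⟪f, g⟫_ℂ) :=
  (aecover_subDisc ℓ).integral_tendsto_of_countably_generated (L2.integrable_inner f g)

theorem setIntegral_discMono_mul {ℓ : ℝ} (hℓ : 1 / 2 < ℓ) (r : ℝ) {m n : ℕ} (h : m ≠ n) :
    ∫ p in subDisc r, conj (discMono m p) * discMono n p ∂bergmanMeasure ℓ = 0 := by
  have := isFiniteMeasure_bergmanMeasure hℓ
  -- The rotation by this angle preserves the measure and the subdisc, and multiplies `conj z ^ m *
  -- z ^ n` by `e^{i(n - m)t} = -1`.
  set t : ℝ := Real.pi / ((n : ℝ) - m) with ht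
  have hnm : (n : ℝ) - m ≠ 0 := sub_ne_zero.2 (by exact_mod_cast h.symm)
  have hpre : mobD (mat0 t) ⁻¹' subDisc r = subDisc r := by
    ext p
    simp only [subDisc, Set.mem_preimage, Set.mem_ofPred_eq, coe_mobD, mob_mat0, norm_mul,
      Complex.norm_exp_ofReal_mul_I, one_mul]
  have hmp := (measurePreserving_mobD_mat0 ℓ t).restrict_preimage (measurableSet_subDisc r)
  rw [hpre] at hmp
  have hc : Continuous fun p : Disc => conj (discMono m p) * discMono n p :=
    (Complex.continuous_conj.comp (discMono m).continuous).mul (discMono n).continuous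
  have h1 : ∫ p in subDisc r, conj (discMono m (mobD (mat0 t) p)) * discMono n (mobD (mat0 t) p)
      ∂bergmanMeasure ℓ = ∫ p in subDisc r, conj (discMono m p) * discMono n p
      ∂bergmanMeasure ℓ := by
    conv_rhs => rw [← hmp.map_eq]
    rw [integral_map hmp.measurable.aemeasurable hc.aestronglyMeasurable]
  have h2 : ∀ p : Disc, conj (discMono m (mobD (mat0 t) p)) * discMono n (mobD (mat0 t) p) =
      -(conj (discMono m p) * discMono n p) := by
    intro p
    have h3 : Complex.exp (-((t : ℂ) * I)) ^ m * Complex.exp ((t : ℂ) * I) ^ n = -1 := by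
      rw [← Complex.exp_nat_mul, ← Complex.exp_nat_mul, ← Complex.exp_add, ← Complex.exp_pi_mul_I]
      congr 1
      have h4 : (t : ℂ) * (n - m) = Real.pi := by
        rw [ht]
        push_cast
        exact div_mul_cancel₀ _ (by exact_mod_cast hnm)
      linear_combination I * h4
    simp only [discMono_apply, coe_mobD, mob_mat0, map_pow, map_mul, ← Complex.exp_conj,
      Complex.conj_ofReal, Complex.conj_I, mul_neg, mul_pow]
    linear_combination (conj (p : ℂ) ^ m * (p : ℂ) ^ n) * h3
  simp only [h2, integral_neg] at h1
  linear_combination -(1 / 2) * h1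

/-- The monomial `z ^ n` as an element of the weighted `L²` space. -/
def lpMono {ℓ : ℝ} (hℓ : 1 / 2 < ℓ) (n : ℕ) : Lp ℂ 2 (bergmanMeasure ℓ) :=
  have := isFiniteMeasure_bergmanMeasure hℓ
  ContinuousMap.toLp 2 (bergmanMeasure ℓ) ℂ (discMono n)

theorem lpMono_coeFn {ℓ : ℝ} (hℓ : 1 / 2 < ℓ) (n : ℕ) :
    lpMono hℓ n =ᵐ[bergmanMeasure ℓ] discMono n :=
  have := isFiniteMeasure_bergmanMeasure hℓ
  ContinuousMap.coeFn_toLp (p := 2) (𝕜 := ℂ) _ _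

theorem setIntegral_inner_lpMono {ℓ : ℝ} (hℓ : 1 / 2 < ℓ) (r : ℝ) {m n : ℕ} (h : m ≠ n) :
    ∫ p in subDisc r, ⟪lpMono hℓ m p, lpMono hℓ n p⟫_ℂ ∂bergmanMeasure ℓ = 0 := by
  refine (integral_congr_ae (ae_restrict_of_ae ?_)).trans (setIntegral_discMono_mul hℓ r h)
  filter_upwards [lpMono_coeFn hℓ m, lpMono_coeFn hℓ n] with p h1 h2
  rw [h1, h2, RCLike.inner_apply']

theorem inner_lpMono {ℓ : ℝ} (hℓ : 1 / 2 < ℓ) {m n : ℕ} (h : m ≠ n) :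
    ⟪lpMono hℓ m, lpMono hℓ n⟫_ℂ = 0 := by
  refine tendsto_nhds_unique (tendsto_setIntegral_inner_subDisc _ _) ?_
  simp only [setIntegral_inner_lpMono hℓ _ h]
  exact tendsto_const_nhds

/-- The weight is strictly positive on the open disc; if `z ^ n` vanished almost everywhere, the
disc would be Lebesgue null. -/
theorem lpMono_ne_zero {ℓ : ℝ} (hℓ : 1 / 2 < ℓ) (n : ℕ) : lpMono hℓ n ≠ 0 := by
  intro h
  have h1 := lpMono_coeFn hℓ n
  rw [h] at h1
  have h2 : ∀ᵐ p : Disc ∂bergmanMeasure ℓ, (p : ℂ) = 0 := by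
    filter_upwards [h1, Lp.coeFn_zero ℂ 2 (bergmanMeasure ℓ)] with p h3 h4
    rw [h4, Pi.zero_apply, discMono_apply] at h3
    exact eq_zero_of_pow_eq_zero h3.symm
  have hm : Measurable (({0} : Set ℂ)ᶜ.indicator (1 : ℂ → ℝ≥0∞)) :=
    measurable_one.indicator (measurableSet_singleton _).compl
  have h3 := lintegral_bergmanMeasure ℓ _ hm
  rw [lintegral_congr_ae (g := fun _ => 0) (by
    filter_upwards [h2] with p hp
    simp [hp]), lintegral_zero, eq_comm, lintegral_eq_zero_iff (by fun_prop)] at h3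
  have h4 : ∀ᵐ z : ℂ ∂volume.restrict (Metric.ball (0 : ℂ) 1), False := by
    filter_upwards [h3, ae_restrict_mem Metric.isOpen_ball.measurableSet,
      ae_restrict_of_ae (Measure.ae_ne volume (0 : ℂ))] with z h5 h6 h7
    have h8 : z ∈ ({0} : Set ℂ)ᶜ := h7
    rw [mem_ball_zero_iff] at h6
    have h9 : 0 < 1 - ‖z‖ ^ 2 := by nlinarith [norm_nonneg z]
    simp only [Set.indicator_of_mem h8, Pi.one_apply, Pi.zero_apply, mul_one,
      ENNReal.ofReal_eq_zero] at h5
    exact absurd (Real.rpow_pos_of_pos h9 _) (not_lt.2 h5)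
  rw [ae_restrict_iff' Metric.isOpen_ball.measurableSet] at h4
  have h5 : volume (Metric.ball (0 : ℂ) 1) = 0 := by
    rw [measure_eq_zero_iff_ae_notMem]
    exact h4
  exact (Metric.measure_ball_pos volume (0 : ℂ) one_pos).ne' h5

theorem lpMono_mem_holL2 {ℓ : ℝ} (hℓ : 1 / 2 < ℓ) (n : ℕ) : lpMono hℓ n ∈ holL2 ℓ :=
  ⟨fun z => z ^ n, (differentiable_id.pow n).differentiableOn, lpMono_coeFn hℓ n⟩

/-- The Taylor series of `f` at `0` is dominated by `∑ ‖a n‖ r ^ n` on the disc of radius `r < 1`,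
so sum and integral may be exchanged. The coefficients depend on neither `g` nor `r`. -/
theorem exists_hasSum_setIntegral {ℓ : ℝ} (hℓ : 1 / 2 < ℓ) {f : Lp ℂ 2 (bergmanMeasure ℓ)}
    (hf : f ∈ holL2 ℓ) : ∃ a : ℕ → ℂ, ∀ (g : Lp ℂ 2 (bergmanMeasure ℓ)) (r : ℝ), 0 ≤ r → r < 1 →
      HasSum (fun n => conj (a n) * ∫ p in subDisc r, ⟪lpMono hℓ n p, g p⟫_ℂ ∂bergmanMeasure ℓ)
        (∫ p in subDisc r, ⟪f p, g p⟫_ℂ ∂bergmanMeasure ℓ) := by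
  have := isFiniteMeasure_bergmanMeasure hℓ
  obtain ⟨F, hF, hfF⟩ := hf
  set a : ℕ → ℂ := fun n => ((n.factorial : ℂ))⁻¹ * iteratedDeriv n F 0
  have hs : ∀ z : ℂ, ‖z‖ < 1 → HasSum (fun n => a n * z ^ n) (F z) := by
    intro z hz
    have h := Complex.hasSum_taylorSeries_on_ball hF (mem_ball_zero_iff.2 hz)
    simp only [sub_zero, smul_eq_mul] at h
    refine h.congr_fun fun n => ?_
    ring
  refine ⟨a, fun g r hr0 hr1 => ?_⟩
  have hgi : IntegrableOn (fun p => ‖g p‖) (subDisc r) (bergmanMeasure ℓ) :=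
    ((Lp.memLp g).integrable (by norm_num)).norm.integrableOn
  have hint : ∀ n, Integrable (fun p => conj (a n) * ⟪lpMono hℓ n p, g p⟫_ℂ)
      ((bergmanMeasure ℓ).restrict (subDisc r)) := fun n =>
    ((L2.integrable_inner (lpMono hℓ n) g).const_mul _).integrableOn
  have hsum : Summable fun n => ‖a n‖ * r ^ n := by
    have h := (hs r (by rwa [Complex.norm_real, Real.norm_of_nonneg hr0])).summable.norm
    refine h.congr fun n => ?_
    rw [norm_mul, norm_pow, Complex.norm_real, Real.norm_of_nonneg hr0]
  have hb : ∀ n, ∫ p in subDisc r, ‖conj (a n) * ⟪lpMono hℓ n p, g p⟫_ℂ‖ ∂bergmanMeasure ℓ ≤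
      ‖a n‖ * r ^ n * ∫ p in subDisc r, ‖g p‖ ∂bergmanMeasure ℓ := by
    intro n
    rw [← integral_const_mul]
    refine integral_mono_ae (hint n).norm (hgi.const_mul _) ?_
    filter_upwards [ae_restrict_of_ae (lpMono_coeFn hℓ n),
      ae_restrict_mem (measurableSet_subDisc r)] with p h1 h2
    rw [h1, RCLike.inner_apply', norm_mul, norm_mul, RCLike.norm_conj, RCLike.norm_conj,
      discMono_apply, norm_pow, ← mul_assoc]
    gcongr
    exact h2
  have h := hasSum_integral_of_summable_integral_norm hint
    (Summable.of_nonneg_of_le (fun n => integral_nonneg fun p => norm_nonneg _) hb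
      (hsum.mul_right _))
  simp only [integral_const_mul] at h
  convert! h using 1
  refine integral_congr_ae ?_
  filter_upwards [ae_restrict_of_ae hfF, ae_restrict_mem (measurableSet_subDisc r),
    ae_restrict_of_ae (ae_all_iff.2 fun n => lpMono_coeFn hℓ n)] with p h1 h2 h3
  have h4 := ((hs p (lt_of_le_of_lt h2 hr1)).map (starRingEnd ℂ) Complex.continuous_conj).mul_right
    (g p)
  rw [h1, RCLike.inner_apply', ← h4.tsum_eq]
  refine tsum_congr fun n => ?_
  rw [h3, RCLike.inner_apply', Function.comp_apply, map_mul, discMono_apply, mul_assoc]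

/-- A holomorphic `f` has least norm among the vectors with its coefficients: `‖f‖² ≤ ∑ |a m|² ‖z ^
m‖²`, and Bessel's inequality bounds the sum by `‖x‖²`. Working on discs of radius `r` and letting
`r → 1` avoids proving that the Taylor series converges in `L²`. -/
theorem norm_le_of_inner_lpMono_eq {ℓ : ℝ} (hℓ : 1 / 2 < ℓ) {f x : Lp ℂ 2 (bergmanMeasure ℓ)}
    (hf : f ∈ holL2 ℓ) (hx : ∀ n, ⟪lpMono hℓ n, x⟫_ℂ = ⟪lpMono hℓ n, f⟫_ℂ) : ‖f‖ ≤ ‖x‖ := by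
  obtain ⟨a, ha⟩ := exists_hasSum_setIntegral hℓ hf
  set T : Lp ℂ 2 (bergmanMeasure ℓ) → Lp ℂ 2 (bergmanMeasure ℓ) → ℝ → ℂ :=
    fun f g r => ∫ p in subDisc r, ⟪f p, g p⟫_ℂ ∂bergmanMeasure ℓ with hT
  have hlim : ∀ f g, Tendsto (T f g) (𝓝[<] 1) (𝓝 ⟪f, g⟫_ℂ) := tendsto_setIntegral_inner_subDisc
  have hconj : ∀ f g r, conj (T f g r) = T g f r := by
    intro f g r
    rw [hT, ← integral_conj]
    exact integral_congr_ae (Eventually.of_forall fun p => inner_conj_symm _ _)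
  have hr : ∀ᶠ r in 𝓝[<] (1 : ℝ), 0 ≤ r ∧ r < 1 := by
    filter_upwards [Ioo_mem_nhdsLT one_pos] with r hr using ⟨hr.1.le, hr.2⟩
  -- The monomials are orthogonal on every concentric disc, so a single Taylor term survives.
  have h1 : ∀ m r, 0 ≤ r → r < 1 → T (lpMono hℓ m) f r = a m * T (lpMono hℓ m) (lpMono hℓ m) r := by
    intro m r h0 h1
    have h2 := hasSum_single (f := fun n => conj (a n) * T (lpMono hℓ n) (lpMono hℓ m) r) m
      fun n hn => by rw [hT]; simp only [setIntegral_inner_lpMono hℓ r hn, mul_zero]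
    have h3 : T f (lpMono hℓ m) r = _ := (ha (lpMono hℓ m) r h0 h1).unique h2
    rw [← hconj, h3, map_mul, hconj, Complex.conj_conj]
  have h2 : ∀ m, ⟪lpMono hℓ m, f⟫_ℂ = a m * (‖lpMono hℓ m‖ ^ 2 : ℝ) := by
    intro m
    refine tendsto_nhds_unique (hlim _ _) ?_
    have h3 := (hlim (lpMono hℓ m) (lpMono hℓ m)).const_mul (a m)
    rw [inner_self_eq_norm_sq_to_K] at h3
    push_cast
    refine h3.congr' ?_
    filter_upwards [hr] with r h4
    exact (h1 m r h4.1 h4.2).symm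
  have h3 : ∀ m r, (T (lpMono hℓ m) (lpMono hℓ m) r).re ≤ ‖lpMono hℓ m‖ ^ 2 := by
    intro m r
    have hi := L2.integrable_inner (𝕜 := ℂ) (lpMono hℓ m) (lpMono hℓ m)
    have e1 : (T (lpMono hℓ m) (lpMono hℓ m) r).re = ∫ p in subDisc r,
      (⟪lpMono hℓ m p, lpMono hℓ m p⟫_ℂ).re ∂bergmanMeasure ℓ := (integral_re hi.integrableOn).symm
    have e2 : ‖lpMono hℓ m‖ ^ 2 = ∫ p, (⟪lpMono hℓ m p, lpMono hℓ m p⟫_ℂ).re ∂bergmanMeasure ℓ :=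
      (norm_sq_eq_re_inner (𝕜 := ℂ) _).trans (integral_re hi).symm
    rw [e1, e2]
    exact setIntegral_le_integral hi.re (Eventually.of_forall fun p =>
      inner_self_nonneg (𝕜 := ℂ) (x := lpMono hℓ m p))
  -- Bessel's inequality for the normalised monomials, applied to `x`.
  have h4 : ∀ s : Finset ℕ, ∑ m ∈ s, ‖a m‖ ^ 2 * ‖lpMono hℓ m‖ ^ 2 ≤ ‖x‖ ^ 2 := by
    intro s
    have ho : Orthonormal ℂ fun m => ((‖lpMono hℓ m‖⁻¹ : ℝ) : ℂ) • lpMono hℓ m := by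
      refine ⟨fun m => ?_, fun m n hmn => ?_⟩
      · rw [norm_smul, Complex.norm_real, norm_inv, norm_norm,
          inv_mul_cancel₀ (norm_ne_zero_iff.2 (lpMono_ne_zero hℓ m))]
      · dsimp only
        rw [inner_smul_left, inner_smul_right, inner_lpMono hℓ hmn, mul_zero, mul_zero]
    refine le_trans (le_of_eq (Finset.sum_congr rfl fun m _ => ?_)) (ho.sum_inner_products_le x (s := s))
    rw [inner_smul_left, hx, h2, norm_mul, RCLike.norm_conj, norm_mul, Complex.norm_real,
      Complex.norm_real, norm_inv, norm_norm, norm_pow, norm_norm]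
    have := norm_ne_zero_iff.2 (lpMono_ne_zero hℓ m)
    field_simp
  have h5 : ∀ r, 0 ≤ r → r < 1 → (T f f r).re ≤ ‖x‖ ^ 2 := by
    intro r hr0 hr1
    have h6 := Complex.hasSum_re (ha f r hr0 hr1)
    refine hasSum_le_of_sum_le h6 fun s => le_trans (Finset.sum_le_sum fun m _ => ?_) (h4 s)
    have h7 : conj (a m) * T (lpMono hℓ m) f r =
        ((‖a m‖ ^ 2 : ℝ) : ℂ) * T (lpMono hℓ m) (lpMono hℓ m) r := by
      rw [h1 m r hr0 hr1, ← mul_assoc, mul_comm (conj _), Complex.mul_conj, normSq_eq_norm_sq]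
    change (conj (a m) * T (lpMono hℓ m) f r).re ≤ _
    rw [h7, Complex.re_ofReal_mul]
    gcongr
    exact h3 m r
  have h6 := le_of_tendsto ((Complex.continuous_re.tendsto _).comp (hlim f f))
    (hr.mono fun r h => h5 r h.1 h.2)
  rw [inner_self_eq_norm_sq_to_K] at h6
  rw [← sq_le_sq₀ (norm_nonneg _) (norm_nonneg _)]
  exact_mod_cast h6

theorem inner_eq_zero_of_forall_norm_le {E : Type*} [NormedAddCommGroup E] [InnerProductSpace ℂ E]
    {f g : E} (h : ∀ c : ℂ, ‖f‖ ≤ ‖f - c • g‖) : ⟪g, f⟫_ℂ = 0 := by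
  have h1 := ((ℂ ∙ g).norm_eq_iInf_iff_inner_eq_zero (u := f) (zero_mem _)).1 (by
    rw [sub_zero]
    refine le_antisymm (le_ciInf fun w => ?_) ?_
    · obtain ⟨c, hc⟩ := Submodule.mem_span_singleton.1 w.2
      rw [← hc]
      exact h c
    · refine (ciInf_le ⟨0, ?_⟩ (0 : ℂ ∙ g)).trans (by simp)
      rintro _ ⟨w, rfl⟩
      exact norm_nonneg _) g (Submodule.mem_span_singleton_self g)
  rwa [sub_zero, inner_eq_zero_symm] at h1

/-- `f - c • g` has the same coefficients as `f`, hence at least its norm, for every `c`; this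
forces orthogonality. As `g` is any `L²` function, the result also applies to elements of the
closure `holSpace`. -/
theorem inner_eq_zero_of_mem_holL2 {ℓ : ℝ} (hℓ : 1 / 2 < ℓ) {f g : Lp ℂ 2 (bergmanMeasure ℓ)}
    (hf : f ∈ holL2 ℓ) (hg : ∀ n, ⟪lpMono hℓ n, g⟫_ℂ = 0) : ⟪g, f⟫_ℂ = 0 :=
  inner_eq_zero_of_forall_norm_le fun c => norm_le_of_inner_lpMono_eq hℓ hf fun n => by
    rw [inner_sub_right, inner_smul_right, hg, mul_zero, sub_zero]

/-! ### The discrete series -/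

theorem hasDerivAt_holMultiplier (ℓ : ℝ) (k : Fin 3) (n : ℕ) (p : Disc) :
    HasDerivAt (fun t => Complex.exp (-2 * ℓ * (expX k t).φ p) * mob (expX k t).g p ^ n)
      (![(I * (ℓ + n)) * (p : ℂ) ^ n, (-(ℓ + n / 2)) * (p : ℂ) ^ (n + 1) + n / 2 * (p : ℂ) ^ (n - 1),
        (I * (ℓ + n / 2)) * (p : ℂ) ^ (n + 1) + I * n / 2 * (p : ℂ) ^ (n - 1)] k) 0 := by
  have h := hasDerivAt_exp_mul_comp ((hasDerivAt_φ_expX k p).const_mul (-2 * ℓ : ℂ))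
    (hasDerivAt_mob_expX k (p : ℂ)) (by simp [expX_zero]) (by rw [expX_zero]; exact mob_one _)
    (hasDerivAt_pow n (p : ℂ))
  refine HasDerivAt.congr_deriv h ?_
  -- For `n = 0` the truncated exponent `n - 1` is harmless, since its coefficient vanishes.
  obtain _ | n := n
  · fin_cases k <;> simp <;> ring
  · fin_cases k <;> simp <;> ring

theorem hasDerivAt_of_subtype {E : Type*} [NormedAddCommGroup E] [InnerProductSpace ℂ E]
    {W : Submodule ℂ E} {γ : ℝ → W} {a : W} {t : ℝ}
    (h : HasDerivAt (fun t => (γ t : E)) (a : E) t) : HasDerivAt γ a t := by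
  rw [hasDerivAt_iff_isLittleO] at h ⊢
  refine Asymptotics.IsLittleO.of_norm_left ?_
  exact h.norm_left

/-- The monomial `conj z ^ n` as an element of the weighted `L²` space. -/
def lpConjMono {ℓ : ℝ} (hℓ : 1 / 2 < ℓ) (n : ℕ) : Lp ℂ 2 (bergmanMeasure ℓ) :=
  have := isFiniteMeasure_bergmanMeasure hℓ
  ContinuousMap.toLp 2 (bergmanMeasure ℓ) ℂ (star (discMono n))

theorem lpConjMono_coeFn {ℓ : ℝ} (hℓ : 1 / 2 < ℓ) (n : ℕ) :
    lpConjMono hℓ n =ᵐ[bergmanMeasure ℓ] fun p => conj (discMono n p) :=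
  have := isFiniteMeasure_bergmanMeasure hℓ
  ContinuousMap.coeFn_toLp (p := 2) (𝕜 := ℂ) _ _

theorem star_lpConjMono {ℓ : ℝ} (hℓ : 1 / 2 < ℓ) (n : ℕ) : star (lpConjMono hℓ n) = lpMono hℓ n := by
  refine Lp.ext ?_
  filter_upwards [Lp.coeFn_star (lpConjMono hℓ n), lpConjMono_coeFn hℓ n, lpMono_coeFn hℓ n]
    with p h1 h2 h3
  rw [h1, h3, Pi.star_apply, h2]
  exact Complex.conj_conj _

/-- Complex conjugation is antiunitary and carries antiholomorphic functions to holomorphic ones, so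
orthogonality statements transfer from `holL2` to `antiL2`. -/
theorem inner_star_star {ℓ : ℝ} (f g : Lp ℂ 2 (bergmanMeasure ℓ)) :
    ⟪star f, star g⟫_ℂ = conj ⟪f, g⟫_ℂ := by
  rw [L2.inner_def, L2.inner_def, ← integral_conj]
  refine integral_congr_ae ?_
  filter_upwards [Lp.coeFn_star f, Lp.coeFn_star g] with p h1 h2
  rw [h1, h2, RCLike.inner_apply', RCLike.inner_apply', map_mul]
  rfl

theorem star_mem_holL2 {ℓ : ℝ} {f : Lp ℂ 2 (bergmanMeasure ℓ)} (hf : f ∈ antiL2 ℓ) :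
    star f ∈ holL2 ℓ := by
  obtain ⟨F, hF, h⟩ := hf
  refine ⟨F, hF, ?_⟩
  filter_upwards [h, Lp.coeFn_star f] with p h1 h2
  rw [h2, Pi.star_apply, h1]
  exact Complex.conj_conj _

theorem lpConjMono_mem_antiL2 {ℓ : ℝ} (hℓ : 1 / 2 < ℓ) (n : ℕ) : lpConjMono hℓ n ∈ antiL2 ℓ :=
  ⟨fun z => z ^ n, (differentiable_id.pow n).differentiableOn, lpConjMono_coeFn hℓ n⟩

theorem lpConjMono_ne_zero {ℓ : ℝ} (hℓ : 1 / 2 < ℓ) (n : ℕ) : lpConjMono hℓ n ≠ 0 := by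
  intro h
  refine lpMono_ne_zero hℓ n ((inner_self_eq_zero (𝕜 := ℂ)).1 ?_)
  rw [← star_lpConjMono, inner_star_star, h, inner_zero_left, map_zero]

theorem inner_eq_zero_of_mem_antiL2 {ℓ : ℝ} (hℓ : 1 / 2 < ℓ) {f g : Lp ℂ 2 (bergmanMeasure ℓ)}
    (hf : f ∈ antiL2 ℓ) (hg : ∀ n, ⟪lpConjMono hℓ n, g⟫_ℂ = 0) : ⟪g, f⟫_ℂ = 0 := by
  have h := inner_eq_zero_of_mem_holL2 hℓ (star_mem_holL2 hf) (g := star g) fun n => by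
    rw [← star_lpConjMono, inner_star_star, hg, map_zero]
  rwa [inner_star_star, map_eq_zero] at h

theorem hasDerivAt_hom_lpMono {ℓ : ℝ} (hℓ : 1 / 2 < ℓ) (k : Fin 3) (n : ℕ) :
    have := isFiniteMeasure_bergmanMeasure hℓ
    HasDerivAt (fun t => (holMultiplier ℓ).rep.hom (expX k t)⁻¹ (lpMono hℓ n))
      (![(I * (ℓ + n)) • lpMono hℓ n,
        (-(ℓ + n / 2) : ℂ) • lpMono hℓ (n + 1) + (n / 2 : ℂ) • lpMono hℓ (n - 1),
        (I * (ℓ + n / 2)) • lpMono hℓ (n + 1) + (I * n / 2) • lpMono hℓ (n - 1)] k) 0 := by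
  intro _
  let F : Fin 3 → C(Disc, ℂ) := ![(I * (ℓ + n)) • discMono n,
    (-(ℓ + n / 2) : ℂ) • discMono (n + 1) + (n / 2 : ℂ) • discMono (n - 1),
    (I * (ℓ + n / 2)) • discMono (n + 1) + (I * n / 2) • discMono (n - 1)]
  have h := (holMultiplier ℓ).hasDerivAt_hom_toLp k (discMono n) (F k) fun p =>
    (hasDerivAt_holMultiplier ℓ k n p).congr_deriv (by
      fin_cases k <;> simp [F, discMono_apply])
  refine h.congr_deriv ?_
  fin_cases k <;> simp [F, lpMono]

theorem hasDerivAt_hom_lpConjMono {ℓ : ℝ} (hℓ : 1 / 2 < ℓ) (k : Fin 3) (n : ℕ) :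
    have := isFiniteMeasure_bergmanMeasure hℓ
    HasDerivAt (fun t => (antiMultiplier ℓ).rep.hom (expX k t)⁻¹ (lpConjMono hℓ n))
      (![(-I * (ℓ + n)) • lpConjMono hℓ n,
        (-(ℓ + n / 2) : ℂ) • lpConjMono hℓ (n + 1) + (n / 2 : ℂ) • lpConjMono hℓ (n - 1),
        (-I * (ℓ + n / 2)) • lpConjMono hℓ (n + 1) + (-I * n / 2) • lpConjMono hℓ (n - 1)] k) 0 := by
  intro _
  let F : Fin 3 → C(Disc, ℂ) := ![(-I * (ℓ + n)) • star (discMono n),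
    (-(ℓ + n / 2) : ℂ) • star (discMono (n + 1)) + (n / 2 : ℂ) • star (discMono (n - 1)),
    (-I * (ℓ + n / 2)) • star (discMono (n + 1)) + (-I * n / 2) • star (discMono (n - 1))]
  have h := (antiMultiplier ℓ).hasDerivAt_hom_toLp k (star (discMono n)) (F k) fun p => by
    have h1 := hasDerivAt_conj (hasDerivAt_holMultiplier ℓ k n p)
    simp only [map_mul, ← Complex.exp_conj, map_neg, Complex.conj_ofReal, map_ofNat] at h1
    refine HasDerivAt.congr_deriv h1 ?_
    fin_cases k <;> simp [F, discMono_apply, map_ofNat]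
  refine h.congr_deriv ?_
  fin_cases k <;> simp [F, lpConjMono]

/-- The monomials `z ^ n` in the weighted Bergman space, extended by zero to negative `n`. -/
def holBasis {ℓ : ℝ} (hℓ : 1 / 2 < ℓ) (n : ℤ) : holSpace ℓ :=
  if 0 ≤ n then ⟨lpMono hℓ n.toNat, subset_closure (lpMono_mem_holL2 hℓ _)⟩ else 0

theorem holBasis_natCast {ℓ : ℝ} (hℓ : 1 / 2 < ℓ) (n : ℕ) :
    (holBasis hℓ n : Lp ℂ 2 (bergmanMeasure ℓ)) = lpMono hℓ n := by
  rw [holBasis, if_pos (Int.natCast_nonneg n)]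
  exact congrArg (lpMono hℓ) (Int.toNat_natCast n)

theorem holBasis_eq_zero_iff {ℓ : ℝ} (hℓ : 1 / 2 < ℓ) (n : ℤ) : holBasis hℓ n = 0 ↔ n < 0 := by
  refine ⟨fun h => ?_, fun h => if_neg (not_le.2 h)⟩
  by_contra hn
  obtain ⟨k, rfl⟩ := Int.eq_ofNat_of_zero_le (not_lt.1 hn)
  exact lpMono_ne_zero hℓ k (by rw [← holBasis_natCast, h, Submodule.coe_zero])

/-- The monomials `conj z ^ (-n)`, extended by zero to positive `n`. -/
def antiBasis {ℓ : ℝ} (hℓ : 1 / 2 < ℓ) (n : ℤ) : antiSpace ℓ :=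
  if 0 ≤ -n then ⟨lpConjMono hℓ (-n).toNat, subset_closure (lpConjMono_mem_antiL2 hℓ _)⟩ else 0

theorem antiBasis_neg_natCast {ℓ : ℝ} (hℓ : 1 / 2 < ℓ) (n : ℕ) :
    (antiBasis hℓ (-n) : Lp ℂ 2 (bergmanMeasure ℓ)) = lpConjMono hℓ n := by
  rw [antiBasis, if_pos (by omega)]
  exact congrArg (lpConjMono hℓ) (by omega)

theorem antiBasis_eq_zero_iff {ℓ : ℝ} (hℓ : 1 / 2 < ℓ) (n : ℤ) : antiBasis hℓ n = 0 ↔ 0 < n := by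
  refine ⟨fun h => ?_, fun h => if_neg (by omega)⟩
  by_contra hn
  obtain ⟨k, rfl⟩ : ∃ k : ℕ, n = -k := ⟨(-n).toNat, by omega⟩
  exact lpConjMono_ne_zero hℓ k (by rw [← antiBasis_neg_natCast, h, Submodule.coe_zero])

/-- Orthogonality to `W` extends to its closure, which contains `v` itself. -/
theorem eq_zero_of_inner_eq_zero {E : Type*} [NormedAddCommGroup E] [InnerProductSpace ℂ E]
    {W : Submodule ℂ E} (v : W.topologicalClosure) (h : ∀ f ∈ W, ⟪(v : E), f⟫_ℂ = 0) : v = 0 := by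
  have h1 : W ≤ (ℂ ∙ (v : E))ᗮ := fun f hf => Submodule.mem_orthogonal_singleton_iff_inner_right.2
    (h f hf)
  have h2 := W.topologicalClosure_minimal h1 (Submodule.isClosed_orthogonal _) v.2
  rw [Submodule.mem_orthogonal_singleton_iff_inner_right, inner_self_eq_zero] at h2
  exact Subtype.ext h2

/-- `z ^ n` has weight `x = n + ℓ`. With `s = ℓ`, the raising coefficient `-(ℓ + n/2)` is `-(x +
s)/2` and the lowering coefficient `n/2` is `(x - s)/2`; the latter vanishes at the bottom `n = 0`.
-/
theorem isLadder_discretePlus {ℓ : ℝ} (hℓ : 1 / 2 < ℓ) :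
    IsLadder (discretePlus ℓ hℓ) (holBasis hℓ) ℓ ℓ where
  total v h := eq_zero_of_inner_eq_zero v fun f hf => inner_eq_zero_of_mem_holL2 hℓ hf fun n => by
    rw [← holBasis_natCast]
    exact h n
  bot n h h1 := by
    rw [Ne, holBasis_eq_zero_iff] at h
    rw [holBasis_eq_zero_iff] at h1
    obtain rfl : n = 0 := by omega
    simp
  top n h h1 := by
    rw [Ne, holBasis_eq_zero_iff] at h
    rw [holBasis_eq_zero_iff] at h1
    omega
  rot n := by
    rcases lt_or_ge n 0 with hn | hn
    · rw [(holBasis_eq_zero_iff hℓ n).2 hn, map_zero, smul_zero]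
    obtain ⟨n, rfl⟩ := Int.eq_ofNat_of_zero_le hn
    have := isFiniteMeasure_bergmanMeasure hℓ
    refine Subtype.ext ?_
    rw [Submodule.coe_smul, holBasis_natCast]
    change (holMultiplier ℓ).rep.hom (expX 0 1)⁻¹ _ = _
    rw [holBasis_natCast]
    refine (Multiplier.hom_inv_toLp _ _ _).trans ?_
    rw [lpMono, ← map_smul]
    congr 1
    ext z
    change Complex.exp (-2 * ℓ * -((1 / 2 : ℝ) * I)) * (mob (mat0 1) z) ^ n =
      Complex.exp ((((n : ℤ) + ℓ : ℝ) : ℂ) * I) * (z : ℂ) ^ n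
    rw [mob_mat0, mul_pow, ← Complex.exp_nat_mul, ← mul_assoc, ← Complex.exp_add]
    congr 2
    push_cast
    ring
  deriv n hn := by
    rw [Ne, holBasis_eq_zero_iff, not_lt] at hn
    obtain ⟨n, rfl⟩ := Int.eq_ofNat_of_zero_le hn
    refine exists_deriv_of_hasDerivAt fun k => hasDerivAt_of_subtype ?_
    have h := hasDerivAt_hom_lpMono hℓ k n
    simp only [← holBasis_natCast] at h
    refine h.congr_deriv ?_
    obtain _ | n := n
    · fin_cases k <;> simp [-Complex.coe_smul] <;> module
    · have h1 : ((n + 1 : ℕ) : ℤ) + 1 = (n + 1 + 1 : ℕ) := by push_cast; ring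
      have h2 : ((n + 1 : ℕ) : ℤ) - 1 = n := by push_cast; ring
      fin_cases k <;> simp only [h1, h2, Nat.add_sub_cancel, Submodule.coe_add, Submodule.coe_smul,
        Fin.zero_eta, Fin.mk_one, Fin.reduceFinMk, Matrix.cons_val] <;> push_cast <;> module

/-- `conj z ^ n` sits at index `-n` and has weight `x = -(n + ℓ)`, so raising the index lowers the
exponent. With the same `s = ℓ` the ladder stops at the top, where `x + s = 0`. -/
theorem isLadder_discreteMinus {ℓ : ℝ} (hℓ : 1 / 2 < ℓ) :
    IsLadder (discreteMinus ℓ hℓ) (antiBasis hℓ) (-ℓ) ℓ where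
  total v h := eq_zero_of_inner_eq_zero v fun f hf => inner_eq_zero_of_mem_antiL2 hℓ hf fun n => by
    rw [← antiBasis_neg_natCast]
    exact h _
  bot n h h1 := by
    rw [Ne, antiBasis_eq_zero_iff] at h
    rw [antiBasis_eq_zero_iff] at h1
    omega
  top n h h1 := by
    rw [Ne, antiBasis_eq_zero_iff] at h
    rw [antiBasis_eq_zero_iff] at h1
    obtain rfl : n = 0 := by omega
    simp
  rot n := by
    rcases lt_or_ge 0 n with hn | hn
    · rw [(antiBasis_eq_zero_iff hℓ n).2 hn, map_zero, smul_zero]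
    obtain ⟨n, rfl⟩ : ∃ k : ℕ, n = -k := ⟨(-n).toNat, by omega⟩
    have := isFiniteMeasure_bergmanMeasure hℓ
    refine Subtype.ext ?_
    rw [Submodule.coe_smul, antiBasis_neg_natCast]
    change (antiMultiplier ℓ).rep.hom (expX 0 1)⁻¹ _ = _
    rw [antiBasis_neg_natCast]
    refine (Multiplier.hom_inv_toLp _ _ _).trans ?_
    rw [lpConjMono, ← map_smul]
    congr 1
    ext z
    change Complex.exp (-2 * ℓ * conj (-((1 / 2 : ℝ) * I))) * conj ((mob (mat0 1) z) ^ n) =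
      Complex.exp ((((-n : ℤ) + -ℓ : ℝ) : ℂ) * I) * conj ((z : ℂ) ^ n)
    rw [mob_mat0, mul_pow, ← Complex.exp_nat_mul, map_mul, ← Complex.exp_conj, ← mul_assoc,
      ← Complex.exp_add]
    congr 2
    simp [map_ofNat]
    ring
  deriv n hn := by
    rw [Ne, antiBasis_eq_zero_iff, not_lt] at hn
    obtain ⟨n, rfl⟩ : ∃ k : ℕ, n = -k := ⟨(-n).toNat, by omega⟩
    refine exists_deriv_of_hasDerivAt fun k => hasDerivAt_of_subtype ?_
    have h := hasDerivAt_hom_lpConjMono hℓ k n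
    simp only [← antiBasis_neg_natCast] at h
    refine h.congr_deriv ?_
    obtain _ | n := n
    · fin_cases k <;> simp [-Complex.coe_smul] <;> module
    · have h1 : -((n + 1 : ℕ) : ℤ) + 1 = -(n : ℤ) := by push_cast; ring
      have h2 : -((n + 1 : ℕ) : ℤ) - 1 = -((n + 1 + 1 : ℕ) : ℤ) := by push_cast; ring
      fin_cases k <;> simp only [h1, h2, Nat.add_sub_cancel, Submodule.coe_add, Submodule.coe_smul,
        Fin.zero_eta, Fin.mk_one, Fin.reduceFinMk, Matrix.cons_val] <;> push_cast <;> module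

/-! ### Reading off the spectra -/

theorem ladderSpectrum_principal {e : ℤ → Lp ℂ 2 circleMeasure} (he : ∀ n, e n ≠ 0) (τ q : ℝ) :
    (fun r : ℝ => (r : ℂ)) '' ladderSpectrum e τ q = {z : ℂ | ∃ k : ℤ,
      z = ((-1 / 2 + √(1 / 4 + q + 2 * (τ + k) * (τ + k - 1)) : ℝ) : ℂ) ∨
      z = ((-1 / 2 - √(1 / 4 + q + 2 * (τ + k) * (τ + k - 1)) : ℝ) : ℂ)} := by
  ext z
  constructor
  · rintro ⟨r, (⟨n, -, -, h⟩ | ⟨n, -, h, -⟩) | ⟨n, h, -, -⟩, rfl⟩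
    · refine ⟨n, ?_⟩
      rw [add_comm τ n]
      exact h.imp (congrArg _) (congrArg _)
    · exact absurd h (he _)
    · exact absurd h (he _)
  · rintro ⟨n, h⟩
    rw [add_comm τ n] at h
    rcases h with h | h
    · exact ⟨_, Or.inl (Or.inl ⟨n, he _, he _, Or.inl rfl⟩), h.symm⟩
    · exact ⟨_, Or.inl (Or.inl ⟨n, he _, he _, Or.inr rfl⟩), h.symm⟩

theorem ladderSpectrum_holBasis {ℓ : ℝ} (hℓ : 1 / 2 < ℓ) (q : ℝ) :
    (fun r : ℝ => (r : ℂ)) '' ladderSpectrum (holBasis hℓ) ℓ q =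
      {((-ℓ : ℝ) : ℂ)} ∪ {z : ℂ | ∃ k : ℕ, 1 ≤ k ∧
        (z = ((-1 / 2 + √(1 / 4 + q + 2 * (ℓ + k) * (ℓ + k - 1)) : ℝ) : ℂ) ∨
          z = ((-1 / 2 - √(1 / 4 + q + 2 * (ℓ + k) * (ℓ + k - 1)) : ℝ) : ℂ))} := by
  simp only [ladderSpectrum, Ne, holBasis_eq_zero_iff]
  ext z
  constructor
  · rintro ⟨r, (⟨n, -, h1, h⟩ | ⟨n, h0, h1, h⟩) | ⟨n, h0, h1, -⟩, rfl⟩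
    · right
      obtain ⟨k, rfl⟩ := Int.eq_ofNat_of_zero_le (show 0 ≤ n by omega)
      refine ⟨k, by omega, ?_⟩
      rw [add_comm ℓ k]
      rw [Int.cast_natCast] at h
      exact h.imp (congrArg _) (congrArg _)
    · left
      obtain rfl : n = 0 := by omega
      rw [h]
      simp
    · omega
  · rintro (rfl | ⟨k, hk, h⟩)
    · exact ⟨-ℓ, Or.inl (Or.inr ⟨0, by simp, by simp, by simp⟩), rfl⟩
    · rw [add_comm ℓ k, ← Int.cast_natCast] at h
      rcases h with h | h
      · exact ⟨_, Or.inl (Or.inl ⟨k, by omega, by omega, Or.inl rfl⟩), h.symm⟩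
      · exact ⟨_, Or.inl (Or.inl ⟨k, by omega, by omega, Or.inr rfl⟩), h.symm⟩

/-- The reflection `n ↦ 1 - n` sends `x` to `1 - x`, which fixes `x(x - 1)` and swaps the two
components of a pair. The top end at `n = 1` corresponds to the bottom end at `n = 0`, both with
eigenvalue `-ℓ`. -/
theorem ladderSpectrum_antiBasis {ℓ : ℝ} (hℓ : 1 / 2 < ℓ) (q : ℝ) :
    ladderSpectrum (antiBasis hℓ) (-ℓ) q = ladderSpectrum (holBasis hℓ) ℓ q := by
  have key : ∀ n : ℤ, 2 * (n + -ℓ) * (n + -ℓ - 1) =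
      2 * (((1 - n : ℤ) : ℝ) + ℓ) * (((1 - n : ℤ) : ℝ) + ℓ - 1) := fun n => by
    push_cast; ring
  simp only [ladderSpectrum, Ne, holBasis_eq_zero_iff, antiBasis_eq_zero_iff, key]
  ext r
  constructor
  · rintro ((⟨n, h0, h1, h⟩ | ⟨n, h0, h1, -⟩) | ⟨n, h0, h1, h⟩)
    · exact Or.inl (Or.inl ⟨1 - n, by omega, by omega, h⟩)
    · omega
    · obtain rfl : n = 1 := by omega
      exact Or.inl (Or.inr ⟨0, by omega, by omega, by rw [h]; simp⟩)
  · rintro ((⟨n, h0, h1, h⟩ | ⟨n, h0, h1, h⟩) | ⟨n, h0, h1, -⟩)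
    · refine Or.inl (Or.inl ⟨1 - n, by omega, by omega, ?_⟩)
      rwa [sub_sub_cancel]
    · obtain rfl : n = 0 := by omega
      exact Or.inr ⟨1, by omega, by omega, by rw [h]; simp⟩
    · omega

theorem localSpectrum_discretePlus (μ : Measure Cover) [μ.IsHaarMeasure] {ℓ : ℝ} (hℓ : 1 / 2 < ℓ) :
    localSpectrum μ (discretePlus ℓ hℓ) =
      (fun r : ℝ => (r : ℂ)) '' ladderSpectrum (holBasis hℓ) ℓ (ℓ * (1 - ℓ)) := by
  refine (isLadder_discretePlus hℓ).localSpectrum_eq μ (by push_cast; ring) fun n hn => ?_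
  simp only [Ne, holBasis_eq_zero_iff] at hn
  have h : (0 : ℝ) ≤ n := by exact_mod_cast (show 0 ≤ n by omega)
  have h1 : 0 ≤ (n : ℝ) * (n - 1) := by
    rcases eq_or_lt_of_le (show 0 ≤ n by omega) with h2 | h2
    · simp [← h2]
    · have : (1 : ℝ) ≤ n := by exact_mod_cast h2
      nlinarith
  -- The radicand equals `2n(n - 1) + 4nℓ + (ℓ - 1/2)²`.
  nlinarith [mul_nonneg h (show (0 : ℝ) ≤ ℓ by linarith), sq_nonneg (ℓ - 1 / 2)]

theorem localSpectrum_discreteMinus (μ : Measure Cover) [μ.IsHaarMeasure] {ℓ : ℝ} (hℓ : 1 / 2 < ℓ) :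
    localSpectrum μ (discreteMinus ℓ hℓ) =
      (fun r : ℝ => (r : ℂ)) '' ladderSpectrum (holBasis hℓ) ℓ (ℓ * (1 - ℓ)) := by
  rw [← ladderSpectrum_antiBasis]
  refine (isLadder_discreteMinus hℓ).localSpectrum_eq μ (by push_cast; ring) fun n hn => ?_
  simp only [Ne, antiBasis_eq_zero_iff] at hn
  have h : (n : ℝ) ≤ 1 := by exact_mod_cast (show n ≤ 1 by omega)
  have h1 : 0 ≤ (n : ℝ) * (n - 1) := by
    rcases eq_or_lt_of_le (show n ≤ 1 by omega) with h2 | h2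
    · simp [h2]
    · have : (n : ℝ) ≤ 0 := by exact_mod_cast (show n ≤ 0 by omega)
      nlinarith
  -- The radicand equals `2n(n - 1) + 4(1 - n)ℓ + (ℓ - 1/2)²`.
  nlinarith [mul_nonneg (sub_nonneg.2 h) (show (0 : ℝ) ≤ ℓ by linarith), sq_nonneg (ℓ - 1 / 2)]

theorem localSpectrum_principalSeries (μ : Measure Cover) [μ.IsHaarMeasure] {q : ℝ}
    (hq : 1 / 4 ≤ q) (τ : ℝ) :
    localSpectrum μ (principalSeries q τ) = (fun r : ℝ => (r : ℂ)) ''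
      ladderSpectrum (fun n => ContinuousMap.toLp 2 circleMeasure ℂ (circMono n)) τ q := by
  refine (isLadder_principalSeries q τ).localSpectrum_eq μ ?_ fun n _ => ?_
  · have h : ((√(q - 1 / 4) : ℝ) : ℂ) ^ 2 = q - 1 / 4 := by
      rw [← Complex.ofReal_pow, Real.sq_sqrt (by linarith)]
      push_cast
      rfl
    linear_combination h - ((√(q - 1 / 4) : ℝ) : ℂ) ^ 2 * I_sq
  -- With `x = n + τ` the radicand is `(q - 1/4) + 2(x - 1/2)²`.
  · nlinarith [sq_nonneg ((n : ℝ) + τ - 1 / 2)]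

end SL2Dirac

end

theorem theorem3p2 (μ : MeasureTheory.Measure SL2Dirac.Cover) [μ.IsHaarMeasure] :
    (∀ q τ : ℝ, 1 / 4 ≤ q → 0 ≤ τ → τ ≤ 1 →
      SL2Dirac.localSpectrum μ (SL2Dirac.principalSeries q τ) =
        {z : ℂ | ∃ k : ℤ,
          z = ((-1 / 2 + √(1 / 4 + q + 2 * (τ + k) * (τ + k - 1)) : ℝ) : ℂ) ∨
          z = ((-1 / 2 - √(1 / 4 + q + 2 * (τ + k) * (τ + k - 1)) : ℝ) : ℂ)}) ∧
    (∀ (ℓ : ℝ) (hℓ : 1 / 2 < ℓ),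
      SL2Dirac.localSpectrum μ (SL2Dirac.discretePlus ℓ hℓ) =
        SL2Dirac.localSpectrum μ (SL2Dirac.discreteMinus ℓ hℓ) ∧
      SL2Dirac.localSpectrum μ (SL2Dirac.discretePlus ℓ hℓ) =
        {((-ℓ : ℝ) : ℂ)} ∪ {z : ℂ | ∃ k : ℕ, 1 ≤ k ∧
          (z = ((-1 / 2 + √(1 / 4 + ℓ * (1 - ℓ) + 2 * (ℓ + k) * (ℓ + k - 1)) : ℝ) : ℂ) ∨
            z = ((-1 / 2 - √(1 / 4 + ℓ * (1 - ℓ) + 2 * (ℓ + k) * (ℓ + k - 1)) : ℝ) : ℂ))}) := by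
  refine ⟨fun q τ hq _ _ => ?_, fun ℓ hℓ => ⟨?_, ?_⟩⟩
  · rw [SL2Dirac.localSpectrum_principalSeries μ hq,
      SL2Dirac.ladderSpectrum_principal SL2Dirac.toLp_circMono_ne_zero]
  · rw [SL2Dirac.localSpectrum_discretePlus, SL2Dirac.localSpectrum_discreteMinus]
  · rw [SL2Dirac.localSpectrum_discretePlus, SL2Dirac.ladderSpectrum_holBasis]
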